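/- For $m,k\ge 1$ let $\phi_m(k)$ be the least positive integer such that $k\,\phi_m(k)$ is an $m$-th power, and put $\phi_m(0)=1$. Call a function $H$ on a set of rational points *Northcott* if $\{P: H(P)\le T\}$ is finite for every $T$. Call a function $H$ on the $\overline{\mathbb Q}$-points of a curve *strongly Northcott* if $\{P : H(P)\le T,\ [\mathbb Q(P):\mathbb Q]\le D\}$ is finite for all positive $T,D$. **(1) Coarse space $\mathbb P^1$.** Let $n\ge 0$, let $a_i=[\alpha_i:\beta_i]$ $(1\le i\le n)$ be distinct points of $\mathbb P^1(\mathbb Q)$ with $\alpha_i,\beta_i$ coprime integers, and let $m_i\ge 2$ be integers. Let $\mathfrak X=\mathfrak X(\mathbb P^1:(a_1,m_1),\dots,(a_n,m_n))$ be the corresponding stacky curve, whose rational points are those of $\mathbb P^1$, and let $$\chi(\mathfrak X)=\delta(\mathbf m)=2-\sum_{i=1}^n\Bigl(1-\frac1{m_i}\Bigr).$$ Its anti-canonical height is, for coprime integers $x,y$, $$H_{-K_{\mathfrak X}}([x:y])=\max(|x|,|y|)^{\chi(\mathfrak X)}\prod_{i=1}^n\phi_{m_i}\bigl(|\alpha_i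 y-\beta_i x|\bigr)^{1/m_i}.$$ For $P\in\mathbb P^1(\overline{\mathbb Q})$ with homogeneous coordinates $x,y$ in the ring of integers of $K=\mathbb Q(P)$, put $$H_{-K_{\mathfrak X}}(P)=H_K([x:y])^{\chi(\mathfrak X)}\prod_{i=1}^n\phi_{m_i}(\lambda_i(P))^{1/m_i},\qquad \lambda_i(P)=\mathrm N\bigl((\alpha_iy-\beta_ix)\,(x,y)^{-1}\bigr),$$ where $H_K$ is the Weil height relative to $K$ and $\mathrm N$ is the norm of ideals of $\mathcal O_K$ (with $\mathrm N(0)=0$). - If $\chi(\mathfrak X)\le 0$, then the height $H_{-K_{\mathfrak X}}$ on $\mathbb P^1(\mathbb Q)$ is not Northcott. - The height $H_{-K_{\mathfrak X}}$ on $\mathbb P^1(\mathbb Q)$ is Northcott if and only if $\chi(\mathfrak X)>0$. - The height $H_{-K_{\mathfrak X}}$ on $\mathbb P^1(\overline{\mathbb Q})$ is strongly Northcott if and only if $\chi(\mathfrak X)>0$. **(2) Curves.** Let $C$ be a smooth projective geometrically integral curve over $\mathbb Q$ with canonical divisor $K_C$, let $\chi(C)=\deg(-K_C)$, and let $H$ be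 any multiplicative absolute Weil height on $C(\overline{\mathbb Q})$ associated with $-K_C$. Then $H$ is strongly Northcott if and only if $\chi(C)>0$. -/

import Mathlib

open AlgebraicGeometry CategoryTheory

namespace StackyCurve

noncomputable section

/-- The algebraic closure of the field of rational numbers. -/
abbrev Qbar : Type := AlgebraicClosure ℚ

instance : Algebra.IsAlgebraic ℚ Qbar := by
  have h := AlgebraicClosure.isAlgebraic ℚ
  have e : (DivisionRing.toRatAlgebra : Algebra ℚ Qbar) = AlgebraicClosure.instAlgebra ℚ :=
    Subsingleton.elim _ _
  rw [e]
  exact h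

/-- The strong Northcott property of a height function `H` on a set of algebraic points, where
`deg P` is the degree over `ℚ` of the field of definition of `P`: there are only finitely many
points of bounded height and bounded degree. -/
def StrongNorthcott {α : Type*} (deg : α → ℕ) (H : α → ℝ) : Prop :=
  ∀ (T : ℝ) (D : ℕ), 0 < T → 0 < D → {P : α | H P ≤ T ∧ deg P ≤ D}.Finite

/-! ### Stacky curves with coarse space the projective line -/

/-- The `ℚ`-points of the projective line. -/
abbrev P1Q : Type := Projectivization ℚ (Fin 2 → ℚ)

/-- The algebraic points of the projective line. -/
abbrev P1Qbar : Type := Projectivization Qbar (Fin 2 → Qbar)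

/-- `phi m n` is the least positive integer `k` such that `n * k` is a perfect `m`-th power. -/
def phi (m n : ℕ) : ℕ := sInf {k : ℕ | 0 < k ∧ ∃ r : ℕ, n * k = r ^ m}

/-- The Euler characteristic `2 - ∑ (1 - 1 / mᵢ)` of the stacky curve with coarse space `ℙ¹` and
stacky points of multiplicities `mᵢ`. -/
def eulerChar {n : ℕ} (m : Fin n → ℕ) : ℝ := 2 - ∑ i, (1 - 1 / (m i : ℝ))

/-- Every rational point of the projective line has coprime integral homogeneous coordinates. -/
theorem exists_coprime_coords (P : P1Q) :
    ∃ v : Fin 2 → ℤ, IsCoprime (v 0) (v 1) ∧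
      ∃ c : ℚ, c ≠ 0 ∧ ∀ i, P.rep i = c * (v i : ℚ) := by
  have h := P.rep_nonzero
  set x := P.rep 0 with hx
  set y := P.rep 1 with hy
  by_cases h0 : y = 0
  · refine ⟨![1, 0], isCoprime_one_left, x, ?_, ?_⟩
    · intro h1
      apply h
      ext i
      fin_cases i <;> simp [← hx, ← hy, h0, h1]
    · intro i
      fin_cases i <;> simp [← hx, ← hy, h0]
  · refine ⟨![(x / y).num, (x / y).den], ?_, y / (x / y).den, ?_, ?_⟩
    · simpa using Rat.isCoprime_num_den (x / y)
    · have := (x / y).den_ne_zero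
      positivity
    · have h2 : ((x / y).den : ℚ) ≠ 0 := by exact_mod_cast (x / y).den_ne_zero
      have h3 : x / y = (x / y).num / (x / y).den := (Rat.num_div_den _).symm
      intro i
      fin_cases i
      · simp only [Fin.zero_eta, Matrix.cons_val_zero, ← hx]
        rw [div_mul_eq_mul_div, mul_div_assoc, ← h3]
        field_simp
      · simp [← hy]

/-- Coprime integral homogeneous coordinates of a rational point of the projective line; they are
unique up to a common sign. -/
def coords (P : P1Q) : Fin 2 → ℤ := (exists_coprime_coords P).choose

/-- The anti-canonical height of `[x : y]`, for coprime integers `x` and `y`, on the stacky curve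
with coarse space `ℙ¹`, stacky points `a i = [αᵢ : βᵢ]` (with `αᵢ`, `βᵢ` coprime integers)
and multiplicities `m i`. -/
def antiCanHeight {n : ℕ} (a : Fin n → P1Q) (m : Fin n → ℕ) (P : P1Q) : ℝ :=
  (max |coords P 0| |coords P 1| : ℝ) ^ eulerChar m *
    ∏ i, (phi (m i) (coords (a i) 0 * coords P 1 - coords (a i) 1 * coords P 0).natAbs : ℝ) ^
      (1 / (m i : ℝ))

/-- The field of definition `ℚ(P)` of an algebraic point of the projective line, generated by
the quotients of its homogeneous coordinates. -/
def fieldOfDef (P : P1Qbar) : IntermediateField ℚ Qbar :=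
  IntermediateField.adjoin ℚ (Set.range fun p : Fin 2 × Fin 2 => P.rep p.1 / P.rep p.2)

instance (P : P1Qbar) : NumberField (fieldOfDef P) where
  to_finiteDimensional := by
    unfold fieldOfDef
    exact IntermediateField.finiteDimensional_adjoin
      fun x _ => (Algebra.IsAlgebraic.isAlgebraic x).isIntegral

open NumberField in
/-- Every algebraic point of the projective line has homogeneous coordinates that are integers of
its field of definition. -/
theorem exists_integral_coords (P : P1Qbar) :
    ∃ v : Fin 2 → 𝓞 (fieldOfDef P), ∃ c : Qbar, c ≠ 0 ∧
      ∀ i, P.rep i = c * ((v i : fieldOfDef P) : Qbar) := by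
  obtain ⟨j, hj⟩ : ∃ j, P.rep j ≠ 0 := by
    by_contra! h
    exact P.rep_nonzero (funext h)
  let w : Fin 2 → fieldOfDef P := fun i =>
    ⟨P.rep i / P.rep j, IntermediateField.subset_adjoin ℚ _ ⟨(i, j), rfl⟩⟩
  obtain ⟨b, hb⟩ := IsLocalization.exist_integer_multiples (nonZeroDivisors (𝓞 (fieldOfDef P)))
    Finset.univ w
  choose v hv using fun i => hb i (Finset.mem_univ i)
  have hb0 : ((b : 𝓞 (fieldOfDef P)) : fieldOfDef P) ≠ 0 := by
    simp
  have hb1 : (((b : 𝓞 (fieldOfDef P)) : fieldOfDef P) : Qbar) ≠ 0 := by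
    simp
  refine ⟨v, P.rep j / (((b : 𝓞 (fieldOfDef P)) : fieldOfDef P) : Qbar),
    div_ne_zero hj hb1, fun i => ?_⟩
  have h1 := congrArg (fun z : fieldOfDef P => (z : Qbar)) (hv i)
  simp only [Algebra.smul_def, w] at h1
  have h2 : ((v i : fieldOfDef P) : Qbar) =
    (((b : 𝓞 (fieldOfDef P)) : fieldOfDef P) : Qbar) * (P.rep i / P.rep j) := h1
  rw [h2]
  field_simp

open NumberField in
/-- Homogeneous coordinates of `P` that are integers of its field of definition. -/
def integralCoords (P : P1Qbar) : Fin 2 → 𝓞 (fieldOfDef P) := (exists_integral_coords P).choose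

open NumberField in
/-- The positive integer `λ(a, P) = ∏ N(𝔭) ^ (P · a)_𝔭`, for `P ≠ a`, where `𝔭` runs over the
primes of the field of definition of `P` and `(P · a)_𝔭` is the largest `k` such that `P` and `a`
agree modulo `𝔭 ^ k`; the value for `P = a` is `0`. For `a = [α : β]` with `α`, `β` coprime integers and
`P = [x : y]` with integral `x`, `y`, the number `(P · a)_𝔭` is the exponent of `𝔭` in the
ideal `(α y - β x) (x, y)⁻¹`, so that `λ(a, P)` is the norm of this ideal. -/
def intersectionNorm (a : P1Q) (P : P1Qbar) : ℕ :=
  Ideal.absNorm (Ideal.span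
      {(coords a 0 : 𝓞 (fieldOfDef P)) * integralCoords P 1 - coords a 1 * integralCoords P 0}) /
    Ideal.absNorm (Ideal.span {integralCoords P 0, integralCoords P 1})

/-- The anti-canonical height of an algebraic point of the stacky curve with coarse space `ℙ¹`,
stacky points `a i` and multiplicities `m i`, computed over the field of definition of the point
(with respect to the Weil height relative to this number field). -/
def antiCanHeightBar {n : ℕ} (a : Fin n → P1Q) (m : Fin n → ℕ) (P : P1Qbar) : ℝ :=
  Height.mulHeight (fun i => (integralCoords P i : fieldOfDef P)) ^ eulerChar m *
    ∏ i, (phi (m i) (intersectionNorm (a i) P) : ℝ) ^ (1 / (m i : ℝ))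

/-- The degree `[ℚ(P) : ℚ]`. -/
def degP1 (P : P1Qbar) : ℕ := Module.finrank ℚ (fieldOfDef P)

/-! ### Smooth projective curves -/

/-- A smooth projective geometrically integral curve over `ℚ` (a proper curve over a field is
projective). -/
structure Curve where
  X : Scheme.{0}
  str : X ⟶ Spec (.of ℚ)
  proper : IsProper str
  smooth : SmoothOfRelativeDimension 1 str
  geomIntegral : GeometricallyIntegral str

namespace Curve

attribute [instance] proper smooth geomIntegral

variable (C : Curve)

instance : IsIntegral C.X := GeometricallyIntegral.isIntegral_of_subsingleton C.str

instance : IsLocallyNoetherian C.X := LocallyOfFiniteType.isLocallyNoetherian C.str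

/-- The function field of `C`. -/
abbrev FunField : Type := C.X.functionField

/-- The function field as an algebra over `ℚ`, through the structure morphism. -/
instance : Algebra ℚ C.FunField :=
  (((Scheme.ΓSpecIso (.of ℚ)).inv ≫ C.str.appTop ≫
    C.X.presheaf.germ ⊤ (genericPoint C.X) trivial).hom).toAlgebra

/-- The degree over `ℚ` of the residue field of a point of `C`. -/
def degPt (z : C.X) : ℕ := C.str.residueDegree z

/-- The degree of a divisor; the coefficient of the point `z` in the divisor `D` is `D z`. -/
def degDiv (D : C.X →₀ ℤ) : ℤ := D.sum fun z k => k * C.degPt z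

/-- `D` is the divisor of a nonzero rational differential form `ω`. At a closed point `z` write
`ω = f dt` with a uniformizer `t`; the coefficient of `z` in the divisor is the order of `f`. -/
def IsCanonical (D : C.X →₀ ℤ) : Prop :=
  ∃ ω : Ω[C.FunField⁄ℚ], ω ≠ 0 ∧
    (∀ z : C.X, IsClosed {z} → ∃ t f : C.FunField,
      Scheme.ord t z = 1 ∧ ω = f • KaehlerDifferential.D ℚ C.FunField t ∧
        D z = Scheme.ord f z) ∧
    ∀ z : C.X, ¬ IsClosed {z} → D z = 0

/-- The algebraic points of `C`. -/
def GeomPoint : Type :=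
  {P : Spec (.of Qbar) ⟶ C.X // P ≫ C.str = Spec.map (CommRingCat.ofHom (algebraMap ℚ Qbar))}

variable {C}

/-- The point of the scheme `C` underlying an algebraic point. -/
def GeomPoint.pt (P : C.GeomPoint) : C.X := P.1 (IsLocalRing.closedPoint Qbar)

/-- The degree `[ℚ(P) : ℚ]`, where `ℚ(P)` is the residue field of the underlying point. -/
def GeomPoint.deg (P : C.GeomPoint) : ℕ := C.degPt P.pt

/-- The value at `P` of a function that is regular at `P`. -/
def GeomPoint.eval (P : C.GeomPoint) : C.X.presheaf.stalk P.pt →+* Qbar :=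
  (Scheme.stalkClosedPointTo P.1).hom

end Curve

/-- The absolute multiplicative Weil height on projective space over `Qbar`, as a function of the
homogeneous coordinates. -/
def absHeight {n : ℕ} (x : Fin (n + 1) → Qbar) : ℝ :=
  haveI : NumberField (IntermediateField.adjoin ℚ (Set.range x)) :=
    { to_finiteDimensional := IntermediateField.finiteDimensional_adjoin
        fun y _ => (Algebra.IsAlgebraic.isAlgebraic y).isIntegral }
  Height.mulHeight (fun i => (⟨x i, IntermediateField.subset_adjoin ℚ _ ⟨i, rfl⟩⟩ :
      IntermediateField.adjoin ℚ (Set.range x))) ^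
    (1 / (Module.finrank ℚ (IntermediateField.adjoin ℚ (Set.range x)) : ℝ))

namespace Curve

variable {C : Curve}

/-- Near `z` the functions `s i` are `u * r i` with the `r i` regular at `z` and without a common
zero there: the `r i` are local homogeneous coordinates of the map to projective space given by
the `s i`. -/
def LocalCoords {n : ℕ} (s : Fin (n + 1) → C.FunField) (z : C.X) (u : C.FunField)
    (r : Fin (n + 1) → C.X.presheaf.stalk z) : Prop :=
  u ≠ 0 ∧ (∀ i, s i = u * algebraMap (C.X.presheaf.stalk z) C.FunField (r i)) ∧ ∃ i, IsUnit (r i)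

/-- The functions `s i` generate the line bundle of the divisor `A`: at every point `z` the
minimum of the orders of the `s i` is `-A z`. -/
def Generates {n : ℕ} (s : Fin (n + 1) → C.FunField) (A : C.X →₀ ℤ) : Prop :=
  ∀ z : C.X, ∃ u r, LocalCoords s z u r ∧ Scheme.ord u z = -A z

/-- `h` is the height `P ↦ H(s 0 (P) : ⋯ : s n (P))` on the algebraic points of `C`. -/
def IsMapHeight {n : ℕ} (s : Fin (n + 1) → C.FunField) (h : C.GeomPoint → ℝ) : Prop :=
  ∀ (P : C.GeomPoint) (u : C.FunField) (r : Fin (n + 1) → C.X.presheaf.stalk P.pt),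
    LocalCoords s P.pt u r → h P = absHeight fun i => P.eval (r i)

/-- `H` is a (multiplicative, absolute) Weil height associated with the divisor `D`: up to a
bounded factor it is the quotient of the heights of the morphisms to projective spaces that are
given by generators of the line bundles of two base point free divisors `A`, `B` with
`D = A - B`. -/
def IsWeilHeight (D : C.X →₀ ℤ) (H : C.GeomPoint → ℝ) : Prop :=
  ∃ (A B : C.X →₀ ℤ) (p q : ℕ) (s : Fin (p + 1) → C.FunField) (t : Fin (q + 1) → C.FunField)
    (hA hB : C.GeomPoint → ℝ) (c : ℝ),
    D = A - B ∧ Generates s A ∧ Generates t B ∧ IsMapHeight s hA ∧ IsMapHeight t hB ∧ 0 < c ∧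
      ∀ P, c⁻¹ * (hA P / hB P) ≤ H P ∧ H P ≤ c * (hA P / hB P)

end Curve

end

end StackyCurve

namespace StackyCurve
noncomputable section

/-! ### Smooth local rings of dimension one -/

section SmoothLocal

open IsLocalRing TensorProduct

/-! Curves. A Weil height attached to a divisor `D` is strongly Northcott exactly when `deg D > 0`
(`IsWeilHeight.strongNorthcott_iff`); the theorem is the case `D = -K`. Write `D = A - B` with both
parts base point free. A base point free system contains a base point free pencil, so outside
finitely many points the two heights agree, up to bounded factors, with the heights of single
functions `φ` and `ψ`, where `deg A = deg φ` and `deg B = deg ψ` (`exists_equiv_ht`). This rests on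
the classical theory of the function field: the stalks at nongeneric points are discrete valuation
rings, properness makes every nontrivial valuation ring over `ℚ` the local ring of a point, and `∑ e
f = n` over `ℚ[h]` counts the zeros of `h`, so that principal divisors have degree zero.

If `deg φ > deg ψ`, a dimension count in the style of Riemann gives a nonzero `g` with poles at most
`N` times those of `φ` that vanishes along `N' > N` times the poles of `ψ` (`exists_section`). Then
`g` and `g ψ ^ N'` have poles bounded by `N` times those of `φ`, whence `H(ψ) ^ N' ≤ K H(φ) ^ N`. A
bound for `H(φ) / H(ψ)` therefore bounds `H(φ)`, and Northcott's theorem for algebraic numbers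
(`finite_setOf_ht_le`) applies.

If `deg φ ≤ deg ψ` and `φ` is not constant, specialize `φ` to large integers `t`. The equation of
`ψ` over `ℚ(φ)`, of degree `e`, can be given coprime integral coefficients, one of which has degree
at least `e` in `φ`. Its coefficient vector at `t` has height at least a constant times `t ^ e`, so
one of its `e` roots has height at least a constant times `t` (`exists_le_ht_root`). This root is
the value of `ψ` at a point of degree at most `deg φ` where `φ = t`, and `H(φ) / H(ψ)` stays bounded
on these points. For constant `φ` any infinite set of points of bounded degree serves.

Stacky projective lines. If the Euler characteristic is positive, the local factors are at least `1`
and the height dominates a positive power of a Weil height. If it is nonpositive, the multiplicities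
dominate a system `m'` of characteristic zero: `(3, 3, 3)`, `(2, 4, 4)`, `(2, 3, 6)` or `(2, 2, 2,
2)` at some of the points and `1` at the others. The height is bounded on points whose pairings with
the `a i` are `m' i`-th powers up to bounded factors (`exists_antiCanHeight_le`). Infinitely many
such points come from iterated duplication on curves of genus one: `u ^ 3 + v ^ 3 = 19 w ^ 3`, `u ^
4 + 8 v ^ 4 = w ^ 2`, and a quadratic twist of `s ^ 2 = t (t - b) (t - c)`; the growing power of `2`
in one coordinate shows that they are infinite in number. The same rational points refute the strong
Northcott property. -/

theorem exists_cotangent_injective_exact (k R : Type) [Field k] [CharZero k] [CommRing R]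
    [IsLocalRing R] [Algebra k R] [Algebra.EssFiniteType k R] [Algebra.FormallySmooth k R] :
    ∃ g : (maximalIdeal R).Cotangent →ₗ[R] ResidueField R ⊗[R] Ω[R⁄k], Function.Injective g ∧
      Function.Exact g (KaehlerDifferential.mapBaseChange k R (ResidueField R)) := by
  have : Algebra.EssFiniteType k (ResidueField R) :=
    Algebra.EssFiniteType.comp k R (ResidueField R)
  have hs : Function.Surjective (algebraMap R (ResidueField R)) := residue_surjective
  -- The maximal ideal equals the kernel of `R → κ` only propositionally, hence the detour through a
  -- variable ideal.
  have key : ∀ I : Ideal R, I = RingHom.ker (algebraMap R (ResidueField R)) →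
      ∃ g : I.Cotangent →ₗ[R] ResidueField R ⊗[R] Ω[R⁄k], Function.Injective g ∧
      Function.Exact g (KaehlerDifferential.mapBaseChange k R (ResidueField R)) := by
    rintro _ rfl
    -- In characteristic zero `κ` is formally smooth over `k`, which splits the conormal sequence on
    -- the left.
    obtain ⟨l, hl⟩ := (Algebra.FormallySmooth.iff_split_injection (R := k) (P := R)
      (A := ResidueField R) hs).1 inferInstance
    exact ⟨_, Function.LeftInverse.injective (g := l) (fun x => LinearMap.congr_fun hl x),
      KaehlerDifferential.exact_kerCotangentToTensor_mapBaseChange _ _ _ hs⟩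
  exact key _ ker_residue.symm

/-- The cotangent space is nonzero and embeds into a one-dimensional space, so it has dimension one.
The embedding is then onto, which forces `Ω[κ⁄k] = 0`, and an unramified residue field is finite
over `k`. -/
theorem isDiscreteValuationRing_of_finrank_kaehlerDifferential
    (k R : Type) [Field k] [CharZero k] [CommRing R] [IsDomain R] [IsLocalRing R]
    [IsNoetherianRing R] [Algebra k R] [Algebra.EssFiniteType k R] [Algebra.FormallySmooth k R]
    [Module.Free R Ω[R⁄k]] [Module.Finite R Ω[R⁄k]] (h : Module.finrank R Ω[R⁄k] = 1)
    (hf : ¬ IsField R) :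
    IsDiscreteValuationRing R ∧ Module.Finite k (ResidueField R) := by
  have : Algebra.EssFiniteType k (ResidueField R) :=
    Algebra.EssFiniteType.comp k R (ResidueField R)
  have hs : Function.Surjective (algebraMap R (ResidueField R)) := residue_surjective
  obtain ⟨g, hg, hex⟩ := exists_cotangent_injective_exact k R
  have h1 : Module.finrank (ResidueField R) (ResidueField R ⊗[R] Ω[R⁄k]) = 1 := by
    rw [Module.finrank_baseChange, h]
  let f : CotangentSpace R →ₗ[ResidueField R] (ResidueField R ⊗[R] Ω[R⁄k]) :=
    LinearMap.extendScalarsOfSurjective hs g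
  have hfinj : Function.Injective f := hg
  have h0 : Module.finrank (ResidueField R) (CotangentSpace R) ≠ 0 := fun h0 =>
    hf (finrank_cotangentSpace_eq_zero_iff.1 h0)
  have hle := LinearMap.finrank_le_finrank_of_injective hfinj
  have heq : Module.finrank (ResidueField R) (CotangentSpace R) = 1 := by lia
  refine ⟨((IsDiscreteValuationRing.TFAE R hf).out 0 5).2 heq, ?_⟩
  have hfs : Function.Surjective f :=
    (LinearMap.injective_iff_surjective_of_finrank_eq_finrank (by rw [heq, h1])).1 hfinj
  have hsub : Subsingleton Ω[ResidueField R⁄k] := by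
    refine ⟨fun x y => ?_⟩
    have hz : ∀ x : Ω[ResidueField R⁄k], x = 0 := fun x => by
      obtain ⟨y, rfl⟩ := KaehlerDifferential.mapBaseChange_surjective k R (ResidueField R) hs x
      obtain ⟨w, rfl⟩ := hfs y
      exact (hex _).2 ⟨w, rfl⟩
    rw [hz x, hz y]
  have : Algebra.FormallyUnramified k (ResidueField R) := ⟨hsub⟩
  exact Algebra.FormallyUnramified.finite_of_free k (ResidueField R)

end SmoothLocal

/-! ### Function fields of transcendence degree one -/

section DimOne

open IntermediateField TensorProduct

theorem finrank_kaehlerDifferential_of_equiv (k A B : Type) [Field k] [CommRing A] [CommRing B] [IsDomain A] [IsDomain B]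
    [Algebra k A] [Algebra k B] (e : A ≃ₐ[k] B) [Module.Free A Ω[A⁄k]] :
    Module.Free B Ω[B⁄k] ∧ Module.finrank B Ω[B⁄k] = Module.finrank A Ω[A⁄k] := by
  let := e.toRingHom.toAlgebra
  have : IsScalarTower k A B := IsScalarTower.of_algebraMap_eq fun x => (e.commutes x).symm
  have : Algebra.FormallyEtale A B := by
    have := Algebra.FormallyEtale.of_equiv (R := A) (A := A) (B := B)
      (AlgEquiv.ofBijective (Algebra.ofId A B) e.bijective)
    exact this
  have e' := KaehlerDifferential.tensorKaehlerEquivOfFormallyEtale k A B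
  exact ⟨Module.Free.of_equiv e', by rw [← e'.finrank_eq, Module.finrank_baseChange]⟩

open scoped IntermediateField.algebraAdjoinAdjoin in
-- A localization `k[s] → k(s)` followed by a separable algebraic extension is formally étale, so
-- `Ω[F⁄k]` is the base change of the differentials of a polynomial ring.
theorem finrank_kaehlerDifferential_of_isTranscendenceBasis
    (k F : Type) [Field k] [CharZero k] [Field F] [Algebra k F] (s : Finset F)
    (hs : IsTranscendenceBasis k ((↑) : s → F)) : Module.finrank F Ω[F⁄k] = s.card := by
  have hr : Set.range ((↑) : s → F) = (s : Set F) := Subtype.range_coe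
  have halg : Algebra.IsAlgebraic (IntermediateField.adjoin k (Set.range ((↑) : s → F))) F :=
    hs.isAlgebraic_field
  let A := Algebra.adjoin k (Set.range ((↑) : s → F))
  let L := IntermediateField.adjoin k (Set.range ((↑) : s → F))
  have : CharZero L := charZero_of_injective_algebraMap (algebraMap k L).injective
  have : Algebra.IsSeparable L F := inferInstance
  have : Algebra.FormallyEtale L F := Algebra.FormallyEtale.of_isSeparable _ F
  have : Algebra.FormallyEtale A L := .of_isLocalization (nonZeroDivisors _)
  have : Algebra.FormallyEtale A F := .comp A L F
  obtain ⟨h1, h2⟩ := finrank_kaehlerDifferential_of_equiv k _ A hs.1.aevalEquiv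
  rw [← (KaehlerDifferential.tensorKaehlerEquivOfFormallyEtale k A F).finrank_eq,
    Module.finrank_baseChange, h2, Module.finrank_eq_card_basis (KaehlerDifferential.mvPolynomialBasis k s)]
  simp

/-- Differentials of rank one mean transcendence degree one, so `x` alone is a transcendence basis;
a finitely generated algebraic extension is finite. -/
theorem finiteDimensional_of_transcendental
    (k F : Type) [Field k] [CharZero k] [Field F] [Algebra k F] [Algebra.EssFiniteType k F]
    (h : Module.finrank F Ω[F⁄k] = 1) (x : F) (hx : Transcendental k x) :
    FiniteDimensional k⟮x⟯ F := by
  obtain ⟨s, hs, -⟩ := exists_isTranscendenceBasis_and_isSeparable_of_perfectField k F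
  have hc := finrank_kaehlerDifferential_of_isTranscendenceBasis k F s hs
  have htr : Algebra.trdeg k F = 1 := by
    rw [← hs.cardinalMk_eq_trdeg]; simp [← hc, h]
  have hai : AlgebraicIndependent k ((↑) : ({x} : Set F) → F) := by
    rw [algebraicIndependent_singleton_iff ⟨x, rfl⟩]
    exact hx
  have hb := hai.isTranscendenceBasis_of_trdeg_le_of_finite (by rw [htr]; simp)
  have halg := hb.isAlgebraic_field
  rw [Subtype.range_coe] at halg
  have : Algebra.EssFiniteType k⟮x⟯ F := Algebra.EssFiniteType.of_comp k _ _
  exact Algebra.finite_of_essFiniteType_of_isAlgebraic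

theorem exists_transcendental
    (k F : Type) [Field k] [CharZero k] [Field F] [Algebra k F] [Algebra.EssFiniteType k F]
    (h : Module.finrank F Ω[F⁄k] = 1)  : ∃ x : F, Transcendental k x := by
  obtain ⟨s, hs, -⟩ := exists_isTranscendenceBasis_and_isSeparable_of_perfectField k F
  have hc := finrank_kaehlerDifferential_of_isTranscendenceBasis k F s hs
  obtain ⟨x, hx⟩ : s.Nonempty := Finset.card_pos.1 (by lia)
  exact ⟨x, hs.1.transcendental ⟨x, hx⟩⟩

end DimOne

end

end StackyCurve

/-! ### Stalks of a smooth curve -/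

namespace StackyCurve
noncomputable section
namespace Curve
variable (C : Curve)

instance stalkAlgebra (z : C.X) : Algebra ℚ (C.X.presheaf.stalk z) :=
  (((Scheme.ΓSpecIso (.of ℚ)).inv ≫ C.str.appTop ≫
    C.X.presheaf.germ ⊤ z trivial).hom).toAlgebra

instance (z : C.X) : IsScalarTower ℚ (C.X.presheaf.stalk z) C.FunField :=
  IsScalarTower.of_algebraMap_eq' (RingHom.ext_rat _ _)

/-- Smoothness provides standard smooth charts over opens of `Spec ℚ`; as this space is a single
point, the chart lies over `ℚ` itself. -/
theorem exists_standardSmooth_chart (z : C.X) :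
    ∃ (A : Type) (_ : CommRing A) (_ : Algebra ℚ A) (_ : Algebra A (C.X.presheaf.stalk z))
      (p : Ideal A) (_ : p.IsPrime), IsLocalization.AtPrime (C.X.presheaf.stalk z) p ∧
        Algebra.IsStandardSmoothOfRelativeDimension 1 ℚ A := by
  obtain ⟨U, hU, V, hV, hz, e, h⟩ :=
    SmoothOfRelativeDimension.exists_isStandardSmoothOfRelativeDimension (n := 1) (f := C.str) z
  have hUtop : U = ⊤ := by
    ext y
    have : y = C.str z := Subsingleton.elim (α := PrimeSpectrum ℚ) _ _
    simpa [this] using e hz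
  subst hUtop
  have h2 : RingHom.IsStandardSmoothOfRelativeDimension 1
      ((C.str.appLE ⊤ V e).hom.comp (Scheme.ΓSpecIso (.of ℚ)).inv.hom) := by
    refine RingHom.IsStandardSmoothOfRelativeDimension.comp (n := 1) (m := 0) h ?_
    exact RingHom.IsStandardSmoothOfRelativeDimension.equiv
      (Scheme.ΓSpecIso (.of ℚ)).symm.commRingCatIsoToRingEquiv
  refine ⟨Γ(C.X, V), inferInstance, RingHom.toAlgebra _, 
    (C.X.presheaf.germ V z hz).hom.toAlgebra, (hV.primeIdealOf ⟨z, hz⟩).asIdeal, inferInstance, 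
    hV.isLocalization_stalk ⟨z, hz⟩, h2⟩

theorem stalk_smooth (z : C.X) :
    Algebra.EssFiniteType ℚ (C.X.presheaf.stalk z) ∧
    Algebra.FormallySmooth ℚ (C.X.presheaf.stalk z) ∧
    Module.Free (C.X.presheaf.stalk z) Ω[C.X.presheaf.stalk z⁄ℚ] ∧
    Module.Finite (C.X.presheaf.stalk z) Ω[C.X.presheaf.stalk z⁄ℚ] ∧
    Module.finrank (C.X.presheaf.stalk z) Ω[C.X.presheaf.stalk z⁄ℚ] = 1 := by
  obtain ⟨A, _, _, _, p, _, hloc, hsm⟩ := C.exists_standardSmooth_chart z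
  have : IsScalarTower ℚ A (C.X.presheaf.stalk z) :=
    IsScalarTower.of_algebraMap_eq' (RingHom.ext_rat _ _)
  have : Nontrivial A := (algebraMap A (C.X.presheaf.stalk z)).domain_nontrivial
  have hss := Algebra.IsStandardSmoothOfRelativeDimension.isStandardSmooth (R := ℚ) (S := A) 1
  have hrk := Algebra.IsStandardSmoothOfRelativeDimension.rank_kaehlerDifferential (R := ℚ) (S := A) 1
  have : Algebra.FormallyEtale A (C.X.presheaf.stalk z) := .of_isLocalization p.primeCompl
  have : Algebra.EssFiniteType A (C.X.presheaf.stalk z) := .of_isLocalization _ p.primeCompl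
  have hess : Algebra.EssFiniteType ℚ (C.X.presheaf.stalk z) := .comp ℚ A _
  have e := KaehlerDifferential.tensorKaehlerEquivOfFormallyEtale ℚ A (C.X.presheaf.stalk z)
  have hfr : Module.finrank A Ω[A⁄ℚ] = 1 := Module.finrank_eq_of_rank_eq (by simpa using hrk)
  refine ⟨hess, .comp ℚ A _, .of_equiv e, inferInstance, ?_⟩
  rw [← e.finrank_eq, Module.finrank_baseChange, hfr]

theorem isField_stalk_iff (z : C.X) : IsField (C.X.presheaf.stalk z) ↔ z = genericPoint C.X := by
  constructor
  · intro h
    have h1 := ringKrullDim_eq_zero_of_isField h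
    rw [AlgebraicGeometry.ringKrullDim_stalk_eq_coheight] at h1
    have h2 : Order.coheight z = 0 := by exact_mod_cast h1
    rw [Order.coheight_eq_zero] at h2
    have h3 : z ≤ genericPoint C.X := genericPoint_specializes z
    exact (Specializes.antisymm (h2 h3) h3).eq
  · rintro rfl
    exact Field.toIsField C.FunField

theorem isDiscreteValuationRing_stalk {z : C.X} (hz : z ≠ genericPoint C.X) :
    IsDiscreteValuationRing (C.X.presheaf.stalk z) ∧
      Module.Finite ℚ (IsLocalRing.ResidueField (C.X.presheaf.stalk z)) := by
  obtain ⟨_, _, _, _, h⟩ := C.stalk_smooth z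
  exact isDiscreteValuationRing_of_finrank_kaehlerDifferential _ _ h
    (fun h => hz ((C.isField_stalk_iff z).1 h))

theorem coheight_eq_one {z : C.X} (hz : z ≠ genericPoint C.X) : Order.coheight z = 1 := by
  have := (C.isDiscreteValuationRing_stalk hz).1
  have h1 := AlgebraicGeometry.ringKrullDim_stalk_eq_coheight z
  rw [IsPrincipalIdealRing.ringKrullDim_eq_one _ (fun h => hz ((C.isField_stalk_iff z).1 h))] at h1
  exact_mod_cast h1.symm

instance : Algebra.EssFiniteType ℚ C.FunField := (C.stalk_smooth _).1

theorem finrank_kaehlerDifferential_funField : Module.finrank C.FunField Ω[C.FunField⁄ℚ] = 1 :=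
  (C.stalk_smooth (genericPoint C.X)).2.2.2.2

end Curve
end
end StackyCurve

/-! ### Valuation rings, local rings and algebraic points -/

namespace StackyCurve
noncomputable section
namespace Curve
variable (C : Curve)

open IsLocalRing

theorem fromSpecStalk_comp_str (z : C.X) :
    C.X.fromSpecStalk z ≫ C.str = Spec.map (CommRingCat.ofHom (algebraMap ℚ (C.X.presheaf.stalk z))) := by
  rw [← Spec.map_preimage (C.X.fromSpecStalk z ≫ C.str)]
  congr 1
  ext1
  exact RingHom.ext_rat _ _

/-- Every valuation ring of the function field that contains `ℚ` is centred on the curve. -/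
theorem exists_center (V : ValuationSubring C.FunField) (hV : ∀ q : ℚ, algebraMap ℚ C.FunField q ∈ V) :
    ∃ (z : C.X) (φ : C.X.presheaf.stalk z →+* V), IsLocalHom φ ∧
      ∀ r, (φ r : C.FunField) = algebraMap (C.X.presheaf.stalk z) C.FunField r := by
  let ι : ℚ →+* V := (algebraMap ℚ C.FunField).codRestrict V.toSubring hV
  have hex : ValuativeCriterion C.str := by
    have h := C.proper
    rw [IsProper.eq_valuativeCriterion] at h
    exact h.1.1.1
  let i₁ : Spec (.of C.FunField) ⟶ C.X := C.X.fromSpecStalk (genericPoint C.X)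
  have hsq : CommSq i₁ (Spec.map (CommRingCat.ofHom (algebraMap V C.FunField))) C.str
      (Spec.map (CommRingCat.ofHom ι)) := by
    constructor
    rw [← Spec.map_comp]
    exact (C.fromSpecStalk_comp_str _).trans (congrArg _ (by ext x; rfl))
  let S : ValuativeCommSq C.str := { R := V, K := C.FunField, i₁ := i₁, i₂ := _, commSq := hsq }
  -- Properness extends the generic point to `Spec V`; the image of the closed point is the centre.
  obtain ⟨⟨l, hl₁, hl₂⟩⟩ := (ValuativeCriterion.iff.1 hex).1 S
  change Spec (.of V) ⟶ C.X at l
  change Spec.map (CommRingCat.ofHom (algebraMap V C.FunField)) ≫ l = i₁ at hl₁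
  refine ⟨l (closedPoint V), (Scheme.stalkClosedPointTo l).hom, inferInstance, ?_⟩
  have h1 : Spec.map (Scheme.stalkClosedPointTo l) ≫ C.X.fromSpecStalk _ = l :=
    Scheme.Spec_stalkClosedPointTo_fromSpecStalk l
  have h2 : Spec.map (C.X.presheaf.stalkSpecializes (genericPoint_specializes (l (closedPoint V)))) ≫ C.X.fromSpecStalk _ = i₁ :=
    Scheme.SpecMap_stalkSpecializes_fromSpecStalk _
  have h3 : Spec.map (C.X.presheaf.stalkSpecializes (genericPoint_specializes (l (closedPoint V)))) =
      Spec.map (Scheme.stalkClosedPointTo l ≫ CommRingCat.ofHom (algebraMap V C.FunField)) := by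
    rw [← cancel_mono (C.X.fromSpecStalk _), h2, Spec.map_comp, Category.assoc, h1, hl₁]
  have h4 := Spec.map_injective h3
  intro r
  exact (congrArg (fun f => f.hom r) h4).symm

theorem exists_ringEquiv_of_range_eq {A B K : Type} [CommRing A] [CommRing B] [CommRing K]
    (f : A →+* K) (g : B →+* K) (hf : Function.Injective f) (hg : Function.Injective g)
    (h : f.range = g.range) : ∃ e : A ≃+* B, ∀ a, g (e a) = f a := by
  let e₁ := RingEquiv.ofBijective f.rangeRestrict
    ⟨fun x y hxy => hf (congrArg Subtype.val hxy), f.rangeRestrict_surjective⟩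
  let e₂ := RingEquiv.ofBijective g.rangeRestrict
    ⟨fun x y hxy => hg (congrArg Subtype.val hxy), g.rangeRestrict_surjective⟩
  refine ⟨(e₁.trans (RingEquiv.subringCongr h)).trans e₂.symm, fun a => ?_⟩
  have := congrArg Subtype.val (e₂.apply_symm_apply (RingEquiv.subringCongr h (e₁ a)))
  exact this

/-- Two points with the same local ring give two extensions of the generic point to its spectrum,
and separatedness allows only one. -/
theorem eq_of_range_eq {z w : C.X} (hz : z ≠ genericPoint C.X)
    (h : (algebraMap (C.X.presheaf.stalk z) C.FunField).range =
      (algebraMap (C.X.presheaf.stalk w) C.FunField).range) : z = w := by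
  have := (C.isDiscreteValuationRing_stalk hz).1
  have hinj : ∀ y : C.X, Function.Injective (algebraMap (C.X.presheaf.stalk y) C.FunField) :=
    fun y => IsFractionRing.injective _ _
  obtain ⟨φ, hφ, hφ'⟩ : ∃ φ : C.X.presheaf.stalk w ⟶ C.X.presheaf.stalk z, IsLocalHom φ.hom ∧
      φ ≫ C.X.presheaf.stalkSpecializes (genericPoint_specializes z) =
        C.X.presheaf.stalkSpecializes (genericPoint_specializes w) := by
    obtain ⟨e, he⟩ := exists_ringEquiv_of_range_eq _ _ (hinj w) (hinj z) h.symm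
    exact ⟨CommRingCat.ofHom e.toRingHom, isLocalHom_toRingHom e, CommRingCat.hom_ext (RingHom.ext he)⟩
  let i₁ : Spec (.of C.FunField) ⟶ C.X := C.X.fromSpecStalk (genericPoint C.X)
  have hgen : ∀ y : C.X, Spec.map (C.X.presheaf.stalkSpecializes (genericPoint_specializes y)) ≫
      C.X.fromSpecStalk y = i₁ := fun y =>
    Scheme.SpecMap_stalkSpecializes_fromSpecStalk (genericPoint_specializes y)
  obtain ⟨l, hl0⟩ : ∃ l : Spec (C.X.presheaf.stalk z) ⟶ C.X, l = Spec.map φ ≫ C.X.fromSpecStalk w :=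
    ⟨_, rfl⟩
  have hl : Spec.map (C.X.presheaf.stalkSpecializes (genericPoint_specializes z)) ≫ l = i₁ := by
    rw [hl0, ← Category.assoc, ← Spec.map_comp, ← hgen w, hφ']
  have hl₂ : l ≫ C.str = Spec.map (CommRingCat.ofHom (algebraMap ℚ (C.X.presheaf.stalk z))) := by
    rw [← Spec.map_preimage (l ≫ C.str)]
    congr 1
    ext1
    exact RingHom.ext_rat _ _
  have hsq : CommSq i₁ (Spec.map (C.X.presheaf.stalkSpecializes (genericPoint_specializes z))) C.str
      (Spec.map (CommRingCat.ofHom (algebraMap ℚ (C.X.presheaf.stalk z)))) := by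
    refine CommSq.mk ?_
    rw [← hl, Category.assoc, hl₂]
    rfl
  let S : ValuativeCommSq C.str :=
    { R := C.X.presheaf.stalk z, K := C.FunField, i₁ := i₁, i₂ := _, commSq := hsq }
  have hu : ValuativeCriterion.Uniqueness C.str := IsSeparated.valuativeCriterion C.str
  have hs := (hu S).elim ⟨C.X.fromSpecStalk z, hgen z, C.fromSpecStalk_comp_str z⟩ ⟨l, hl, hl₂⟩
  have hs' : C.X.fromSpecStalk z = l := congrArg CommSq.LiftStruct.l hs
  have hz1 : C.X.fromSpecStalk z (closedPoint _) = z := Scheme.fromSpecStalk_closedPoint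
  have hcl : Spec.map φ (closedPoint (C.X.presheaf.stalk z)) = closedPoint (C.X.presheaf.stalk w) :=
    comap_closedPoint φ.hom
  have hz2 : l (closedPoint _) = w := by
    rw [hl0]
    exact (congrArg (fun p => C.X.fromSpecStalk w p) hcl).trans Scheme.fromSpecStalk_closedPoint
  rw [← hz1, ← hz2, hs']

/-- The function `f` is regular at `P`, with value `a`. -/
def GeomPoint.HasVal {C : Curve} (P : C.GeomPoint) (f : C.FunField) (a : Qbar) : Prop :=
  ∃ r : C.X.presheaf.stalk P.pt, algebraMap _ C.FunField r = f ∧ P.eval r = a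

theorem exists_geomPoint (z : C.X) (τ : C.X.presheaf.stalk z →+* Qbar) (hτ : IsLocalHom τ) :
    ∃ P : C.GeomPoint, P.pt = z ∧ ∀ r, P.HasVal (algebraMap _ C.FunField r) (τ r) := by
  let P₀ : Spec (.of Qbar) ⟶ C.X := Spec.map (CommRingCat.ofHom τ) ≫ C.X.fromSpecStalk z
  have hP₀ : P₀ ≫ C.str = Spec.map (CommRingCat.ofHom (algebraMap ℚ Qbar)) := by
    rw [Category.assoc, fromSpecStalk_comp_str, ← Spec.map_comp]
    congr 1
    ext1
    exact RingHom.ext_rat _ _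
  have h := (SpecToEquivOfLocalRing C.X (.of Qbar)).apply_symm_apply ⟨z, CommRingCat.ofHom τ, hτ⟩
  have key : ∀ s : Σ x, { f : C.X.presheaf.stalk x ⟶ .of Qbar // IsLocalHom f.hom },
      s = ⟨z, CommRingCat.ofHom τ, hτ⟩ → s.1 = z ∧ ∀ r, ∃ r' : C.X.presheaf.stalk s.1,
        algebraMap _ C.FunField r' = algebraMap (C.X.presheaf.stalk z) C.FunField r ∧
          s.2.1.hom r' = τ r := by
    rintro _ rfl
    exact ⟨rfl, fun r => ⟨r, rfl, rfl⟩⟩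
  exact ⟨⟨P₀, hP₀⟩, key _ h⟩

instance {C : Curve} (P : C.GeomPoint) : IsLocalHom P.eval :=
  Scheme.isLocalHom_stalkClosedPointTo' P.1

/-- Evaluation at the generic point would embed the function field, which contains a transcendental
element, into `Qbar`. -/
theorem GeomPoint.pt_ne_genericPoint {C : Curve} (P : C.GeomPoint) : P.pt ≠ genericPoint C.X := by
  intro h
  obtain ⟨x, hx⟩ := exists_transcendental ℚ C.FunField C.finrank_kaehlerDifferential_funField
  have hf := (C.isField_stalk_iff _).2 h
  obtain ⟨r, rfl⟩ : ∃ r, algebraMap (C.X.presheaf.stalk P.pt) C.FunField r = x := by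
    let := hf.toField
    exact IsFractionRing.surjective_iff_isField.2 hf x
  apply hx
  let ev : C.X.presheaf.stalk P.pt →ₐ[ℚ] Qbar := P.eval.toRatAlgHom
  have hr : IsAlgebraic ℚ r := by
    have h1 : IsAlgebraic ℚ (ev r) := Algebra.IsAlgebraic.isAlgebraic _
    have hinj : Function.Injective ev := by
      let := hf.toField
      exact RingHom.injective ev.toRingHom
    exact (isAlgebraic_algHom_iff ev hinj).1 h1
  exact hr.algebraMap

/-- Algebraic points above `z` are given by embeddings of its residue field, a finite extension of
`ℚ`. -/
theorem GeomPoint.finite_of_pt_eq {C : Curve} {z : C.X} (hz : z ≠ genericPoint C.X) :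
    {P : C.GeomPoint | P.pt = z}.Finite := by
  have := (C.isDiscreteValuationRing_stalk hz).2
  have hfin : Finite (ResidueField (C.X.presheaf.stalk z) →ₐ[ℚ] Qbar) := inferInstance
  let g : (ResidueField (C.X.presheaf.stalk z) →ₐ[ℚ] Qbar) → 
    Σ x, { f : C.X.presheaf.stalk x ⟶ .of Qbar // IsLocalHom f.hom } := fun σ =>
      ⟨z, CommRingCat.ofHom (σ.toRingHom.comp (residue (C.X.presheaf.stalk z))),
        RingHom.isLocalHom_comp σ.toRingHom (residue (C.X.presheaf.stalk z))⟩
  refine Set.Finite.of_finite_image (f := fun P => SpecToEquivOfLocalRing C.X (.of Qbar) P.1) 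
    ((Set.finite_range g).subset ?_) (fun P _ Q _ h => Subtype.ext (Equiv.injective _ h))
  rintro _ ⟨P, hP, rfl⟩
  have key : ∀ s : Σ x, { f : C.X.presheaf.stalk x ⟶ .of Qbar // IsLocalHom f.hom }, s.1 = z → 
     s ∈ Set.range g := by
    rintro ⟨_, f, hf⟩ rfl
    let σ := ResidueField.lift f.hom
    refine ⟨σ.toRatAlgHom, ?_⟩
    simp only [g]
    congr 2
  exact key _ hP

/-- The residue degree is taken over the residue field of `Spec ℚ` at the image point, which has to
be identified with `ℚ`. -/
theorem degPt_eq (z : C.X) : C.degPt z = Module.finrank ℚ (ResidueField (C.X.presheaf.stalk z)) := by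
  let y : PrimeSpectrum ℚ := C.str z
  have hbij : Function.Bijective (algebraMap ℚ y.asIdeal.ResidueField) := by
    refine ⟨RingHom.injective _, ?_⟩
    have hmax : y.asIdeal.IsMaximal := inferInstance
    rw [IsScalarTower.algebraMap_eq ℚ (ℚ ⧸ y.asIdeal) y.asIdeal.ResidueField, RingHom.coe_comp]
    exact (Ideal.bijective_algebraMap_quotient_residueField y.asIdeal).2.comp
      Ideal.Quotient.mk_surjective
  let i : ResidueField ((Spec (.of ℚ)).presheaf.stalk y) ≃+* ℚ :=
    (Scheme.Spec.residueFieldIso (.of ℚ) y).commRingCatIsoToRingEquiv.trans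
      (RingEquiv.ofBijective _ hbij).symm
  let := (C.str.residueFieldMap z).hom.toAlgebra
  refine Algebra.finrank_eq_of_equiv_equiv i (RingEquiv.refl _) ?_
  have h : (algebraMap ℚ (ResidueField (C.X.presheaf.stalk z))) =
    ((RingEquiv.refl _).toRingHom.comp (algebraMap ((Spec (.of ℚ)).residueField y) (C.X.residueField z))).comp
      i.symm.toRingHom := RingHom.ext_rat _ _
  ext x
  have := RingHom.congr_fun h (i x)
  refine this.trans ?_
  exact congrArg (algebraMap ((Spec (.of ℚ)).residueField y) (C.X.residueField z))
    (i.symm_apply_apply x)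

end Curve
end
end StackyCurve

/-! ### Orders of functions at points -/

namespace StackyCurve
noncomputable section
namespace Curve
variable (C : Curve)
open IsLocalRing

theorem coheight_genericPoint : Order.coheight (genericPoint C.X) = 0 := by
  rw [Order.coheight_eq_zero]
  intro z _
  exact genericPoint_specializes z

variable {C}
theorem ord_genericPoint (f : C.FunField) : Scheme.ord f (genericPoint C.X) = 0 :=
  Scheme.ord_eq_zero_of_coheight_neq_one (by rw [coheight_genericPoint]; exact zero_ne_one) f

theorem ord_algebraMap_of_span_eq {z : C.X} (hz : z ≠ genericPoint C.X)
    {r : C.X.presheaf.stalk z} {n : ℕ} (h : Ideal.span {r} = maximalIdeal _ ^ n) :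
    Scheme.ord (algebraMap _ C.FunField r) z = n := by
  have hD := (C.isDiscreteValuationRing_stalk hz).1
  obtain ⟨ϖ, hϖ⟩ := IsDiscreteValuationRing.exists_irreducible (C.X.presheaf.stalk z)
  rw [hϖ.maximalIdeal_eq, Ideal.span_singleton_pow] at h
  have has : Associated r (ϖ ^ n) := Ideal.span_singleton_eq_span_singleton.1 h
  have hr : r ≠ 0 := fun h0 => pow_ne_zero n hϖ.ne_zero (has.eq_zero_iff.1 h0)
  have hf : algebraMap _ C.FunField r ≠ 0 := by
    simpa using hr
  have hz1 := C.coheight_eq_one hz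
  rw [Scheme.ord_eq_iff hz1 hf]
  have : Ring.KrullDimLE 1 (C.X.presheaf.stalk z) := krullDimLE_of_coheight_le hz1.le
  change Ring.ordFrac (C.X.presheaf.stalk z) (algebraMap _ C.FunField r) = _
  rw [Ring.ordFrac_eq_ord _ hr]
  refine Ring.ordMonoidWithZeroHom_eq_coe _ (mem_nonZeroDivisors_of_ne_zero hr) ?_
  rw [Ring.ord_eq_of_associated has, Ring.ord_pow (mem_nonZeroDivisors_of_ne_zero hϖ.ne_zero),
    Ring.ord_of_irreducible hϖ]
  simp

theorem exists_span_eq {z : C.X} (hz : z ≠ genericPoint C.X)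
    {r : C.X.presheaf.stalk z} (hr : r ≠ 0) : ∃ n : ℕ, Ideal.span {r} = maximalIdeal _ ^ n := by
  have hD := (C.isDiscreteValuationRing_stalk hz).1
  obtain ⟨ϖ, hϖ⟩ := IsDiscreteValuationRing.exists_irreducible (C.X.presheaf.stalk z)
  obtain ⟨n, hn⟩ := IsDiscreteValuationRing.ideal_eq_span_pow_irreducible
    (s := Ideal.span {r}) (by simpa using hr) hϖ
  exact ⟨n, by rw [hn, hϖ.maximalIdeal_eq, Ideal.span_singleton_pow]⟩

theorem ord_inv {f : C.FunField} (z : C.X) : Scheme.ord f⁻¹ z = - Scheme.ord f z := by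
  by_cases hf : f = 0
  · simp [hf]
  have h := Scheme.ord_mul (x := z) hf (inv_ne_zero hf)
  have h1 : Scheme.ord (1 : C.FunField) z = 0 := by
    have := Scheme.ord_mul (x := z) (one_ne_zero (α := C.FunField)) (one_ne_zero (α := C.FunField))
    rw [mul_one] at this
    omega
  rw [mul_inv_cancel₀ hf, h1] at h
  omega

theorem ord_algebraMap_nonneg {z : C.X} (r : C.X.presheaf.stalk z) :
    0 ≤ Scheme.ord (algebraMap _ C.FunField r) z := by
  by_cases hz : z = genericPoint C.X
  · subst hz; rw [ord_genericPoint]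
  by_cases hr : r = 0
  · simp [hr]
  obtain ⟨n, hn⟩ := exists_span_eq hz hr
  rw [ord_algebraMap_of_span_eq hz hn]
  positivity

theorem ord_algebraMap_eq_zero_iff {z : C.X} (hz : z ≠ genericPoint C.X) {r : C.X.presheaf.stalk z} (hr : r ≠ 0) :
    Scheme.ord (algebraMap _ C.FunField r) z = 0 ↔ IsUnit r := by
  obtain ⟨n, hn⟩ := exists_span_eq hz hr
  rw [ord_algebraMap_of_span_eq hz hn, ← Ideal.span_singleton_eq_top, hn]
  constructor
  · intro h
    rw [Nat.cast_eq_zero.1 h, pow_zero, Ideal.one_eq_top]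
  · intro h
    rcases n with _ | n
    · rfl
    · exact absurd (top_le_iff.1 (h.symm.le.trans (Ideal.pow_le_self n.succ_ne_zero)))
        (maximalIdeal.isMaximal _).ne_top

theorem ord_eq_zero_of_isUnit {z : C.X} {r : C.X.presheaf.stalk z} (hr : IsUnit r) :
    Scheme.ord (algebraMap _ C.FunField r) z = 0 := by
  by_cases hz : z = genericPoint C.X
  · subst hz; rw [ord_genericPoint]
  · exact (ord_algebraMap_eq_zero_iff hz hr.ne_zero).2 hr

theorem ord_nonneg_iff {z : C.X} (hz : z ≠ genericPoint C.X) {f : C.FunField} :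
    0 ≤ Scheme.ord f z ↔ ∃ r : C.X.presheaf.stalk z, algebraMap _ C.FunField r = f := by
  constructor
  · intro h
    have hD := (C.isDiscreteValuationRing_stalk hz).1
    rcases ValuationRing.isInteger_or_isInteger (C.X.presheaf.stalk z) f with ⟨r, hr⟩ | ⟨r, hr⟩
    · exact ⟨r, hr⟩
    · by_cases hf : f = 0
      · exact ⟨0, by simp [hf]⟩
      have h1 := ord_algebraMap_nonneg r
      have hr0 : r ≠ 0 := by
        rintro rfl
        simp [eq_comm, hf] at hr
      have h2 := ord_inv (f := f) z
      rw [← hr] at h2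
      obtain ⟨u, hu⟩ := (ord_algebraMap_eq_zero_iff hz hr0).1 (by omega)
      refine ⟨(u⁻¹ : (C.X.presheaf.stalk z)ˣ), ?_⟩
      have h3 : algebraMap _ C.FunField ((u⁻¹ : (C.X.presheaf.stalk z)ˣ) : C.X.presheaf.stalk z) * algebraMap _ C.FunField (u : C.X.presheaf.stalk z) = 1 := by
        rw [← map_mul]; simp
      rw [hu, hr] at h3
      exact (eq_of_mul_inv_eq_one h3)
  · rintro ⟨r, rfl⟩
    exact ord_algebraMap_nonneg r

theorem ord_one (z : C.X) : Scheme.ord (1 : C.FunField) z = 0 := by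
  have := ord_inv (f := (1 : C.FunField)) z
  rw [inv_one] at this
  omega

theorem ord_pow (f : C.FunField) (z : C.X) (n : ℕ) : Scheme.ord (f ^ n) z = n * Scheme.ord f z := by
  by_cases hf : f = 0
  · subst hf
    rcases n with _ | n
    · simp [ord_one]
    · simp
  induction n with
  | zero => simp [ord_one]
  | succ n ih => rw [pow_succ, Scheme.ord_mul (pow_ne_zero n hf) hf, ih]; push_cast; ring

/-- The sum must be nonzero because the zero function has the default order `0`, not infinity. -/
theorem le_ord_add {f g : C.FunField} {z : C.X} {n : ℤ} (hf : n ≤ Scheme.ord f z)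
    (hg : n ≤ Scheme.ord g z) (h : f + g ≠ 0) : n ≤ Scheme.ord (f + g) z := by
  by_cases hz : z = genericPoint C.X
  · subst hz; rw [ord_genericPoint] at *; exact hf
  have hD := (C.isDiscreteValuationRing_stalk hz).1
  exact (le_min hf hg).trans (Scheme.ord_add h)

theorem ord_algebraMap (q : ℚ) (z : C.X) : Scheme.ord (algebraMap ℚ C.FunField q) z = 0 := by
  by_cases hq : q = 0
  · simp [hq]
  rw [IsScalarTower.algebraMap_apply ℚ (C.X.presheaf.stalk z) C.FunField]
  exact ord_eq_zero_of_isUnit ((isUnit_iff_ne_zero.2 hq).map _)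

end Curve
end
end StackyCurve

/-! ### Integral closure and valuations -/

namespace StackyCurve
noncomputable section
namespace Curve
variable {C : Curve}
open IsLocalRing IntermediateField.algebraAdjoinAdjoin

/-- Since `V` is not the whole field, its centre is not generic, and the stalk there is a discrete
valuation ring dominated by `V`. Valuation rings are maximal for domination. -/
theorem exists_range_eq_valuationSubring (V : ValuationSubring C.FunField)
    (hV : ∀ q : ℚ, algebraMap ℚ C.FunField q ∈ V) (hV' : V ≠ ⊤) :
    ∃ z, z ≠ genericPoint C.X ∧
      (algebraMap (C.X.presheaf.stalk z) C.FunField).range = V.toSubring := by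
  obtain ⟨z, φ, hφ, hφ'⟩ := C.exists_center V hV
  have hz : z ≠ genericPoint C.X := by
    intro h
    apply hV'
    have hf := (C.isField_stalk_iff _).2 h
    rw [eq_top_iff]
    intro x _
    obtain ⟨r, rfl⟩ : ∃ r, algebraMap (C.X.presheaf.stalk z) C.FunField r = x := by
      let := hf.toField
      exact IsFractionRing.surjective_iff_isField.2 hf x
    rw [← hφ']
    exact (φ r).2
  refine ⟨z, hz, ?_⟩
  have hD := (C.isDiscreteValuationRing_stalk hz).1
  have h := bijective_rangeRestrict_comp_of_valuationRing (K := C.FunField) φ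
    (algebraMap V C.FunField) (RingHom.ext hφ')
  ext x
  constructor
  · rintro ⟨r, rfl⟩
    rw [← hφ']
    exact (φ r).2
  · intro hx
    obtain ⟨r, hr⟩ := h.2 ⟨x, ⟨⟨x, hx⟩, rfl⟩⟩
    exact ⟨r, (hφ' r).symm.trans (congrArg Subtype.val hr)⟩

theorem exists_lift_stalk {A : Type} [CommRing A] (f : A →+* C.FunField) (z : C.X)
    (h : ∀ a, ∃ r : C.X.presheaf.stalk z, algebraMap _ C.FunField r = f a) :
    ∃ g : A →+* C.X.presheaf.stalk z, ∀ a, algebraMap _ C.FunField (g a) = f a := by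
  have hinj : Function.Injective (algebraMap (C.X.presheaf.stalk z) C.FunField) :=
    IsFractionRing.injective _ _
  choose g hg using h
  exact ⟨{ toFun := g
           map_one' := hinj (by rw [hg, map_one, map_one])
           map_mul' := fun x y => hinj (by rw [hg, map_mul, map_mul, hg, hg])
           map_zero' := hinj (by rw [hg, map_zero, map_zero])
           map_add' := fun x y => hinj (by rw [hg, map_add, map_add, hg, hg]) }, hg⟩

theorem ord_nonneg_of_isIntegral {A : Type} [CommRing A] [Algebra A C.FunField] {z : C.X}
    (hA : ∀ a, 0 ≤ Scheme.ord (algebraMap A C.FunField a) z) {f : C.FunField}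
    (hf : IsIntegral A f) : 0 ≤ Scheme.ord f z := by
  by_cases hz : z = genericPoint C.X
  · rw [hz, ord_genericPoint]
  have hD := (C.isDiscreteValuationRing_stalk hz).1
  obtain ⟨g, hg⟩ := exists_lift_stalk (algebraMap A C.FunField) z
    (fun a => (ord_nonneg_iff hz).1 (hA a))
  have h := hf.map_of_comp_eq g (RingHom.id C.FunField) (RingHom.ext hg)
  rw [RingHom.id_apply, IsIntegrallyClosed.isIntegral_iff] at h
  exact (ord_nonneg_iff hz).2 h

/-- The integral closure is the intersection of the valuation rings that contain `A`, and each of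
these is the whole field or the local ring of a point. -/
theorem isIntegral_of_forall_ord_nonneg (A : Subalgebra ℚ C.FunField) {f : C.FunField}
    (h : ∀ z, (∀ a ∈ A, 0 ≤ Scheme.ord a z) → 0 ≤ Scheme.ord f z) : IsIntegral A f := by
  have h1 : f ∈ (integralClosure (Subring.closure (A : Set C.FunField)) C.FunField).toSubring := by
    rw [← iInf_valuationSubring_superset]
    simp only [Subring.mem_iInf]
    rintro ⟨V, hV⟩
    by_cases hT : V = ⊤
    · subst hT
      trivial
    obtain ⟨z, hz, hr⟩ := exists_range_eq_valuationSubring V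
      (fun q => hV (A.algebraMap_mem q)) hT
    have h2 := h z fun a ha => by
      rw [ord_nonneg_iff hz]
      have : a ∈ V.toSubring := hV ha
      rwa [← hr] at this
    rw [ord_nonneg_iff hz] at h2
    change f ∈ V.toSubring
    rw [← hr]
    exact h2
  have h2 : IsIntegral (Subring.closure (A : Set C.FunField)) f := h1
  have h3 : Subring.closure (A : Set C.FunField) ≤ A.toSubring := Subring.closure_le.2 le_rfl
  exact h2.map_of_comp_eq (Subring.inclusion h3) (RingHom.id _) (RingHom.ext fun _ => rfl)

theorem ord_aeval_nonneg {f : C.FunField} {z : C.X} (hf : 0 ≤ Scheme.ord f z) (p : Polynomial ℚ) :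
    0 ≤ Scheme.ord (Polynomial.aeval f p) z := by
  by_cases hz : z = genericPoint C.X
  · rw [hz, ord_genericPoint]
  obtain ⟨r, rfl⟩ := (ord_nonneg_iff hz).1 hf
  rw [Polynomial.aeval_algebraMap_apply]
  exact ord_algebraMap_nonneg _

theorem ord_adjoin_nonneg {f : C.FunField} {z : C.X} (hf : 0 ≤ Scheme.ord f z) {a : C.FunField}
    (ha : a ∈ Algebra.adjoin ℚ {f}) : 0 ≤ Scheme.ord a z := by
  rw [Algebra.adjoin_singleton_eq_range_aeval] at ha
  obtain ⟨p, rfl⟩ := ha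
  exact ord_aeval_nonneg hf p

theorem isIntegral_adjoin_iff {f g : C.FunField} : IsIntegral (Algebra.adjoin ℚ {f}) g ↔
    ∀ z, 0 ≤ Scheme.ord f z → 0 ≤ Scheme.ord g z := by
  constructor
  · intro h z hz
    exact ord_nonneg_of_isIntegral (fun a => ord_adjoin_nonneg hz a.2) h
  · intro h
    exact isIntegral_of_forall_ord_nonneg _ fun z hz => h z (hz f (Algebra.self_mem_adjoin_singleton ℚ f))

end Curve
end
end StackyCurve

/-! ### The prime `h = 0` of the polynomial ring `ℚ[h]` -/

namespace StackyCurve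
noncomputable section
namespace Curve
variable {C : Curve}
open IsLocalRing IntermediateField.algebraAdjoinAdjoin

section
variable {h : C.FunField} 

theorem isPrincipalIdealRing_adjoin (hh : Transcendental ℚ h) :
    IsPrincipalIdealRing (Algebra.adjoin ℚ {h}) :=
  IsPrincipalIdealRing.of_surjective (Polynomial.algEquivOfTranscendental ℚ h hh).toRingEquiv.toRingHom
    (Polynomial.algEquivOfTranscendental ℚ h hh).surjective

/-- The ideal of the polynomial ring `ℚ[h]` that is generated by `h`. -/
def zeroIdeal (h : C.FunField) : Ideal (Algebra.adjoin ℚ {h}) :=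
  Ideal.span {⟨h, Algebra.self_mem_adjoin_singleton ℚ h⟩}

theorem exists_sub_mem_zeroIdeal (a : Algebra.adjoin ℚ {h}) :
    ∃ q : ℚ, a - algebraMap ℚ _ q ∈ zeroIdeal h := by
  obtain ⟨a, ha⟩ := a
  have ha' := ha
  rw [Algebra.adjoin_singleton_eq_range_aeval] at ha'
  obtain ⟨p, rfl⟩ := ha'
  refine ⟨p.coeff 0, Ideal.mem_span_singleton'.2 ⟨⟨Polynomial.aeval h p.divX, 
    (Algebra.adjoin_singleton_eq_range_aeval ℚ h).ge ⟨_, rfl⟩⟩, Subtype.ext ?_⟩⟩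
  have := congrArg (Polynomial.aeval h) p.divX_mul_X_add
  simp only [map_add, map_mul, Polynomial.aeval_X, Polynomial.aeval_C] at this
  simp [← this]

theorem zeroIdeal_ne_top (hh : Transcendental ℚ h) : zeroIdeal h ≠ ⊤ := by
  rw [zeroIdeal, Ne, Ideal.span_singleton_eq_top]
  intro hu
  have := hu.map (Polynomial.algEquivOfTranscendental ℚ h hh).symm
  have h2 : (Polynomial.algEquivOfTranscendental ℚ h hh).symm ⟨h, Algebra.self_mem_adjoin_singleton ℚ h⟩ = Polynomial.X := by
    rw [AlgEquiv.symm_apply_eq]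
    exact Subtype.ext (by simp)
  rw [h2] at this
  exact Polynomial.not_isUnit_X this

theorem isMaximal_zeroIdeal (hh : Transcendental ℚ h) : (zeroIdeal h).IsMaximal := by
  refine Ideal.isMaximal_iff.2 ⟨fun h1 => zeroIdeal_ne_top hh (Ideal.eq_top_iff_one _ |>.2 h1), ?_⟩
  intro J x hJ hx hxJ
  obtain ⟨q, hq⟩ := exists_sub_mem_zeroIdeal x
  have hq0 : q ≠ 0 := by
    rintro rfl
    simp only [map_zero, sub_zero] at hq
    exact hx hq
  have : algebraMap ℚ (Algebra.adjoin ℚ {h}) q ∈ J := by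
    have := J.sub_mem hxJ (hJ hq)
    simpa using this
  have h2 := J.mul_mem_left (algebraMap ℚ _ q⁻¹) this
  rwa [← map_mul, inv_mul_cancel₀ hq0, map_one] at h2

/-- The residue field of `ℚ[h]` at `h = 0` is `ℚ`. -/
theorem bijective_residueField_zeroIdeal [hp : (zeroIdeal h).IsMaximal] (f : ℚ →+* (zeroIdeal h).ResidueField) :
    Function.Bijective f := by
  refine ⟨f.injective, fun y => ?_⟩
  obtain ⟨a, rfl⟩ := (Ideal.bijective_algebraMap_quotient_residueField (zeroIdeal h)).2 y
  obtain ⟨a, rfl⟩ := Ideal.Quotient.mk_surjective a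
  obtain ⟨q, hq⟩ := exists_sub_mem_zeroIdeal a
  refine ⟨q, ?_⟩
  rw [(Ideal.Quotient.mk_eq_mk_iff_sub_mem a _).2 hq]
  let g : ℚ →+* (zeroIdeal h).ResidueField := (algebraMap (Algebra.adjoin ℚ {h} ⧸ zeroIdeal h) _).comp
    ((Ideal.Quotient.mk _).comp (algebraMap ℚ (Algebra.adjoin ℚ {h})))
  exact RingHom.congr_fun (RingHom.ext_rat f g) q

end

end Curve
end
end StackyCurve

/-! ### Zeros of `h` as primes of the integral closure of `ℚ[h]` -/

namespace StackyCurve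
noncomputable section
namespace Curve
variable {C : Curve}
open IsLocalRing IntermediateField.algebraAdjoinAdjoin

instance finiteDimensional_adjoin_of_transcendental {h : C.FunField} [hh : Fact (Transcendental ℚ h)] :
    FiniteDimensional (IntermediateField.adjoin ℚ {h}) C.FunField :=
  finiteDimensional_of_transcendental ℚ C.FunField C.finrank_kaehlerDifferential_funField h hh.out

instance isDedekindDomain_integralClosure {h : C.FunField} [hh : Fact (Transcendental ℚ h)] :
    IsDedekindDomain (integralClosure (Algebra.adjoin ℚ {h}) C.FunField) := by
  have := isPrincipalIdealRing_adjoin hh.out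
  exact integralClosure.isDedekindDomain _ (IntermediateField.adjoin ℚ {h}) _

instance isFractionRing_integralClosure {h : C.FunField} [hh : Fact (Transcendental ℚ h)] :
    IsFractionRing (integralClosure (Algebra.adjoin ℚ {h}) C.FunField) C.FunField :=
  integralClosure.isFractionRing_of_finite_extension (IntermediateField.adjoin ℚ {h}) C.FunField

theorem ne_genericPoint_of_ord_ne_zero {f : C.FunField} {z : C.X} (hz : Scheme.ord f z ≠ 0) :
    z ≠ genericPoint C.X := by
  rintro rfl
  exact hz (ord_genericPoint f)

theorem mem_maximalIdeal_iff {z : C.X} (hz : z ≠ genericPoint C.X) {r : C.X.presheaf.stalk z}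
    (hr : r ≠ 0) : r ∈ maximalIdeal _ ↔ 0 < Scheme.ord (algebraMap _ C.FunField r) z := by
  rw [mem_maximalIdeal, mem_nonunits_iff, ← ord_algebraMap_eq_zero_iff hz hr]
  have := ord_algebraMap_nonneg r
  omega

theorem zeroIdeal_le_under {h : C.FunField} (q : Ideal (integralClosure (Algebra.adjoin ℚ {h}) C.FunField))
    (hq : algebraMap (Algebra.adjoin ℚ {h}) _ ⟨h, Algebra.self_mem_adjoin_singleton ℚ h⟩ ∈ q) :
    zeroIdeal h ≤ q.under (Algebra.adjoin ℚ {h}) := by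
  rw [zeroIdeal, Ideal.span_le, Set.singleton_subset_iff]
  exact hq

/-- A local ring that dominates the localization of a Dedekind domain at a nonzero prime, within
the fraction field, is equal to it. -/
theorem exists_localization_equiv_of_dominates {S O F : Type} [CommRing S] [IsDedekindDomain S] [CommRing O]
    [IsLocalRing O] [Field F] [Algebra S F] [IsFractionRing S F] [Algebra O F]
    (hinj : Function.Injective (algebraMap O F)) (g : S →+* O)
    (hg : ∀ x, algebraMap O F (g x) = algebraMap S F x) (q : Ideal S) [q.IsPrime]
    (hq : q = (maximalIdeal O).comap g) (hqbot : q ≠ ⊥) :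
    ∃ e : Localization.AtPrime q ≃+* O, ∀ x, e (algebraMap _ _ x) = g x := by
  have hmem : ∀ x, x ∉ q → IsUnit (g x) := fun x hx => by
    rw [hq] at hx
    simpa using hx
  let l : Localization.AtPrime q →+* O :=
    IsLocalization.lift (M := q.primeCompl) (g := g) fun y => hmem _ y.2
  have hl : ∀ x, l (algebraMap _ _ x) = g x := fun x => IsLocalization.lift_eq _ x
  -- Once `O` is known to dominate the discrete valuation ring `S_q`, the two agree by maximality.
  have hloc : IsLocalHom l := by
    refine ⟨fun a ha => ?_⟩
    obtain ⟨x, s, rfl⟩ := IsLocalization.exists_mk'_eq q.primeCompl a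
    rw [IsLocalization.AtPrime.isUnit_mk'_iff _ q]
    intro hx
    have h1 : l (IsLocalization.mk' _ x s) * g s = g x := by
      rw [← hl, ← hl, ← map_mul, IsLocalization.mk'_spec]
    rw [hq] at hx
    exact hx (h1 ▸ ha.mul (hmem _ s.2))
  let : Algebra (Localization.AtPrime q) F := ((algebraMap O F).comp l).toAlgebra
  have hT : IsScalarTower S (Localization.AtPrime q) F := IsScalarTower.of_algebraMap_eq fun x => by
    change _ = algebraMap O F (l _)
    rw [hl, hg]
  have hfr : IsFractionRing (Localization.AtPrime q) F :=
    IsFractionRing.isFractionRing_of_isDomain_of_isLocalization q.primeCompl _ _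
  have hDq := IsLocalization.AtPrime.isDiscreteValuationRing_of_dedekind_domain _ hqbot
    (Localization.AtPrime q)
  have hb := bijective_rangeRestrict_comp_of_valuationRing (K := F) l (algebraMap O F) rfl
  refine ⟨RingEquiv.ofBijective l ⟨fun a b hab => hb.1 (Subtype.ext ?_), fun y => ?_⟩, hl⟩
  · exact congrArg (algebraMap O F) hab
  · obtain ⟨a, ha⟩ := hb.2 ⟨_, ⟨y, rfl⟩⟩
    exact ⟨a, hinj (congrArg Subtype.val ha)⟩

/-- A zero of `h` gives a prime ideal of the integral closure of `ℚ[h]`, with the same local ring. -/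
theorem exists_localization_equiv {h : C.FunField} [hh : Fact (Transcendental ℚ h)] {z : C.X}
    (hz : 0 < Scheme.ord h z) :
    ∃ (q : Ideal (integralClosure (Algebra.adjoin ℚ {h}) C.FunField)) (_ : q.IsPrime)
      (_ : q.LiesOver (zeroIdeal h)) (e : Localization.AtPrime q ≃+* C.X.presheaf.stalk z),
      ∀ x : integralClosure (Algebra.adjoin ℚ {h}) C.FunField,
        algebraMap _ C.FunField (e (algebraMap _ _ x)) = x.1 := by
  have hz' := ne_genericPoint_of_ord_ne_zero hz.ne'
  obtain ⟨g, hg⟩ := exists_lift_stalk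
    (algebraMap (integralClosure (Algebra.adjoin ℚ {h}) C.FunField) C.FunField) z fun x =>
      (ord_nonneg_iff hz').1 (isIntegral_adjoin_iff.1 x.2 z hz.le)
  let q := (maximalIdeal (C.X.presheaf.stalk z)).comap g
  have hgh : g (algebraMap (Algebra.adjoin ℚ {h}) _ ⟨h, Algebra.self_mem_adjoin_singleton ℚ h⟩) ∈
      maximalIdeal (C.X.presheaf.stalk z) := by
    rw [mem_maximalIdeal_iff hz', hg]
    · exact hz
    · intro h0
      have h1 := hg (algebraMap (Algebra.adjoin ℚ {h}) _ ⟨h, Algebra.self_mem_adjoin_singleton ℚ h⟩)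
      rw [h0, map_zero] at h1
      change 0 = h at h1
      simp [← h1] at hz
  have hmax := isMaximal_zeroIdeal hh.out
  have hq : q.IsPrime := Ideal.comap_isPrime _ _
  have hover : q.LiesOver (zeroIdeal h) :=
    ⟨hmax.eq_of_le (Ideal.comap_ne_top _ hq.ne_top) (zeroIdeal_le_under q hgh)⟩
  have hqbot : q ≠ ⊥ := by
    intro h0
    have h1 : algebraMap (Algebra.adjoin ℚ {h}) _ ⟨h, Algebra.self_mem_adjoin_singleton ℚ h⟩ ∈ q := hgh
    rw [h0, Ideal.mem_bot] at h1
    have h2 : h = 0 := congrArg Subtype.val h1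
    simp [h2] at hz
  obtain ⟨e, he⟩ := exists_localization_equiv_of_dominates (IsFractionRing.injective _ C.FunField) g hg q
    rfl hqbot
  refine ⟨q, hq, hover, e, fun x => ?_⟩
  rw [he, hg]
  rfl

/-- Some valuation ring contains the integral closure and has the elements of `q` among its
nonunits. It is not the whole field since `h` is a nonzero nonunit, so it is the local ring of a
point, where `q` vanishes. -/
theorem exists_pt_of_primesOver {h : C.FunField} [hh : Fact (Transcendental ℚ h)]
    (q : Ideal (integralClosure (Algebra.adjoin ℚ {h}) C.FunField)) [hq : q.IsPrime]
    [hover : q.LiesOver (zeroIdeal h)] :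
    ∃ z, 0 < Scheme.ord h z ∧ ∀ x ∈ q, x.1 = 0 ∨ 0 < Scheme.ord x.1 z := by
  obtain ⟨V, hV, hqV⟩ := Ideal.image_subset_nonunits_valuationSubring
    (A := (integralClosure (Algebra.adjoin ℚ {h}) C.FunField).toSubring) q hq.ne_top
  have hh0 : h ≠ 0 := by
    rintro h0
    exact hh.out (h0 ▸ isAlgebraic_zero)
  have hVQ : ∀ r : ℚ, algebraMap ℚ C.FunField r ∈ V := fun r =>
    hV ((algebraMap ℚ (integralClosure (Algebra.adjoin ℚ {h}) C.FunField) r).2)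
  have hmem : algebraMap (Algebra.adjoin ℚ {h}) (integralClosure (Algebra.adjoin ℚ {h}) C.FunField)
      ⟨h, Algebra.self_mem_adjoin_singleton ℚ h⟩ ∈ q := by
    change _ ∈ q.under (Algebra.adjoin ℚ {h})
    rw [← hover.over]
    exact Ideal.mem_span_singleton_self _
  have hnon : ∀ x ∈ q, x.1 ∈ V.nonunits := fun x hx => hqV ⟨x, hx, rfl⟩
  obtain ⟨z, hz, hr⟩ := exists_range_eq_valuationSubring V hVQ (by
    rintro rfl
    rcases (ValuationSubring.mem_nonunits_iff_or _).1 (hnon _ hmem) with h1 | h1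
    · exact hh0 h1
    · exact h1 trivial)
  have key : ∀ x ∈ q, x.1 = 0 ∨ 0 < Scheme.ord x.1 z := by
    intro x hx
    by_contra! hcon
    refine ((ValuationSubring.mem_nonunits_iff_or _).1 (hnon _ hx)).elim hcon.1 fun h1 => h1 ?_
    have h2 : (x.1)⁻¹ ∈ V.toSubring := by
      rw [← hr, RingHom.mem_range, ← ord_nonneg_iff hz, ord_inv]
      omega
    exact h2
  exact ⟨z, (key _ hmem).resolve_left hh0, key⟩

end Curve
end
end StackyCurve

/-! ### Ramification indices and residue degrees -/

namespace StackyCurve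
noncomputable section
namespace Curve
variable {C : Curve}
open IsLocalRing IntermediateField.algebraAdjoinAdjoin

section

variable {A S O F : Type} [CommRing A] [CommRing S] [Algebra A S] [CommRing O]
  (q : Ideal S) [q.IsPrime] (e : Localization.AtPrime q ≃+* O)

/-- The ramification index is the length of `S_q / a S_q`, which a discrete valuation ring reads off
as the order of `a`. -/
theorem ramificationIdx_eq_of_span_eq [IsDomain O]
    [IsDiscreteValuationRing O] (a : A)
    [q.LiesOver (Ideal.span {a})] {n : ℕ}
    (h : Ideal.span {e (algebraMap S _ (algebraMap A S a))} = maximalIdeal O ^ n) :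
    q.ramificationIdx A = n := by
  have : IsDomain (Localization.AtPrime q) := e.toMulEquiv.isDomain O
  have hDq : IsDiscreteValuationRing (Localization.AtPrime q) :=
    IsDiscreteValuationRing.RingEquivClass.isDiscreteValuationRing e.symm
  obtain ⟨ϖ, hϖ⟩ := IsDiscreteValuationRing.exists_irreducible (Localization.AtPrime q)
  have hϖ' : Irreducible (e ϖ) := (MulEquiv.irreducible_iff e).2 hϖ
  rw [hϖ'.maximalIdeal_eq, Ideal.span_singleton_pow, Ideal.span_singleton_eq_span_singleton,
    ← map_pow] at h
  have h' := h.map e.symm.toRingHom.toMonoidHom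
  have h2 : Associated (algebraMap S (Localization.AtPrime q) (algebraMap A S a)) (ϖ ^ n) := by
    simpa using h'
  have hmap : (Ideal.span {a}).map (algebraMap A (Localization.AtPrime q)) =
      maximalIdeal (Localization.AtPrime q) ^ n := by
    rw [Ideal.map_span, Set.image_singleton, hϖ.maximalIdeal_eq, Ideal.span_singleton_pow]
    exact Ideal.span_singleton_eq_span_singleton.2 h2
  rw [Ideal.ramificationIdx_eq (Ideal.span {a}) q, hmap, hDq.length_quotient_pow_maximalIdeal,
    ENat.toNat_natCast]

theorem inertiaDeg_eq_finrank {A S O : Type} [CommRing A] [CommRing S] [Algebra A S] [CommRing O]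
    (q : Ideal S) [q.IsPrime] (e : Localization.AtPrime q ≃+* O) [IsLocalRing O] [Algebra ℚ (ResidueField O)] (p : Ideal A) [p.IsPrime]
    [q.LiesOver p]
    (g : ℚ →+* p.ResidueField) (hg : Function.Bijective g) :
    q.inertiaDeg A = Module.finrank ℚ (ResidueField O) := by
  let := Localization.AtPrime.algebraOfLiesOver p q
  rw [Ideal.inertiaDeg_eq p q]
  let i := (RingEquiv.ofBijective g hg).symm
  refine Algebra.finrank_eq_of_equiv_equiv i (ResidueField.mapEquiv e) ?_
  have h3 : algebraMap ℚ (ResidueField O) =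
    (((ResidueField.mapEquiv e).toRingHom.comp (algebraMap p.ResidueField q.ResidueField))).comp
      i.symm.toRingHom := RingHom.ext_rat _ _
  refine RingHom.ext fun x => ?_
  have := RingHom.congr_fun h3 (i x)
  refine this.trans ?_
  exact congrArg (fun y => (ResidueField.mapEquiv e) (algebraMap p.ResidueField q.ResidueField y))
    (i.symm_apply_apply x)

theorem mem_range_of_localization_equiv [Field F] [Algebra O F] [Algebra S F] [FaithfulSMul S F]
    (he : ∀ x, algebraMap O F (e (algebraMap S _ x)) = algebraMap S F x) (y : F) :
    y ∈ (algebraMap O F).range ↔ ∃ x s, s ∉ q ∧ y * algebraMap S F s = algebraMap S F x := by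
  constructor
  · rintro ⟨r, rfl⟩
    obtain ⟨r, rfl⟩ := e.surjective r
    obtain ⟨x, s, rfl⟩ := IsLocalization.exists_mk'_eq q.primeCompl r
    refine ⟨x, s, s.2, ?_⟩
    rw [← he, ← he, ← map_mul, ← map_mul, IsLocalization.mk'_spec]
  · rintro ⟨x, s, hs, hxs⟩
    refine ⟨e (IsLocalization.mk' _ x (⟨s, hs⟩ : q.primeCompl)), ?_⟩
    have hs0 : algebraMap S F s ≠ 0 := by
      rw [Ne, FaithfulSMul.algebraMap_eq_zero_iff]
      rintro rfl
      exact hs q.zero_mem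
    refine mul_right_cancel₀ hs0 (Eq.trans ?_ hxs.symm)
    rw [← he, ← he, ← map_mul, ← map_mul]
    exact congrArg (fun y => algebraMap O F (e y))
      (IsLocalization.mk'_spec _ x (⟨s, hs⟩ : q.primeCompl))

theorem mem_iff_of_localization_equiv [IsLocalRing O] (x : S) : x ∈ q ↔ e (algebraMap S _ x) ∈ maximalIdeal O := by
  rw [← IsLocalization.AtPrime.to_map_mem_maximal_iff (Localization.AtPrime q) q,
    mem_maximalIdeal, mem_maximalIdeal, mem_nonunits_iff, mem_nonunits_iff, isUnit_map_iff e]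

end

theorem ramificationIdx_mul_inertiaDeg {h : C.FunField} [hh : Fact (Transcendental ℚ h)] {z : C.X}
    (hz : 0 < Scheme.ord h z) (q : Ideal (integralClosure (Algebra.adjoin ℚ {h}) C.FunField))
    [q.IsPrime] [hq : q.LiesOver (zeroIdeal h)] (e : Localization.AtPrime q ≃+* C.X.presheaf.stalk z)
    (he : ∀ x : integralClosure (Algebra.adjoin ℚ {h}) C.FunField,
      algebraMap _ C.FunField (e (algebraMap _ _ x)) = x.1) :
    ((q.ramificationIdx (Algebra.adjoin ℚ {h}) * q.inertiaDeg (Algebra.adjoin ℚ {h}) : ℕ) : ℤ) =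
      max (Scheme.ord h z) 0 * C.degPt z := by
  have hz' := ne_genericPoint_of_ord_ne_zero hz.ne'
  have hD := (C.isDiscreteValuationRing_stalk hz').1
  have hmax := isMaximal_zeroIdeal hh.out
  have hex := he (algebraMap (Algebra.adjoin ℚ {h}) _ ⟨h, Algebra.self_mem_adjoin_singleton ℚ h⟩)
  have h1 : ((q.ramificationIdx (Algebra.adjoin ℚ {h}) : ℕ) : ℤ) = Scheme.ord h z := by
    obtain ⟨n, hn⟩ := exists_span_eq hz' (r := e (algebraMap _ _ (algebraMap (Algebra.adjoin ℚ {h}) _ ⟨h, Algebra.self_mem_adjoin_singleton ℚ h⟩))) (by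
      intro h0
      rw [h0, map_zero] at hex
      have h2 : (0 : C.FunField) = h := hex
      simp [← h2] at hz)
    have : q.LiesOver (Ideal.span
        {(⟨h, Algebra.self_mem_adjoin_singleton ℚ h⟩ : Algebra.adjoin ℚ {h})}) := hq
    rw [ramificationIdx_eq_of_span_eq q e _ hn, ← ord_algebraMap_of_span_eq hz' hn, hex]
    rfl
  rw [inertiaDeg_eq_finrank q e (zeroIdeal h) (algebraMap ℚ _) (bijective_residueField_zeroIdeal _),
    ← degPt_eq, max_eq_left hz.le, ← h1, Nat.cast_mul]

end Curve
end
end StackyCurve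

/-! ### The fundamental identity and the number of zeros -/

namespace StackyCurve
noncomputable section
namespace Curve
variable {C : Curve}
open IsLocalRing IntermediateField.algebraAdjoinAdjoin

section

variable {A : Type} [CommRing A] [IsDomain A] [IsPrincipalIdealRing A] (K L : Type) [Field K] [Field L]
  [Algebra A K] [IsFractionRing A K] [Algebra K L] [Algebra A L] [IsScalarTower A K L]
  [FiniteDimensional K L] [CharZero K] (p : Ideal A) [hp : p.IsMaximal]
  (S : Type) [CommRing S] [Algebra A S] [Algebra S L] [IsScalarTower A S L] [IsIntegralClosure S A L]

/-- The integral closure is finite and free over the principal ideal domain `A`, of rank `[L : K]`,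
so the identity `∑ e f = n` applies. -/
theorem sum_ramificationIdx_mul_inertiaDeg_integralClosure :
    Finite (p.primesOver S) ∧ ∀ _ : Fintype (p.primesOver S),
      ∑ q : p.primesOver S, q.1.ramificationIdx A * q.1.inertiaDeg A =
        Module.finrank K L := by
  have : Module.IsTorsionFree A L := by
    have := FaithfulSMul.trans A K L
    infer_instance
  have hfree : Module.Free A S := IsIntegralClosure.module_free _ K L _
  have hfin : Module.Finite A S := IsIntegralClosure.finite _ K L _
  refine ⟨Algebra.QuasiFinite.finite_primesOver p, fun _ => ?_⟩
  rw [Ideal.sum_ramification_inertia_eq_finrank p, IsIntegralClosure.rank _ K L]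

theorem isMaximal_of_liesOver_integralClosure {A : Type} [CommRing A] (L : Type) [Field L]
    [Algebra A L] (p : Ideal A) [hp : p.IsMaximal] (S : Type) [CommRing S] [Algebra A S] [Algebra S L]
    [IsScalarTower A S L] [IsIntegralClosure S A L] (q : Ideal S) [q.IsPrime]
    [hq : q.LiesOver p] : q.IsMaximal := by
  have := IsIntegralClosure.isIntegral_algebra A (A := S) L
  exact Ideal.isMaximal_of_isIntegral_of_isMaximal_comap q (hq.over ▸ hp)

end

/-- Distinct zeros give distinct primes because a point is determined by its local ring, here `S_q`.
Conversely a prime over `p` is contained in the prime of a point where it vanishes, and equals it by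
maximality. -/
theorem exists_primesOver_equiv {A S : Type} [CommRing A] [CommRing S] [Algebra A S]
    [Algebra S C.FunField] [FaithfulSMul S C.FunField] (p : Ideal A) (h : C.FunField)
    (h₁ : ∀ z, 0 < Scheme.ord h z → ∃ (q : Ideal S) (_ : q.IsPrime)
      (_ : q.LiesOver p) (e : Localization.AtPrime q ≃+* C.X.presheaf.stalk z),
      (∀ x, algebraMap _ C.FunField (e (algebraMap S _ x)) = algebraMap S C.FunField x) ∧
      ((q.ramificationIdx A * q.inertiaDeg A : ℕ) : ℤ) = max (Scheme.ord h z) 0 * C.degPt z)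
    (h₂ : ∀ q : Ideal S, q.IsPrime → q.LiesOver p → q.IsMaximal ∧ ∃ z, 0 < Scheme.ord h z ∧
      ∀ x ∈ q, algebraMap S C.FunField x = 0 ∨ 0 < Scheme.ord (algebraMap S C.FunField x) z) :
    ∃ E : {z // 0 < Scheme.ord h z} ≃ p.primesOver S,
      ∀ z, (((E z).1.ramificationIdx A * (E z).1.inertiaDeg A : ℕ) : ℤ) =
          max (Scheme.ord h z.1) 0 * C.degPt z.1 := by
  choose q hq hover e he hef using fun z : {z // 0 < Scheme.ord h z} => h₁ z.1 z.2
  have hmemq : ∀ (z : {z // 0 < Scheme.ord h z}) x, x ∈ q z ↔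
      algebraMap S C.FunField x = 0 ∨ 0 < Scheme.ord (algebraMap S C.FunField x) z := by
    intro z x
    have hz' := ne_genericPoint_of_ord_ne_zero z.2.ne'
    by_cases hx : x = 0
    · simp [hx]
    have hx1 : algebraMap S C.FunField x ≠ 0 := by
      rwa [Ne, FaithfulSMul.algebraMap_eq_zero_iff]
    have hne : e z (algebraMap _ _ x) ≠ 0 := by
      intro h0
      have := he z x
      rw [h0, map_zero] at this
      exact hx1 this.symm
    rw [or_iff_right hx1, ← he z x, ← mem_maximalIdeal_iff hz' hne,
      mem_iff_of_localization_equiv (q z) (e z)]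
  have hbij : Function.Bijective (fun z => (⟨q z, hq z, hover z⟩ : p.primesOver S)) := by
    constructor
    · intro z w hzw
      have hqq : q z = q w := congrArg Subtype.val hzw
      refine Subtype.ext (C.eq_of_range_eq (ne_genericPoint_of_ord_ne_zero z.2.ne') ?_)
      ext y
      rw [mem_range_of_localization_equiv (q z) (e z) (he z),
        mem_range_of_localization_equiv (q w) (e w) (he w), hqq]
    · rintro ⟨p', hp, hpo⟩
      obtain ⟨hmax, z, hz, hzp⟩ := h₂ p' hp hpo
      have hle : p' ≤ q ⟨z, hz⟩ := fun x hx => (hmemq ⟨z, hz⟩ x).2 (hzp x hx)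
      have heq : p' = q ⟨z, hz⟩ := hmax.eq_of_le (hq ⟨z, hz⟩).ne_top hle
      refine ⟨⟨z, hz⟩, ?_⟩
      subst heq
      rfl
  exact ⟨Equiv.ofBijective _ hbij, hef⟩

instance {h : C.FunField} : IsScalarTower (Algebra.adjoin ℚ {h})
    (integralClosure (Algebra.adjoin ℚ {h}) C.FunField) C.FunField :=
  IsScalarTower.of_algebraMap_eq fun _ => rfl

theorem exists_primesOver_equiv_integralClosure (h : C.FunField) [hh : Fact (Transcendental ℚ h)] :
    ∃ E : {z // 0 < Scheme.ord h z} ≃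
        (zeroIdeal h).primesOver (integralClosure (Algebra.adjoin ℚ {h}) C.FunField),
      ∀ z, (((E z).1.ramificationIdx (Algebra.adjoin ℚ {h}) *
        (E z).1.inertiaDeg (Algebra.adjoin ℚ {h}) : ℕ) : ℤ) =
          max (Scheme.ord h z.1) 0 * C.degPt z.1 := by
  have hmax := isMaximal_zeroIdeal hh.out
  refine exists_primesOver_equiv _ h (fun z hz => ?_) (fun q hq hover => ?_)
  · obtain ⟨q, hq, hover, e, he⟩ := exists_localization_equiv hz
    exact ⟨q, hq, hover, e, he, ramificationIdx_mul_inertiaDeg hz q e he⟩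
  · exact ⟨isMaximal_of_liesOver_integralClosure C.FunField (zeroIdeal h) _ q,
        exists_pt_of_primesOver q⟩

theorem sum_primesOver_eq_finrank (h : C.FunField) [hh : Fact (Transcendental ℚ h)] :
    Finite ((zeroIdeal h).primesOver (integralClosure (Algebra.adjoin ℚ {h}) C.FunField)) ∧
    ∀ _ : Fintype ((zeroIdeal h).primesOver (integralClosure (Algebra.adjoin ℚ {h}) C.FunField)),
     ∑ q : (zeroIdeal h).primesOver (integralClosure (Algebra.adjoin ℚ {h}) C.FunField),
        q.1.ramificationIdx (Algebra.adjoin ℚ {h}) * q.1.inertiaDeg (Algebra.adjoin ℚ {h}) =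
      Module.finrank (IntermediateField.adjoin ℚ {h}) C.FunField := by
  have hPID := isPrincipalIdealRing_adjoin hh.out
  have hmax := isMaximal_zeroIdeal hh.out
  exact sum_ramificationIdx_mul_inertiaDeg_integralClosure
    (IntermediateField.adjoin ℚ {h}) C.FunField (zeroIdeal h) _

theorem finite_and_finsum_eq_of_equiv {Z ι : Type*} [Finite ι] (f : Z → ℤ) (Q : Z → Prop)
    (hf : ∀ z, ¬ Q z → f z = 0) (E : {z // Q z} ≃ ι) (g : ι → ℕ) (hE : ∀ z, (g (E z) : ℤ) = f z.1)
    {n : ℕ} (hsum : ∀ _ : Fintype ι, ∑ i, g i = n) : {z | Q z}.Finite ∧ ∑ᶠ z, f z = n := by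
  have hF' : Finite {z // Q z} := Finite.of_equiv _ E.symm
  have hset : {z | Q z}.Finite := hF'
  refine ⟨hset, ?_⟩
  let I := Fintype.ofFinite ι
  let := Fintype.ofFinite {z // Q z}
  rw [← hsum I, ← E.sum_comp, Nat.cast_sum, finsum_eq_sum_of_support_subset (s := hset.toFinset)]
  · rw [← Finset.sum_coe_sort]
    refine Fintype.sum_equiv (Equiv.subtypeEquivRight fun z => by simp) _ _ fun z => ?_
    exact (hE ⟨z.1, hset.mem_toFinset.1 z.2⟩).symm
  · intro z hz
    by_contra hcon
    exact hz (hf z (by simpa using hcon))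

/-- The number of zeros of a nonconstant function is its degree. -/
theorem finite_setOf_ord_pos_and_finsum_eq_finrank {h : C.FunField} (hh : Transcendental ℚ h) :
    {z | 0 < Scheme.ord h z}.Finite ∧
      ∑ᶠ z, max (Scheme.ord h z) 0 * C.degPt z =
        Module.finrank (IntermediateField.adjoin ℚ {h}) C.FunField := by
  have : Fact (Transcendental ℚ h) := ⟨hh⟩
  obtain ⟨E, hE⟩ := exists_primesOver_equiv_integralClosure h
  obtain ⟨hF, hsum⟩ := sum_primesOver_eq_finrank h
  exact finite_and_finsum_eq_of_equiv _ (fun z => 0 < Scheme.ord h z)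
    (fun z hz => by rw [max_eq_right (not_lt.1 hz), zero_mul]) E _ hE hsum

end Curve
end
end StackyCurve

/-! ### Degrees of functions, divisors and pencils -/

namespace StackyCurve
noncomputable section
namespace Curve
variable {C : Curve}
open IsLocalRing

/-- The degree of a nonconstant function, and `0` for a constant. -/
def funDeg (f : C.FunField) : ℕ := Module.finrank (IntermediateField.adjoin ℚ {f}) C.FunField

theorem ord_eq_zero_of_isAlgebraic {f : C.FunField} (hf : IsAlgebraic ℚ f) (z : C.X) :
    Scheme.ord f z = 0 := by
  have h : ∀ g : C.FunField, IsAlgebraic ℚ g → 0 ≤ Scheme.ord g z := fun g hg =>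
    ord_nonneg_of_isIntegral (fun q => (ord_algebraMap q z).ge) hg.isIntegral
  have h1 := h _ hf.inv
  rw [ord_inv] at h1
  have := h _ hf
  omega

theorem adjoin_inv (f : C.FunField) :
    IntermediateField.adjoin ℚ {f⁻¹} = IntermediateField.adjoin ℚ {f} := by
  have h : ∀ g : C.FunField, IntermediateField.adjoin ℚ {g⁻¹} ≤ IntermediateField.adjoin ℚ {g} := by
    intro g
    rw [IntermediateField.adjoin_simple_le_iff]
    exact inv_mem (IntermediateField.mem_adjoin_simple_self ℚ g)
  refine le_antisymm (h f) ?_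
  have := h f⁻¹
  rwa [inv_inv] at this

theorem funDeg_inv (f : C.FunField) : funDeg f⁻¹ = funDeg f := by
  unfold funDeg
  rw [adjoin_inv]

/-- Here `finrank` takes its default value `0`: the function field has infinite degree over a finite
extension of `ℚ`. -/
theorem funDeg_eq_zero_of_isAlgebraic {f : C.FunField} (hf : IsAlgebraic ℚ f) : funDeg f = 0 := by
  by_contra h
  obtain ⟨x, hx⟩ := exists_transcendental ℚ C.FunField C.finrank_kaehlerDifferential_funField
  have h1 : FiniteDimensional (IntermediateField.adjoin ℚ {f}) C.FunField :=
    Module.finite_of_finrank_pos (Nat.pos_of_ne_zero h)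
  have h2 : FiniteDimensional ℚ (IntermediateField.adjoin ℚ {f}) :=
    IntermediateField.adjoin.finiteDimensional hf.isIntegral
  have h3 : FiniteDimensional ℚ C.FunField := FiniteDimensional.trans ℚ (IntermediateField.adjoin ℚ {f}) _
  exact hx (Algebra.IsAlgebraic.isAlgebraic x)

theorem transcendental_of_funDeg_pos {f : C.FunField} (hf : 0 < funDeg f) : Transcendental ℚ f :=
  fun h => hf.ne' (funDeg_eq_zero_of_isAlgebraic h)

theorem funDeg_pos {f : C.FunField} (hf : Transcendental ℚ f) : 0 < funDeg f := by
  have : Fact (Transcendental ℚ f) := ⟨hf⟩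
  exact Module.finrank_pos

theorem finite_setOf_ord_pos (f : C.FunField) : {z | 0 < Scheme.ord f z}.Finite := by
  by_cases hf : Transcendental ℚ f
  · exact (finite_setOf_ord_pos_and_finsum_eq_finrank hf).1
  · convert! Set.finite_empty
    ext z
    simp [ord_eq_zero_of_isAlgebraic (not_not.1 hf)]

theorem finsum_zeros (f : C.FunField) : ∑ᶠ z, max (Scheme.ord f z) 0 * C.degPt z = funDeg f := by
  by_cases hf : Transcendental ℚ f
  · exact (finite_setOf_ord_pos_and_finsum_eq_finrank hf).2
  · rw [funDeg_eq_zero_of_isAlgebraic (not_not.1 hf)]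
    simp [ord_eq_zero_of_isAlgebraic (not_not.1 hf)]

theorem finite_setOf_ord_neg (f : C.FunField) : {z | Scheme.ord f z < 0}.Finite := by
  have := finite_setOf_ord_pos f⁻¹
  simpa [ord_inv] using this

theorem finsum_poles (f : C.FunField) : ∑ᶠ z, max (- Scheme.ord f z) 0 * C.degPt z = funDeg f := by
  have := finsum_zeros f⁻¹
  simpa [ord_inv, funDeg_inv] using this

theorem finite_setOf_ord_ne_zero (f : C.FunField) : {z | Scheme.ord f z ≠ 0}.Finite :=
  ((finite_setOf_ord_pos f).union (finite_setOf_ord_neg f)).subset fun z hz => by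
    rcases lt_or_gt_of_ne hz with h | h
    · exact Or.inr h
    · exact Or.inl h

/-- Zeros and poles of `f` are both counted by `[F : ℚ(f)]`, as `ℚ(f⁻¹) = ℚ(f)`. -/
theorem finsum_ord (f : C.FunField) : ∑ᶠ z, Scheme.ord f z * C.degPt z = 0 := by
  have h1 := finsum_zeros f
  rw [← finsum_poles f, ← sub_eq_zero, ← finsum_sub_distrib] at h1
  · rw [← h1]
    refine finsum_congr fun z => ?_
    rw [← sub_mul]
    congr 1
    omega
  · refine (finite_setOf_ord_pos f).subset fun z hz => ?_
    by_contra h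
    simp only [Set.mem_ofPred_eq, not_lt] at h
    simp [h] at hz
  · refine (finite_setOf_ord_neg f).subset fun z hz => ?_
    by_contra h
    simp only [Set.mem_ofPred_eq, not_lt] at h
    simp [h] at hz

theorem degDiv_eq_finsum (D : C.X →₀ ℤ) : C.degDiv D = ∑ᶠ z, D z * C.degPt z := by
  rw [degDiv, finsum_eq_sum_of_support_subset (s := D.support)]
  · rfl
  · intro z hz
    simp only [Function.mem_support, ne_eq, mul_eq_zero, not_or] at hz
    simpa using hz.1

theorem ord_localCoords {n : ℕ} {s : Fin (n + 1) → C.FunField} {z : C.X} {u : C.FunField}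
    {r : Fin (n + 1) → C.X.presheaf.stalk z} (h : LocalCoords s z u r) (w : C.X.presheaf.stalk z)
    {f : C.FunField} (hf : f = u * algebraMap _ C.FunField w) (hf0 : f ≠ 0) :
    Scheme.ord u z ≤ Scheme.ord f z := by
  subst hf
  rw [Scheme.ord_mul h.1 (right_ne_zero_of_mul hf0)]
  have := ord_algebraMap_nonneg w
  omega

theorem le_ord_of_generates {n : ℕ} {s : Fin (n + 1) → C.FunField} {A : C.X →₀ ℤ}
    (hs : Generates s A) (c : Fin (n + 1) → ℚ) (z : C.X) (h0 : ∑ i, c i • s i ≠ 0) :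
    - A z ≤ Scheme.ord (∑ i, c i • s i) z := by
  obtain ⟨u, r, h, hu⟩ := hs z
  rw [← hu]
  refine ord_localCoords h (∑ i, c i • r i) ?_ h0
  rw [map_sum, Finset.mul_sum]
  refine Finset.sum_congr rfl fun i _ => ?_
  rw [h.2.1 i, Algebra.smul_def, Algebra.smul_def, map_mul,
    ← IsScalarTower.algebraMap_apply ℚ (C.X.presheaf.stalk z) C.FunField]
  ring

theorem exists_nat_forall_eval_ne_zero {ι : Type*} (Z : Set ι) (hZ : Z.Finite) (K : ι → Type)
    [∀ i, Field (K i)] [∀ i, CharZero (K i)] (p : ∀ i, Polynomial (K i)) (hp : ∀ i ∈ Z, p i ≠ 0) :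
    ∃ a : ℕ, ∀ i ∈ Z, (p i).eval (a : K i) ≠ 0 := by
  have hfin : (⋃ i ∈ Z, {a : ℕ | (p i).eval (a : K i) = 0}).Finite := by
    refine hZ.biUnion fun i hi => ?_
    refine Set.Finite.of_finite_image (f := fun a : ℕ => (a : K i)) ?_ Nat.cast_injective.injOn
    refine (Polynomial.finite_setOfPred_isRoot (hp i hi)).subset ?_
    rintro _ ⟨a, ha, rfl⟩
    exact ha
  obtain ⟨a, ha⟩ := hfin.exists_notMem
  refine ⟨a, fun i hi h => ha ?_⟩
  simp only [Set.mem_iUnion]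
  exact ⟨i, hi, h⟩

/-- A base point free linear system on a curve contains a base point free pencil. -/
theorem exists_pencil {n : ℕ} {s : Fin (n + 1) → C.FunField} {A : C.X →₀ ℤ} (hs : Generates s A) :
    ∃ c d : Fin (n + 1) → ℚ, ∑ i, c i • s i ≠ 0 ∧ ∑ i, d i • s i ≠ 0 ∧
      ∀ z, min (Scheme.ord (∑ i, c i • s i) z) (Scheme.ord (∑ i, d i • s i) z) = - A z := by
  obtain ⟨i₀, hi₀⟩ : ∃ i, s i ≠ 0 := by
    obtain ⟨u, r, h, -⟩ := hs (genericPoint C.X)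
    obtain ⟨i, hi⟩ := h.2.2
    refine ⟨i, ?_⟩
    rw [h.2.1 i]
    exact mul_ne_zero h.1 (hi.map _).ne_zero
  have hd : ∑ i, (Pi.single i₀ 1 : Fin (n + 1) → ℚ) i • s i = s i₀ := by
    rw [Finset.sum_eq_single i₀] <;> simp +contextual
  -- Away from `Z` the section `s i₀` already generates; a second section is needed only on this
  -- finite set.
  let Z : Set C.X := {z | Scheme.ord (s i₀) z ≠ - A z}
  have hle : ∀ z, - A z ≤ Scheme.ord (s i₀) z := fun z => by
    have := le_ord_of_generates hs (Pi.single i₀ 1) z (by rwa [hd])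
    rwa [hd] at this
  by_cases hZ0 : Z = ∅
  · refine ⟨_, _, hd.trans_ne hi₀, hd.trans_ne hi₀, fun z => ?_⟩
    rw [hd, min_self]
    by_contra hz
    exact Set.notMem_empty z (hZ0 ▸ hz)
  have hZ : Z.Finite := by
    refine ((finite_setOf_ord_ne_zero (s i₀)).union A.support.finite_toSet).subset fun z hz => ?_
    by_contra hcon
    simp only [Set.mem_union, Set.mem_ofPred_eq, Finset.mem_coe, Finsupp.mem_support_iff, not_or,
      not_not] at hcon
    exact hz (by rw [hcon.1, hcon.2, neg_zero])
  choose u r h hu using hs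
  have hchar : ∀ z, CharZero (ResidueField (C.X.presheaf.stalk z)) := fun z =>
    algebraRat.charZero _
  -- The second section is `∑ aⁱ sᵢ`, where `a` is no root, at any point of `Z`, of the polynomial
  -- whose coefficients are the residues of the `rᵢ`. That polynomial is nonzero because some `rᵢ`
  -- is a unit.
  obtain ⟨a, ha⟩ := exists_nat_forall_eval_ne_zero Z hZ (fun z => ResidueField (C.X.presheaf.stalk z))
    (fun z => ∑ i : Fin (n + 1), Polynomial.monomial i.1 (residue _ (r z i))) (by
      intro z _ h0
      obtain ⟨i, hi⟩ := (h z).2.2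
      have := congrArg (fun p => Polynomial.coeff p i.1) h0
      simp only [Polynomial.finsetSum_coeff, Polynomial.coeff_monomial, Polynomial.coeff_zero] at this
      rw [Finset.sum_eq_single i (fun j _ hj => if_neg fun hji => hj (Fin.ext hji)) (by simp), if_pos rfl] at this
      exact (hi.map (residue _)).ne_zero this)
  have hsum : ∀ z, ∑ i : Fin (n + 1), ((a : ℚ) ^ i.1) • s i =
      u z * algebraMap _ C.FunField (∑ i : Fin (n + 1), ((a : C.X.presheaf.stalk z) ^ i.1) * r z i) := by
    intro z
    rw [map_sum, Finset.mul_sum]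
    refine Finset.sum_congr rfl fun i _ => ?_
    rw [(h z).2.1 i, Algebra.smul_def, map_mul, map_pow, map_pow, map_natCast, map_natCast]
    ring
  have hunit : ∀ z ∈ Z, IsUnit (∑ i : Fin (n + 1), ((a : C.X.presheaf.stalk z) ^ i.1) * r z i) := by
    intro z hz
    by_contra hcon
    apply ha z hz
    rw [← mem_nonunits_iff, ← mem_maximalIdeal, ← residue_eq_zero_iff] at hcon
    rw [← hcon, map_sum, Polynomial.eval_finsetSum]
    refine Finset.sum_congr rfl fun i _ => ?_
    rw [Polynomial.eval_monomial, map_mul, map_pow, map_natCast, mul_comm]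
  obtain ⟨z₀, hz₀⟩ := Set.nonempty_iff_ne_empty.2 hZ0
  have hne : ∑ i : Fin (n + 1), ((a : ℚ) ^ i.1) • s i ≠ 0 := by
    rw [hsum z₀]
    exact mul_ne_zero (h z₀).1 ((hunit z₀ hz₀).map _).ne_zero
  refine ⟨fun i => (a : ℚ) ^ i.1, Pi.single i₀ 1, hne, hd.trans_ne hi₀, fun z => ?_⟩
  rw [hd]
  by_cases hz : z ∈ Z
  · have : Scheme.ord (∑ i : Fin (n + 1), ((a : ℚ) ^ i.1) • s i) z = - A z := by
      rw [hsum z, Scheme.ord_mul (h z).1 ((hunit z hz).map _).ne_zero,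
        ord_eq_zero_of_isUnit (hunit z hz), hu z, add_zero]
    rw [this, min_eq_left (hle z)]
  · have hz' : Scheme.ord (s i₀) z = - A z := not_not.1 hz
    rw [hz']
    exact min_eq_right (le_ord_of_generates (fun z => ⟨u z, r z, h z, hu z⟩) _ z hne)

/-- The divisor of poles of `f / g` is `A + div g`, and principal divisors have degree zero. -/
theorem degDiv_eq_funDeg {A : C.X →₀ ℤ} {f g : C.FunField} (hf : f ≠ 0) (hg : g ≠ 0)
    (h : ∀ z, min (Scheme.ord f z) (Scheme.ord g z) = - A z) : C.degDiv A = funDeg (f / g) := by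
  have hord : ∀ z, Scheme.ord (f / g) z = Scheme.ord f z - Scheme.ord g z := fun z => by
    rw [div_eq_mul_inv, Scheme.ord_mul hf (inv_ne_zero hg), ord_inv, sub_eq_add_neg]
  suffices key : ∑ᶠ z, A z * C.degPt z - ∑ᶠ z, max (- Scheme.ord (f / g) z) 0 * C.degPt z =
      - ∑ᶠ z, Scheme.ord g z * C.degPt z by
    rw [degDiv_eq_finsum, ← finsum_poles, ← sub_eq_zero, key, finsum_ord, neg_zero]
  rw [← finsum_sub_distrib, ← finsum_neg_distrib]
  · refine finsum_congr fun z => ?_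
    rw [hord, ← sub_mul, ← neg_mul]
    have := h z
    congr 1
    omega
  · refine A.support.finite_toSet.subset fun z hz => ?_
    simp only [Function.mem_support, ne_eq, mul_eq_zero, not_or] at hz
    simpa using hz.1
  · refine (finite_setOf_ord_neg (f / g)).subset fun z hz => ?_
    by_contra h
    simp only [Set.mem_ofPred_eq, not_lt] at h
    simp [h] at hz

end Curve
end
end StackyCurve

/-! ### Functions with prescribed poles and zeros -/

namespace StackyCurve
noncomputable section
namespace Curve
variable {C : Curve}
open IsLocalRing IntermediateField.algebraAdjoinAdjoin

theorem exists_ord_eq_one {z : C.X} (hz : z ≠ genericPoint C.X) : ∃ t : C.FunField, t ≠ 0 ∧ Scheme.ord t z = 1 := by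
  have hD := (C.isDiscreteValuationRing_stalk hz).1
  obtain ⟨ϖ, hϖ⟩ := IsDiscreteValuationRing.exists_irreducible (C.X.presheaf.stalk z)
  refine ⟨algebraMap _ _ ϖ, by simpa using hϖ.ne_zero, ?_⟩
  have := ord_algebraMap_of_span_eq (n := 1) hz (by rw [pow_one, hϖ.maximalIdeal_eq])
  simpa using this

theorem ord_zpow {f : C.FunField} (z : C.X) (n : ℤ) :
    Scheme.ord (f ^ n) z = n * Scheme.ord f z := by
  obtain ⟨k, rfl | rfl⟩ := n.eq_nat_or_neg
  · rw [zpow_natCast, ord_pow]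
  · rw [zpow_neg, zpow_natCast, ord_inv, ord_pow, neg_mul]

/-- Multiplication by `t ^ (-m)` makes the elements of `W` regular at `z`. Those with zero residue
form the kernel of a map into the residue field, whose dimension is the degree of `z`. -/
theorem exists_submodule_ord_succ {z : C.X} (hz : z ≠ genericPoint C.X) (m : ℤ)
    (W : Submodule ℚ C.FunField) [FiniteDimensional ℚ W] (hW : ∀ w ∈ W, w ≠ 0 → m ≤ Scheme.ord w z) :
    ∃ W' ≤ W, Module.finrank ℚ W ≤ Module.finrank ℚ W' + C.degPt z ∧
      ∀ w ∈ W', w ≠ 0 → m + 1 ≤ Scheme.ord w z := by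
  have hfin := (C.isDiscreteValuationRing_stalk hz).2
  obtain ⟨t, ht0, ht⟩ := exists_ord_eq_one hz
  let j : C.X.presheaf.stalk z →ₗ[ℚ] C.FunField :=
    (IsScalarTower.toAlgHom ℚ (C.X.presheaf.stalk z) C.FunField).toLinearMap
  have hj : Function.Injective j := IsFractionRing.injective (C.X.presheaf.stalk z) C.FunField
  let f : W →ₗ[ℚ] C.FunField := (LinearMap.mulLeft ℚ (t ^ (-m))).comp W.subtype
  have hf : ∀ w : W, w.1 ≠ 0 → Scheme.ord (f w) z = Scheme.ord w.1 z - m := fun w hw => by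
    change Scheme.ord (t ^ (-m) * w.1) z = _
    rw [Scheme.ord_mul (zpow_ne_zero _ ht0) hw, ord_zpow, ht]
    ring
  have hfr : ∀ w, f w ∈ LinearMap.range j := fun w => by
    by_cases hw : w.1 = 0
    · have : w = 0 := Subtype.ext hw
      rw [this, map_zero]
      exact zero_mem _
    · obtain ⟨r, hr⟩ := (ord_nonneg_iff hz (f := f w)).1 (by
        rw [hf w hw]
        have := hW w w.2 hw
        omega)
      exact ⟨r, hr⟩
  let g : W →ₗ[ℚ] C.X.presheaf.stalk z :=
    (LinearEquiv.ofInjective j hj).symm.toLinearMap.comp (f.codRestrict _ hfr)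
  have hg : ∀ w, algebraMap _ C.FunField (g w) = f w := fun w =>
    congrArg Subtype.val ((LinearEquiv.ofInjective j hj).apply_symm_apply ⟨f w, hfr w⟩)
  let π : W →ₗ[ℚ] ResidueField (C.X.presheaf.stalk z) :=
    (IsScalarTower.toAlgHom ℚ (C.X.presheaf.stalk z) (ResidueField (C.X.presheaf.stalk z))).toLinearMap.comp g
  refine ⟨(LinearMap.ker π).map W.subtype, Submodule.map_subtype_le _ _, ?_, ?_⟩
  · rw [← LinearMap.finrank_range_add_finrank_ker π, add_comm, degPt_eq,
      (Submodule.equivMapOfInjective W.subtype W.injective_subtype (LinearMap.ker π)).finrank_eq]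
    exact Nat.add_le_add_left (Submodule.finrank_le _) _
  · rintro _ ⟨w, hw, rfl⟩ hw0
    have h1 : residue _ (g w) = 0 := hw
    rw [residue_eq_zero_iff] at h1
    have hg0 : g w ≠ 0 := by
      intro h0
      have := hg w
      rw [h0, map_zero] at this
      exact mul_ne_zero (zpow_ne_zero _ ht0) hw0 this.symm
    have h2 := (mem_maximalIdeal_iff hz hg0).1 h1
    rw [hg, hf w hw0] at h2
    change _ ≤ Scheme.ord w.1 z
    omega

theorem exists_submodule_ord_add {z : C.X} (hz : z ≠ genericPoint C.X) (m : ℤ) (k : ℕ)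
    (W : Submodule ℚ C.FunField) [FiniteDimensional ℚ W] (hW : ∀ w ∈ W, w ≠ 0 → m ≤ Scheme.ord w z) :
    ∃ W' ≤ W, Module.finrank ℚ W ≤ Module.finrank ℚ W' + k * C.degPt z ∧
      ∀ w ∈ W', w ≠ 0 → m + k ≤ Scheme.ord w z := by
  induction k with
  | zero => exact ⟨W, le_rfl, by simp, by simpa using hW⟩
  | succ k ih =>
    obtain ⟨W₁, h₁, h₂, h₃⟩ := ih
    have := Submodule.finiteDimensional_of_le h₁
    obtain ⟨W₂, h₄, h₅, h₆⟩ := exists_submodule_ord_succ hz _ W₁ h₃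
    refine ⟨W₂, h₄.trans h₁, ?_, ?_⟩
    · rw [add_mul]; omega
    · push_cast
      simpa [add_assoc] using h₆

theorem exists_submodule_ord_add_finset (T : Finset C.X) (hT : ∀ z ∈ T, z ≠ genericPoint C.X)
    (b : C.X → ℤ) (k : C.X → ℕ) (W : Submodule ℚ C.FunField) [FiniteDimensional ℚ W]
    (hW : ∀ w ∈ W, w ≠ 0 → ∀ z, b z ≤ Scheme.ord w z) :
    ∃ W' ≤ W, Module.finrank ℚ W ≤ Module.finrank ℚ W' + ∑ z ∈ T, k z * C.degPt z ∧
      ∀ w ∈ W', w ≠ 0 → ∀ z ∈ T, b z + k z ≤ Scheme.ord w z := by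
  classical
  induction T using Finset.induction with
  | empty => exact ⟨W, le_rfl, by simp, by simp⟩
  | insert z T hzT ih =>
    obtain ⟨W₁, h₁, h₂, h₃⟩ := ih fun w hw => hT w (Finset.mem_insert_of_mem hw)
    have := Submodule.finiteDimensional_of_le h₁
    obtain ⟨W₂, h₄, h₅, h₆⟩ := exists_submodule_ord_add (hT z (Finset.mem_insert_self z T)) (b z) (k z) W₁
      fun w hw hw0 => hW w (h₁ hw) hw0 z
    refine ⟨W₂, h₄.trans h₁, ?_, ?_⟩
    · rw [Finset.sum_insert hzT]; omega
    · intro w hw hw0 y hy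
      rcases Finset.mem_insert.1 hy with rfl | hy
      · exact h₆ w hw hw0
      · exact h₃ w (h₄ hw) hw0 y hy

theorem linearIndependent_pow_mul {K F ι : Type*} [Field K] [Field F] [Algebra ℚ K] [Algebra K F]
    [Algebra ℚ F] [IsScalarTower ℚ K F] {x : K} (hx : Transcendental ℚ x) {v : ι → F}
    (hv : LinearIndependent K v) {n : ℕ} :
    LinearIndependent ℚ fun p : Fin n × ι => algebraMap K F x ^ p.1.1 * v p.2 := by
  have hpow : LinearIndependent ℚ fun i : Fin n => x ^ i.1 := by
    have h1 := ((Polynomial.basisMonomials ℚ).linearIndependent.map'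
      (Polynomial.aeval x).toLinearMap (LinearMap.ker_eq_bot.2
        (transcendental_iff_injective.1 hx))).comp (fun i : Fin n => i.1) Fin.val_injective
    have h2 : (fun i : Fin n => x ^ i.1) =
        (⇑(Polynomial.aeval (R := ℚ) x).toLinearMap ∘ ⇑(Polynomial.basisMonomials ℚ)) ∘ fun i => i.1 := by
      ext i
      simp
    rw [h2]
    exact h1
  convert linearIndependent_smul hpow hv using 1
  ext p
  rw [Algebra.smul_def, map_pow]

/-- A weak form of Riemann's inequality. A basis of the function field over `ℚ(φ)`, scaled to be
integral over `ℚ[φ]`, has poles bounded by `c` times those of `φ`; the products `φ ^ i * v j` with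
`i < N - c` span the space. For `N ≤ c` the truncated difference makes the dimension bound void. -/
theorem exists_submodule_poles {φ : C.FunField} (hφ : Transcendental ℚ φ) :
    ∃ c : ℕ, ∀ N : ℕ, ∃ W : Submodule ℚ C.FunField, FiniteDimensional ℚ W ∧
      funDeg φ * (N - c) ≤ Module.finrank ℚ W ∧
      ∀ w ∈ W, w ≠ 0 → ∀ z, N * min (Scheme.ord φ z) 0 ≤ Scheme.ord w z := by
  classical
  have : Fact (Transcendental ℚ φ) := ⟨hφ⟩
  have hφ0 : φ ≠ 0 := fun h0 => hφ (h0 ▸ isAlgebraic_zero)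
  let K := IntermediateField.adjoin ℚ {φ}
  let b := Module.finBasis K C.FunField
  have halg : Algebra.IsAlgebraic (Algebra.adjoin ℚ {φ}) C.FunField :=
    (IsFractionRing.comap_isAlgebraic_iff (K := K)).2 inferInstance
  obtain ⟨y, hy0, hy⟩ := Algebra.IsAlgebraic.exists_integral_multiples (Algebra.adjoin ℚ {φ})
    (Finset.univ.image b)
  let v : Fin (funDeg φ) → C.FunField := fun j => y.1 * b j
  have hy0' : y.1 ≠ 0 := fun h => hy0 (Subtype.ext h)
  have hv : ∀ j z, 0 ≤ Scheme.ord φ z → 0 ≤ Scheme.ord (v j) z := fun j =>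
    isIntegral_adjoin_iff.1 (hy _ (Finset.mem_image_of_mem _ (Finset.mem_univ j)))
  have hlin : LinearIndependent K v :=
    b.linearIndependent.map' (LinearMap.mulLeft K y.1)
      (LinearMap.ker_eq_bot.2 (mul_right_injective₀ hy0'))
  obtain ⟨c, hc⟩ : ∃ c : ℕ, ∀ j z, c * min (Scheme.ord φ z) 0 ≤ Scheme.ord (v j) z := by
    have hfin := finite_setOf_ord_neg φ
    refine ⟨∑ j, ∑ z ∈ hfin.toFinset, (- Scheme.ord (v j) z).toNat, fun j z => ?_⟩
    by_cases hz : Scheme.ord φ z < 0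
    · have h1 : (- Scheme.ord (v j) z).toNat ≤ ∑ j, ∑ z ∈ hfin.toFinset, (- Scheme.ord (v j) z).toNat :=
        (Finset.single_le_sum (f := fun z => (- Scheme.ord (v j) z).toNat) (fun _ _ => Nat.zero_le _)
          (hfin.mem_toFinset.2 hz)).trans
        (Finset.single_le_sum (f := fun j => ∑ z ∈ hfin.toFinset, (- Scheme.ord (v j) z).toNat)
          (fun _ _ => Nat.zero_le _) (Finset.mem_univ j))
      generalize ∑ j, ∑ z ∈ hfin.toFinset, (- Scheme.ord (v j) z).toNat = c at h1
      have h2 : - Scheme.ord (v j) z ≤ c := by omega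
      rw [min_eq_left hz.le]
      nlinarith
    · rw [min_eq_right (by omega), mul_zero]
      exact hv j z (by omega)
  refine ⟨c, fun N => ?_⟩
  let gen : K := IntermediateField.AdjoinSimple.gen ℚ φ
  have hgen : Transcendental ℚ gen := by
    intro h
    exact hφ (h.algebraMap (A := C.FunField))
  have hli := linearIndependent_pow_mul (n := N - c) hgen hlin
  refine ⟨Submodule.span ℚ (Set.range fun p : Fin (N - c) × Fin (funDeg φ) => algebraMap K C.FunField gen ^ p.1.1 * v p.2),
    FiniteDimensional.span_of_finite ℚ (Set.finite_range _), ?_, ?_⟩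
  · rw [finrank_span_eq_card hli, Fintype.card_prod, Fintype.card_fin, Fintype.card_fin, mul_comm]
  · intro w hw
    induction hw using Submodule.span_induction with
    | mem w hw =>
      obtain ⟨⟨i, j⟩, rfl⟩ := hw
      intro hw0 z
      change _ ≤ Scheme.ord (φ ^ i.1 * v j) z
      rw [Scheme.ord_mul (pow_ne_zero _ hφ0) (hlin.ne_zero j), ord_pow]
      have h1 := hc j z
      have hi := i.2
      by_cases hz : Scheme.ord φ z < 0
      · rw [min_eq_left hz.le] at h1 ⊢
        have h2 : (i.1 : ℤ) + c ≤ N := by omega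
        nlinarith
      · rw [min_eq_right (by omega)] at h1 ⊢
        have h3 : (0 : ℤ) ≤ i.1 * Scheme.ord φ z := mul_nonneg (by positivity) (by omega)
        omega
    | zero => exact fun h => absurd rfl h
    | add x y _ _ hx hy =>
      intro hxy z
      by_cases hx0 : x = 0
      · rw [hx0, zero_add] at hxy ⊢
        exact hy hxy z
      by_cases hy0 : y = 0
      · rw [hy0, add_zero] at hxy ⊢
        exact hx hxy z
      exact le_ord_add (hx hx0 z) (hy hy0 z) hxy
    | smul q x _ hx =>
      intro hqx z
      rw [Algebra.smul_def] at hqx ⊢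
      rw [Scheme.ord_mul (left_ne_zero_of_mul hqx) (right_ne_zero_of_mul hqx), ord_algebraMap, zero_add]
      exact hx (right_ne_zero_of_mul hqx) z

/-- If `φ` has more poles than `ψ`, there are functions whose poles are bounded by `N` times those of
`φ`, and which vanish along `N'` times the poles of `ψ`, for suitable `N < N'`. -/
theorem exists_section {φ ψ : C.FunField} (h : funDeg ψ < funDeg φ) :
    ∃ (N N' : ℕ) (g : C.FunField), N < N' ∧ g ≠ 0 ∧
      ∀ z, N * min (Scheme.ord φ z) 0 + N' * max (- Scheme.ord ψ z) 0 ≤ Scheme.ord g z := by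
  obtain ⟨c, hc⟩ := exists_submodule_poles (transcendental_of_funDeg_pos (by omega : 0 < funDeg φ))
  -- This value makes `funDeg φ * (N - c)` exceed `(N + 1) * funDeg ψ`, the cost of vanishing `N +
  -- 1` times along the poles of `ψ`.
  let N := c + funDeg φ * c + funDeg ψ + 1
  obtain ⟨W, hWf, hWd, hW⟩ := hc N
  have hψ := finite_setOf_ord_neg ψ
  obtain ⟨W', hle, hd, hW'⟩ := exists_submodule_ord_add_finset hψ.toFinset
    (fun z hz => ne_genericPoint_of_ord_ne_zero (f := ψ) (by
      exact (hψ.mem_toFinset.1 hz).ne)) _ (fun z => (N + 1) * (- Scheme.ord ψ z).toNat) W hW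
  have hsum : ∑ z ∈ hψ.toFinset, ((N + 1) * (- Scheme.ord ψ z).toNat) * C.degPt z = (N + 1) * funDeg ψ := by
    have h1 := finsum_poles ψ
    rw [finsum_eq_sum_of_support_subset (s := hψ.toFinset)] at h1
    · zify
      rw [← h1, Finset.mul_sum]
      refine Finset.sum_congr rfl fun z _ => ?_
      rw [mul_assoc, Int.ofNat_toNat]
    · intro z hz
      by_contra h
      simp only [Set.Finite.coe_toFinset, Set.mem_ofPred_eq, not_lt] at h
      simp [h] at hz
  have := Submodule.finiteDimensional_of_le hle
  have hpos : 0 < Module.finrank ℚ W' := by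
    by_contra h0
    have h2 : funDeg φ * (N - c) ≤ (N + 1) * funDeg ψ := by
      rw [Nat.eq_zero_of_not_pos h0, zero_add, hsum] at hd
      exact hWd.trans hd
    obtain ⟨k, hk⟩ : ∃ k, funDeg φ = funDeg ψ + 1 + k := ⟨_, (Nat.add_sub_of_le h).symm⟩
    have h3 : N - c = funDeg φ * c + funDeg ψ + 1 := by omega
    rw [h3] at h2
    have h4 : N = c + funDeg φ * c + funDeg ψ + 1 := rfl
    rw [h4, hk] at h2
    nlinarith [Nat.zero_le (k * c), Nat.zero_le (k * k * c), Nat.zero_le (k * funDeg ψ * c),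
      Nat.zero_le (funDeg ψ * c), Nat.zero_le (k * funDeg ψ)]
  obtain ⟨⟨g, hg⟩, hg0⟩ := Module.finrank_pos_iff_exists_ne_zero.1 hpos
  have hg0' : g ≠ 0 := fun h => hg0 (Subtype.ext h)
  refine ⟨N, N + 1, g, by omega, hg0', fun z => ?_⟩
  by_cases hz : Scheme.ord ψ z < 0
  · have := hW' g hg hg0' z (hψ.mem_toFinset.2 hz)
    rw [max_eq_left (by omega)]
    push_cast at this ⊢
    rwa [Int.toNat_of_nonneg (by omega)] at this
  · have := hW g (hle hg) hg0' z
    rw [max_eq_right (by omega)]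
    simpa using this

end Curve
end
end StackyCurve

/-! ### Absolute heights over number fields -/

namespace StackyCurve
noncomputable section

open NumberField Height

section
variable {K : Type*} [Field K] [NumberField K]

open scoped Classical in
theorem prod_infinitePlace_pow_mult (f : InfinitePlace K → ℝ) :
    ∏ v : InfinitePlace K, f v ^ v.mult = ∏ φ : K →+* ℂ, f (InfinitePlace.mk φ) := by
  rw [← Finset.univ.prod_fiberwise (fun φ : K →+* ℂ => InfinitePlace.mk φ)]
  refine Finset.prod_congr rfl fun v _ => ?_
  rw [Finset.prod_congr rfl (g := fun _ => f v)
    (fun φ hφ => by rw [(Finset.mem_filter.mp hφ).2]), Finset.prod_const,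
    InfinitePlace.card_filter_mk_eq]

/-- The finite places contribute the inverse norm of the ideal generated by the coordinates. The
archimedean part is indexed by embeddings instead of places, which absorbs their multiplicities. -/
theorem absNorm_mul_mulHeight {ι : Type*} [Finite ι] {x : ι → 𝓞 K} (hx : x ≠ 0) :
    (Ideal.span (Set.range x)).absNorm * mulHeight (fun i => (x i : K)) =
      ∏ φ : K →+* ℂ, ⨆ i, ‖φ (x i)‖ := by
  have hx' : (fun i => (x i : K)) ≠ 0 := by
    intro h
    exact hx (funext fun i => by simpa using congrFun h i)
  rw [NumberField.mulHeight_eq hx', mul_left_comm, absNorm_mul_finprod_finitePlace_eq_one hx, mul_one,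
    prod_infinitePlace_pow_mult]
  simp only [InfinitePlace.apply]

variable {L : Type*} [Field L] [NumberField L] [Algebra K L]

open scoped Classical in
theorem card_embeddings_over (φ : K →+* ℂ) :
    (Finset.univ.filter fun σ : L →+* ℂ => σ.comp (algebraMap K L) = φ).card =
      Module.finrank K L := by
  let := φ.toAlgebra
  have : FiniteDimensional K L := FiniteDimensional.right ℚ K L
  rw [← AlgHom.card K L ℂ, ← Fintype.card_subtype]
  refine Fintype.card_congr ?_
  exact
    { toFun := fun σ => { σ.1 with commutes' := fun r => RingHom.congr_fun σ.2 r }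
      invFun := fun σ => ⟨σ.toRingHom, RingHom.ext fun r => σ.commutes r⟩
      left_inv := fun σ => rfl
      right_inv := fun σ => rfl }

open scoped Classical in
theorem prod_embeddings_comp (f : (K →+* ℂ) → ℝ) :
    ∏ σ : L →+* ℂ, f (σ.comp (algebraMap K L)) = (∏ φ, f φ) ^ Module.finrank K L := by
  rw [← Finset.univ.prod_fiberwise (fun σ : L →+* ℂ => σ.comp (algebraMap K L)),
    ← Finset.prod_pow]
  refine Finset.prod_congr rfl fun φ _ => ?_
  rw [Finset.prod_congr rfl (g := fun _ => f φ)
    (fun σ hσ => by rw [(Finset.mem_filter.mp hσ).2]), Finset.prod_const, card_embeddings_over]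

theorem exists_integer_smul {ι : Type*} [Finite ι] (y : ι → K) :
    ∃ (b : K) (x : ι → 𝓞 K), b ≠ 0 ∧ ∀ i, (x i : K) = b * y i := by
  have := Fintype.ofFinite ι
  obtain ⟨b, hb⟩ := IsLocalization.exist_integer_multiples (nonZeroDivisors (𝓞 K)) Finset.univ y
  choose v hv using fun i => hb i (Finset.mem_univ i)
  exact ⟨((b : 𝓞 K) : K), v, by simp, fun i => (hv i).trans (Algebra.smul_def _ _)⟩

/-- For integral coordinates both factors of the height are explicit: each embedding of `K` has `[L
: K]` extensions, and the norm of the extended ideal is the `[L : K]`-th power. -/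
theorem mulHeight_algebraMap {ι : Type*} [Finite ι] (y : ι → K) :
    mulHeight (fun i => algebraMap K L (y i)) = mulHeight y ^ Module.finrank K L := by
  by_cases hy : y = 0
  · subst hy
    have : (fun i : ι => algebraMap K L ((0 : ι → K) i)) = 0 := by ext; simp
    rw [this]; simp
  obtain ⟨b, x, hb, hx⟩ := exists_integer_smul y
  have hx0 : x ≠ 0 := by
    rintro rfl
    apply hy
    ext i
    have := hx i
    simpa [hb] using this.symm
  have h1 : mulHeight y = mulHeight (fun i => (x i : K)) := by
    rw [← mulHeight_smul_eq_mulHeight y hb]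
    congr 1
    ext i
    rw [hx i]; rfl
  let x' : ι → 𝓞 L := fun i => algebraMap (𝓞 K) (𝓞 L) (x i)
  have hx'c : ∀ i, (x' i : L) = algebraMap K L (x i) := fun i => rfl
  have hb' : algebraMap K L b ≠ 0 := by simpa
  have h2 : mulHeight (fun i => algebraMap K L (y i)) = mulHeight (fun i => (x' i : L)) := by
    rw [← mulHeight_smul_eq_mulHeight _ hb']
    congr 1
    ext i
    rw [hx'c, hx i, map_mul]; rfl
  have hx'0 : x' ≠ 0 := by
    intro h
    apply hx0
    ext i
    have := hx'c i
    rw [h] at this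
    simpa using this.symm
  have e1 := absNorm_mul_mulHeight hx0
  have e2 := absNorm_mul_mulHeight hx'0
  have h3 : Ideal.span (Set.range x') = (Ideal.span (Set.range x)).map (algebraMap (𝓞 K) (𝓞 L)) := by
    rw [Ideal.map_span, ← Set.range_comp]; rfl
  have h4 : (Ideal.span (Set.range x)).absNorm ≠ 0 := by
    rw [Ne, Ideal.absNorm_eq_zero_iff, Ideal.span_eq_bot]
    intro h
    exact hx0 (funext fun i => h _ ⟨i, rfl⟩)
  have h5 : Module.finrank (𝓞 K) (𝓞 L) = Module.finrank K L :=
    (IsFractionRing.finrank_eq (𝓞 K) K (𝓞 L) L).symm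
  have h6 : ∏ σ : L →+* ℂ, ⨆ i, ‖σ (x' i)‖ =
      (∏ φ : K →+* ℂ, ⨆ i, ‖φ (x i)‖) ^ Module.finrank K L :=
    prod_embeddings_comp (L := L) (fun φ : K →+* ℂ => ⨆ i, ‖φ (x i)‖)
  rw [h6, ← e1, h3, Ideal.absNorm_algebraMap, h5, mul_pow, Nat.cast_pow] at e2
  rw [h1, h2]
  refine mul_left_cancel₀ ?_ e2
  exact_mod_cast pow_ne_zero _ h4

end

/-- The absolute multiplicative Weil height of a family of algebraic numbers. -/
def ht {ι : Type*} [Finite ι] (x : ι → Qbar) : ℝ :=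
  haveI : NumberField (IntermediateField.adjoin ℚ (Set.range x)) :=
    { to_finiteDimensional := IntermediateField.finiteDimensional_adjoin
        fun y _ => (Algebra.IsAlgebraic.isAlgebraic y).isIntegral }
  Height.mulHeight (fun i => (⟨x i, IntermediateField.subset_adjoin ℚ _ ⟨i, rfl⟩⟩ :
      IntermediateField.adjoin ℚ (Set.range x))) ^
    (1 / (Module.finrank ℚ (IntermediateField.adjoin ℚ (Set.range x)) : ℝ))

theorem absHeight_eq_ht {n : ℕ} (x : Fin (n + 1) → Qbar) : absHeight x = ht x := rfl

/-- The absolute height can be computed over any number field containing the coordinates. -/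
theorem ht_eq {K : Type*} [Field K] [NumberField K] (σ : K →+* Qbar) {ι : Type*} [Finite ι]
    (y : ι → K) :
    ht (fun i => σ (y i)) = mulHeight y ^ (1 / (Module.finrank ℚ K : ℝ)) := by
  have hE : NumberField (IntermediateField.adjoin ℚ (Set.range fun i => σ (y i))) :=
    { to_finiteDimensional := IntermediateField.finiteDimensional_adjoin
        fun y _ => (Algebra.IsAlgebraic.isAlgebraic y).isIntegral }
  unfold ht
  set E := IntermediateField.adjoin ℚ (Set.range fun i => σ (y i)) with hEdef
  let τ : K →ₐ[ℚ] Qbar := σ.toRatAlgHom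
  have hle : E ≤ τ.fieldRange := by
    rw [IntermediateField.adjoin_le_iff]
    rintro _ ⟨i, rfl⟩
    exact ⟨y i, rfl⟩
  let ρ : E →ₐ[ℚ] K :=
    (show τ.fieldRange →ₐ[ℚ] K from (AlgEquiv.ofInjectiveField τ).symm.toAlgHom).comp
      (IntermediateField.inclusion hle)
  let : Algebra E K := ρ.toRingHom.toAlgebra
  have : FiniteDimensional E K := FiniteDimensional.right ℚ E K
  have h1 : ∀ (i) (h : σ (y i) ∈ E), algebraMap E K ⟨σ (y i), h⟩ = y i := by
    intro i h
    exact (AlgEquiv.ofInjectiveField τ).symm_apply_apply (y i)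
  have h2 := mulHeight_algebraMap (L := K) (fun i => (⟨σ (y i),
    IntermediateField.subset_adjoin ℚ _ ⟨i, rfl⟩⟩ : E))
  simp only [h1] at h2
  have h3 := Module.finrank_mul_finrank ℚ E K
  have h4 : 0 < Module.finrank ℚ E := Module.finrank_pos
  have h5 : 0 < Module.finrank E K := Module.finrank_pos
  rw [h2, ← h3, ← Real.rpow_natCast, ← Real.rpow_mul (mulHeight_pos _).le]
  congr 1
  push_cast
  field_simp
  exact div_self (by exact_mod_cast h4.ne')

end
end StackyCurve

/-! ### Local estimates and inequalities between heights -/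

namespace StackyCurve
noncomputable section

open NumberField Height

section places
variable {K : Type*} [Field K]

open AdmissibleAbsValues in
-- This multiplies the local inequalities; the constant enters once for each archimedean absolute
-- value, counted with multiplicity.
theorem mulHeight_le_of_forall_absVal [AdmissibleAbsValues K] {ι ι' : Type*} [Finite ι] [Finite ι'] [Nonempty ι]
    {x : ι → K} {y : ι' → K} (hy : y ≠ 0) {C : ℝ} (hC : 1 ≤ C)
    (h1 : ∀ v ∈ archAbsVal (K := K), ∀ i, v (x i) ≤ C * ⨆ j, v (y j))
    (h2 : ∀ v ∈ nonarchAbsVal (K := K), ∀ i, v (x i) ≤ ⨆ j, v (y j)) :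
    mulHeight x ≤ C ^ totalWeight K * mulHeight y := by
  rcases eq_or_ne x 0 with h | h
  · rw [h, mulHeight_zero]
    exact one_le_mul_of_one_le_of_one_le (one_le_pow₀ hC) (one_le_mulHeight _)
  rw [Height.mulHeight_eq h, Height.mulHeight_eq hy, ← mul_assoc]
  gcongr
  · exact finprod_nonneg fun v ↦ Real.iSup_nonneg_of_nonnegHomClass v.val _
  · exact mul_nonneg (by positivity)
      (Multiset.prod_map_nonneg fun v _ ↦ Real.iSup_nonneg_of_nonnegHomClass v _)
  · rw [← Multiset.prod_replicate, totalWeight, ← Multiset.map_const', ← Multiset.prod_map_mul]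
    exact Multiset.prod_map_le_prod_map₀ _ _
      (fun v _ ↦ Real.iSup_nonneg_of_nonnegHomClass v _) fun v hv ↦ ciSup_le (h1 v hv)
  · exact finprod_le_finprod (by fun_prop)
      (fun v ↦ Real.iSup_nonneg_of_nonnegHomClass v.val _) (by fun_prop)
      fun v ↦ ciSup_le (h2 _ v.2)

/-- A bound for the roots of a monic polynomial. -/
theorem abv_le_of_pow_eq_sum (v : AbsoluteValue K ℝ) {d : ℕ} (hd : 0 < d) {y : K} {c : ℕ → K}
    (h : y ^ d = ∑ k ∈ Finset.range d, c k * y ^ k) {S : ℝ} (hS : 1 ≤ S)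
    (hc : ∀ k < d, v (c k) ≤ S) : v y ≤ d * S := by
  by_contra! hy
  have hd1 : (1 : ℝ) ≤ d := by exact_mod_cast hd
  have hy1 : 1 < v y := (one_le_mul_of_one_le_of_one_le hd1 hS).trans_lt hy
  have h1 : v y ^ d ≤ ∑ k ∈ Finset.range d, S * v y ^ (d - 1) := by
    rw [← map_pow, h]
    refine (v.sum_le _ _).trans (Finset.sum_le_sum fun k hk => ?_)
    rw [Finset.mem_range] at hk
    rw [map_mul, map_pow]
    exact mul_le_mul (hc k hk) (pow_le_pow_right₀ hy1.le (by omega))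
      (pow_nonneg (v.nonneg _) _) (by linarith)
  rw [Finset.sum_const, Finset.card_range, nsmul_eq_mul] at h1
  have h2 : v y ^ d = v y * v y ^ (d - 1) := by
    rw [← pow_succ', Nat.sub_add_cancel hd]
  have h3 : 0 < v y ^ (d - 1) := by positivity
  nlinarith

theorem abv_le_one_of_pow_eq_sum {v : AbsoluteValue K ℝ} (hv : IsNonarchimedean v)
    {d : ℕ} (hd : 0 < d) {y : K} {c : ℕ → K}
    (h : y ^ d = ∑ k ∈ Finset.range d, c k * y ^ k)
    (hc : ∀ k < d, v (c k) ≤ 1) : v y ≤ 1 := by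
  by_contra! hy
  have : Nonempty (Finset.range d) := ⟨⟨0, Finset.mem_range.2 hd⟩⟩
  have h1 : v y ^ d ≤ ⨆ k : Finset.range d, v (c k * y ^ (k : ℕ)) := by
    rw [← map_pow, h]
    exact hv.apply_sum_le
  obtain ⟨k, hk⟩ := exists_eq_ciSup_of_finite (f := fun k : Finset.range d => v (c k * y ^ (k : ℕ)))
  rw [← hk, map_mul, map_pow] at h1
  have hkd := Finset.mem_range.1 k.2
  have h2 : v (c k) * v y ^ (k : ℕ) ≤ 1 * v y ^ (k : ℕ) :=
    mul_le_mul_of_nonneg_right (hc k hkd) (pow_nonneg (v.nonneg _) _)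
  have h3 : v y ^ (k : ℕ) < v y ^ d := pow_lt_pow_right₀ hy hkd
  linarith

theorem abv_intCast_le (v : AbsoluteValue K ℝ) (n : ℤ) : v n ≤ |(n : ℝ)| := by
  obtain ⟨m, rfl | rfl⟩ := n.eq_nat_or_neg
  · simpa using v.apply_nat_le_self m
  · simpa using v.apply_nat_le_self m

theorem abv_aeval_le (v : AbsoluteValue K ℝ) (p : Polynomial ℤ) {a : K} (ha : v a ≤ 1) :
    v (Polynomial.aeval a p) ≤ ∑ i ∈ Finset.range (p.natDegree + 1), |(p.coeff i : ℝ)| := by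
  rw [Polynomial.aeval_eq_sum_range]
  refine (v.sum_le _ _).trans (Finset.sum_le_sum fun i hi => ?_)
  rw [zsmul_eq_mul, map_mul, map_pow]
  calc _ ≤ |(p.coeff i : ℝ)| * 1 := mul_le_mul (abv_intCast_le v _)
        (pow_le_one₀ (v.nonneg _) ha) (pow_nonneg (v.nonneg _) _) (abs_nonneg _)
    _ = _ := mul_one _

theorem abv_aeval_le_one {v : AbsoluteValue K ℝ} (hv : IsNonarchimedean v)
    (p : Polynomial ℤ) {a : K} (ha : v a ≤ 1) : v (Polynomial.aeval a p) ≤ 1 := by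
  rw [Polynomial.aeval_eq_sum_range]
  have : Nonempty (Finset.range (p.natDegree + 1)) := ⟨⟨0, by simp⟩⟩
  refine hv.apply_sum_le.trans (ciSup_le fun i => ?_)
  rw [zsmul_eq_mul, map_mul, map_pow]
  exact mul_le_one₀ hv.apply_intCast_le_one (pow_nonneg (v.nonneg _) _)
    (pow_le_one₀ (v.nonneg _) ha)

end places

/-- A uniform bound for solutions of monic equations with coefficients in `ℤ[a]`, `|a| ≤ 1`. -/
theorem exists_abv_le {ι : Type*} [Fintype ι] (d : ι → ℕ) (hd : ∀ j, 0 < d j)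
    (c : ι → ℕ → Polynomial ℤ) :
    ∃ R : ℝ, 1 ≤ R ∧ ∀ (K : IntermediateField ℚ Qbar) (v : AbsoluteValue K ℝ) (a : K) (j : ι)
      (y : K), v a ≤ 1 →
      y ^ d j = ∑ k ∈ Finset.range (d j), Polynomial.aeval a (c j k) * y ^ k →
      v y ≤ R ∧ (IsNonarchimedean v → v y ≤ 1) := by
  -- The bounds use only absolute values of integer coefficients, so they depend neither on the
  -- field nor on the place.
  let s : ι → ℕ → ℝ := fun j k => ∑ i ∈ Finset.range ((c j k).natDegree + 1), |((c j k).coeff i : ℝ)|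
  have hs : ∀ j k, 0 ≤ s j k := fun j k => Finset.sum_nonneg fun i _ => abs_nonneg _
  let T : ι → ℝ := fun j => d j * (1 + ∑ k ∈ Finset.range (d j), s j k)
  have hs' : ∀ j, 0 ≤ ∑ k ∈ Finset.range (d j), s j k := fun j => Finset.sum_nonneg fun k _ => hs j k
  have hT : ∀ j, 0 ≤ T j := fun j => mul_nonneg (Nat.cast_nonneg _) (by linarith [hs' j])
  refine ⟨1 + ∑ j, T j, by linarith [Finset.sum_nonneg fun j (_ : j ∈ Finset.univ) => hT j],
    fun K v a j y ha h => ⟨?_, fun hv => ?_⟩⟩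
  · have h1 : v y ≤ T j := abv_le_of_pow_eq_sum v (hd j) h (by linarith [hs' j]) fun k hk => by
      have h2 : s j k ≤ ∑ k ∈ Finset.range (d j), s j k :=
        Finset.single_le_sum (fun k _ => hs j k) (Finset.mem_range.2 hk)
      exact (abv_aeval_le v (c j k) ha).trans (h2.trans (le_add_of_nonneg_left zero_le_one))
    have h2 : T j ≤ ∑ j, T j := Finset.single_le_sum (fun j _ => hT j) (Finset.mem_univ j)
    linarith
  · exact abv_le_one_of_pow_eq_sum hv (hd j) h fun k _ => abv_aeval_le_one hv _ ha

theorem exists_numberField {ι : Type*} [Finite ι] (x : ι → Qbar) :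
    ∃ K : IntermediateField ℚ Qbar, NumberField K ∧ ∀ i, x i ∈ K :=
  ⟨IntermediateField.adjoin ℚ (Set.range x),
    { to_finiteDimensional := IntermediateField.finiteDimensional_adjoin
        fun y _ => (Algebra.IsAlgebraic.isAlgebraic y).isIntegral },
    fun i => IntermediateField.subset_adjoin ℚ _ ⟨i, rfl⟩⟩

section
variable {K : Type*} [Field K] [NumberField K] (σ : K →+* Qbar)
variable {ι ι' : Type*} [Finite ι] [Finite ι']

theorem ht_pow_finrank (y : ι → K) :
    ht (fun i => σ (y i)) ^ Module.finrank ℚ K = mulHeight y := by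
  rw [ht_eq σ, ← Real.rpow_natCast, ← Real.rpow_mul (mulHeight_pos _).le, one_div,
    inv_mul_cancel₀ (by exact_mod_cast Module.finrank_pos.ne'), Real.rpow_one]

end

section
variable {ι ι' : Type*} [Finite ι] [Finite ι']

theorem one_le_ht (x : ι → Qbar) : 1 ≤ ht x := by
  obtain ⟨K, hK, hx⟩ := exists_numberField x
  have := ht_eq K.val.toRingHom (fun i => (⟨x i, hx i⟩ : K))
  exact (Real.one_le_rpow (one_le_mulHeight _) (by positivity)).trans_eq this.symm

theorem ht_pos (x : ι → Qbar) : 0 < ht x := zero_lt_one.trans_le (one_le_ht x)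

/-- Inequalities between absolute heights can be checked over a number field. -/
theorem ht_le_mul_mul_prod {κ α β : Type*} [Finite κ] [Fintype α] [Finite β]
    (x : ι → Qbar) (z : κ → Qbar) (y : α → β → Qbar) {C : ℝ} (hC : 0 ≤ C)
    (h : ∀ (K : IntermediateField ℚ Qbar) [NumberField K] (x' : ι → K) (z' : κ → K)
      (y' : α → β → K), (∀ i, (x' i : Qbar) = x i) → (∀ i, (z' i : Qbar) = z i) →
      (∀ a i, (y' a i : Qbar) = y a i) →
      mulHeight x' ≤ C ^ totalWeight K * mulHeight z' * ∏ a, mulHeight (y' a)) :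
    ht x ≤ C * ht z * ∏ a, ht (y a) := by
  obtain ⟨K, hK, hx⟩ := exists_numberField (Sum.elim x (Sum.elim z (fun i : α × β => y i.1 i.2)))
  have h1 := h K (fun i => ⟨x i, hx (Sum.inl i)⟩) (fun i => ⟨z i, hx (Sum.inr (Sum.inl i))⟩)
    (fun a i => ⟨y a i, hx (Sum.inr (Sum.inr (a, i)))⟩)
    (fun _ => rfl) (fun _ => rfl) (fun _ _ => rfl)
  rw [totalWeight_eq_finrank] at h1
  have e1 := ht_pow_finrank K.val.toRingHom (fun i => (⟨x i, hx (Sum.inl i)⟩ : K))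
  have e2 := fun a => ht_pow_finrank K.val.toRingHom
    (fun i => (⟨y a i, hx (Sum.inr (Sum.inr (a, i)))⟩ : K))
  have e3 := ht_pow_finrank K.val.toRingHom (fun i => (⟨z i, hx (Sum.inr (Sum.inl i))⟩ : K))
  rw [← e1, ← e3] at h1
  simp_rw [← e2] at h1
  rw [Finset.prod_pow, ← mul_pow, ← mul_pow] at h1
  exact le_of_pow_le_pow_left₀ (Module.finrank_pos (R := ℚ) (M := K)).ne'
    (mul_nonneg (mul_nonneg hC (ht_pos z).le) (Finset.prod_nonneg fun a _ => (ht_pos (y a)).le)) h1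

theorem ht_eq_one_of_subsingleton [Subsingleton ι] (x : ι → Qbar) : ht x = 1 := by
  obtain ⟨K, hK, hx⟩ := exists_numberField x
  have e1 := ht_eq K.val.toRingHom (fun i => (⟨x i, hx i⟩ : K))
  rw [mulHeight_eq_one_of_subsingleton, Real.one_rpow] at e1
  exact e1

theorem ht_smul_le (x : ι → Qbar) {c : Qbar} (hc : c ≠ 0) : ht (fun i => c * x i) ≤ ht x := by
  obtain ⟨K, hK, hx⟩ := exists_numberField (fun i : Option ι => i.elim c x)
  have e1 := ht_eq K.val.toRingHom (fun i => (⟨c, hx none⟩ : K) * (⟨x i, hx (some i)⟩ : K))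
  have e2 := ht_eq K.val.toRingHom (fun i => (⟨x i, hx (some i)⟩ : K))
  have hc' : (⟨c, hx none⟩ : K) ≠ 0 := fun h => hc (congrArg Subtype.val h)
  have e3 := mulHeight_smul_eq_mulHeight (fun i => (⟨x i, hx (some i)⟩ : K)) hc'
  have e4 : mulHeight (fun i => (⟨c, hx none⟩ : K) * (⟨x i, hx (some i)⟩ : K)) =
    mulHeight (fun i => (⟨x i, hx (some i)⟩ : K)) := e3
  rw [e4, ← e2] at e1
  exact e1.le

theorem ht_smul (x : ι → Qbar) {c : Qbar} (hc : c ≠ 0) : ht (fun i => c * x i) = ht x := by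
  refine (ht_smul_le x hc).antisymm ?_
  have := ht_smul_le (fun i => c * x i) (inv_ne_zero hc)
  simpa [hc] using this

theorem ht_fun_pow (x : ι → Qbar) (n : ℕ) : ht (fun i => x i ^ n) = ht x ^ n := by
  obtain ⟨K, hK, hx⟩ := exists_numberField x
  have e1 := ht_eq K.val.toRingHom (fun i => (⟨x i, hx i⟩ : K) ^ n)
  have e2 := ht_eq K.val.toRingHom (fun i => (⟨x i, hx i⟩ : K))
  have e3 := mulHeight_pow (fun i => (⟨x i, hx i⟩ : K)) n
  change mulHeight (fun i => (⟨x i, hx i⟩ : K) ^ n) = _ at e3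
  have e4 : ht (fun i => x i ^ n) = _ := e1
  have e5 : ht x = _ := e2
  rw [e4, e5, e3, ← Real.rpow_natCast, ← Real.rpow_mul (mulHeight_pos _).le, ← Real.rpow_natCast,
    ← Real.rpow_mul (mulHeight_pos _).le, mul_comm]

theorem ht_linearMap_le [Fintype ι] [Nonempty ι] (A : ι' × ι → Qbar) :
    ∃ C : ℝ, 0 < C ∧ ∀ x : ι → Qbar, ht (fun j => ∑ i, A (j, i) * x i) ≤ C * ht x := by
  have hc : (0 : ℝ) < Nat.card ι := by exact_mod_cast Nat.card_pos
  refine ⟨Nat.card ι * ht A, mul_pos hc (ht_pos A), fun x => ?_⟩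
  have := ht_le_mul_mul_prod (α := Unit) (fun j => ∑ i, A (j, i) * x i) A (fun _ => x) hc.le
    fun K _ x' A' x'' hx hA hx' => by
      have : x' = fun j => ∑ i, A' (j, i) * x'' () i := by
        ext j
        simp [hx, hA, hx']
      rw [this, Fintype.prod_unique]
      exact mulHeight_linearMap_apply_le A' _
  simpa using this

/-- The height of the coefficients of `∏ (X - yᵢ)`. -/
theorem ht_coeff_prod_le (e : ℕ) :
    ∃ C : ℝ, 0 < C ∧ ∀ y : Fin e → Qbar,
      ht (fun k : Fin (e + 1) => (∏ i, (Polynomial.X - Polynomial.C (y i))).coeff k) ≤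
        C * ∏ i, ht ![1, y i] := by
  classical
  -- On expanding the product, each coefficient is a linear form, with coefficients `0` and `±1`, in
  -- the products `∏ ![1, yᵢ] (I i)`.
  obtain ⟨C, hC, h⟩ := ht_linearMap_le (ι := Fin e → Fin 2) (ι' := Fin (e + 1))
    (fun p => if (p.1 : ℕ) = ∑ i, (if p.2 i = 0 then 1 else 0) then
      ∏ i, (if p.2 i = 0 then 1 else -1) else 0)
  refine ⟨C, hC, fun y => ?_⟩
  have h1 := h (fun I => ∏ i, ![1, y i] (I i))
  -- These products are the Segre coordinates, whose height is the product of the heights.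
  have h2 : ht (fun I : Fin e → Fin 2 => ∏ i, ![1, y i] (I i)) ≤ ∏ i, ht ![1, y i] := by
    have := ht_le_mul_mul_prod (fun I : Fin e → Fin 2 => ∏ i, ![1, y i] (I i))
      (fun _ : Unit => 1) (fun i => ![1, y i]) zero_le_one fun K _ x' z' y' hx hz hy => by
        have h3 : x' = fun I : Fin e → Fin 2 => ∏ i, y' i (I i) := by
          ext I
          simp [hx, hy]
        have h4 : ∀ i, y' i ≠ 0 := by
          intro i h0
          have := hy i 0
          simp [h0] at this
        rw [h3, mulHeight_fun_prod_eq h4]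
        simp [mulHeight_eq_one_of_subsingleton]
    simpa [ht_eq_one_of_subsingleton] using this
  refine le_trans (le_of_eq ?_) (h1.trans (mul_le_mul_of_nonneg_left h2 hC.le))
  congr 1
  ext k
  have h5 : ∀ i, (Polynomial.X - Polynomial.C (y i)) =
      ∑ j : Fin 2, Polynomial.monomial (if j = 0 then 1 else 0)
        ((if j = 0 then 1 else -1) * ![1, y i] j) := by
    intro i
    simp [Polynomial.X, sub_eq_add_neg]
  simp_rw [h5]
  rw [Finset.prod_univ_sum, Polynomial.finsetSum_coeff]
  simp only [Fintype.piFinset_univ]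
  refine Finset.sum_congr rfl fun I _ => ?_
  have h6 : ∀ (s : Finset (Fin e)) (a : Fin e → ℕ) (b : Fin e → Qbar),
      ∏ i ∈ s, Polynomial.monomial (a i) (b i) =
        Polynomial.monomial (∑ i ∈ s, a i) (∏ i ∈ s, b i) := by
    intro s a b
    induction s using Finset.induction_on with
    | empty => simp
    | insert i s hi ih => rw [Finset.prod_insert hi, ih, Polynomial.monomial_mul_monomial,
        Finset.sum_insert hi, Finset.prod_insert hi]
  rw [h6, Polynomial.coeff_monomial, Finset.prod_mul_distrib]
  by_cases hk : (k : ℕ) = ∑ i, (if I i = 0 then 1 else 0)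
  · rw [if_pos hk, if_pos hk.symm]
  · rw [if_neg hk, if_neg (Ne.symm hk), zero_mul]

/-- The height of algebraic numbers `yⱼ` that are integral over `ℤ[a]` and such that the numbers
`yⱼ / a ^ N` are integral over `ℤ[a⁻¹]`. -/
theorem exists_ht_le_of_pow_eq_sum [Fintype ι] (d e : ι → ℕ) (hd : ∀ j, 0 < d j)
    (he : ∀ j, 0 < e j) (b c : ι → ℕ → Polynomial ℤ) (N : ℕ) :
    ∃ C : ℝ, 0 < C ∧ ∀ (a : Qbar) (y : ι → Qbar),
      (∀ j, y j ^ d j = ∑ k ∈ Finset.range (d j), Polynomial.aeval a (b j k) * y j ^ k) →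
      (a ≠ 0 → ∀ j, (y j * a⁻¹ ^ N) ^ e j =
        ∑ k ∈ Finset.range (e j), Polynomial.aeval a⁻¹ (c j k) * (y j * a⁻¹ ^ N) ^ k) →
      ht y ≤ C * ht ![1, a] ^ N := by
  obtain ⟨R, hR, hR'⟩ := exists_abv_le d hd b
  obtain ⟨S, hS, hS'⟩ := exists_abv_le e he c
  have hRS : 1 ≤ R * S := one_le_mul_of_one_le_of_one_le hR hS
  refine ⟨R * S, by linarith, fun a y hy hz => ?_⟩
  obtain ⟨K, hK, hx⟩ := exists_numberField (Sum.elim y ![1, a])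
  let a' : K := ⟨a, hx (Sum.inr 1)⟩
  let y' : ι → K := fun j => ⟨y j, hx (Sum.inl j)⟩
  have e1 := ht_pow_finrank K.val.toRingHom y'
  have e2 := ht_pow_finrank K.val.toRingHom ![1, a']
  have e3 : (fun i => K.val.toRingHom (![1, a'] i)) = ![1, a] := by
    ext i
    fin_cases i
    · exact map_one _
    · rfl
  have e4 : (fun i => K.val.toRingHom (y' i)) = y := rfl
  rw [e3] at e2
  rw [e4] at e1
  suffices h : mulHeight y' ≤ (R * S) ^ totalWeight K * mulHeight ![1, a'] ^ N by
    rw [totalWeight_eq_finrank, ← e1, ← e2, ← pow_mul, mul_comm _ N, pow_mul, ← mul_pow] at h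
    exact le_of_pow_le_pow_left₀ (Module.finrank_pos (R := ℚ) (M := K)).ne'
      (mul_nonneg (by linarith) (pow_nonneg (ht_pos _).le _)) h
  rcases isEmpty_or_nonempty ι with hι | hι
  · rw [mulHeight_eq_one_of_subsingleton]
    exact one_le_mul_of_one_le_of_one_le (one_le_pow₀ hRS) (one_le_pow₀ (one_le_mulHeight _))
  rw [← mulHeight_pow]
  have hval : ∀ (x : K) (p : Polynomial ℤ),
      ((Polynomial.aeval x p : K) : Qbar) = Polynomial.aeval (x : Qbar) p := fun x p =>
    (Polynomial.aeval_algHom_apply (K.val.restrictScalars ℤ) x p).symm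
  have hy' : ∀ j, y' j ^ d j =
      ∑ k ∈ Finset.range (d j), Polynomial.aeval a' (b j k) * y' j ^ k := by
    intro j
    apply Subtype.ext
    rw [AddSubmonoidClass.coe_finsetSum]
    simp only [IntermediateField.coe_mul, IntermediateField.coe_pow, hval]
    exact hy j
  have hz' : a' ≠ 0 → ∀ j, (y' j * a'⁻¹ ^ N) ^ e j =
      ∑ k ∈ Finset.range (e j), Polynomial.aeval a'⁻¹ (c j k) * (y' j * a'⁻¹ ^ N) ^ k := by
    intro ha j
    apply Subtype.ext
    rw [AddSubmonoidClass.coe_finsetSum]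
    simp only [IntermediateField.coe_mul, IntermediateField.coe_pow, hval, IntermediateField.coe_inv]
    exact hz (fun h => ha (Subtype.ext h)) j
  have key0 : ∀ v : AbsoluteValue K ℝ, 1 ≤ ⨆ i, v ((![1, a'] ^ N) i) := fun v =>
    Finite.le_ciSup_of_le 0 (by simp)
  have key1 : ∀ v : AbsoluteValue K ℝ, v a' ^ N ≤ ⨆ i, v ((![1, a'] ^ N) i) := fun v =>
    Finite.le_ciSup_of_le 1 (by simp)
  -- For `|a| ≤ 1` the first equation bounds `yⱼ`, for `|a| > 1` the second bounds `yⱼ / a ^ N`; in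
  -- both cases the bound is a multiple of `max 1 |a| ^ N`.
  have local_bound : ∀ (v : AbsoluteValue K ℝ) (j : ι),
      v (y' j) ≤ R * S * ⨆ i, v ((![1, a'] ^ N) i) ∧
        (IsNonarchimedean v → v (y' j) ≤ ⨆ i, v ((![1, a'] ^ N) i)) := by
    intro v j
    rcases le_or_gt (v a') 1 with h | h
    · obtain ⟨h1, h2⟩ := hR' K v a' j (y' j) h (hy' j)
      refine ⟨?_, fun hv => (h2 hv).trans (key0 v)⟩
      calc _ ≤ R * 1 * 1 := by linarith
        _ ≤ _ := mul_le_mul (mul_le_mul_of_nonneg_left hS (by linarith)) (key0 v) zero_le_one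
          (by linarith)
    · have ha0 : a' ≠ 0 := by
        rintro h0
        rw [h0, map_zero] at h
        linarith
      have hv0 : 0 < v a' ^ N := by positivity
      obtain ⟨h1, h2⟩ := hS' K v a'⁻¹ j _ (by rw [map_inv₀]; exact inv_le_one_of_one_le₀ h.le)
        (hz' ha0 j)
      rw [map_mul, map_pow, map_inv₀, inv_pow, ← div_eq_mul_inv, div_le_iff₀ hv0] at h1
      rw [map_mul, map_pow, map_inv₀, inv_pow, ← div_eq_mul_inv, div_le_iff₀ hv0, one_mul] at h2
      refine ⟨h1.trans ?_, fun hv => (h2 hv).trans (key1 v)⟩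
      exact mul_le_mul (le_mul_of_one_le_left (by linarith) hR) (key1 v) hv0.le (by linarith)
  refine mulHeight_le_of_forall_absVal ?_ hRS (fun v _ j => (local_bound v j).1)
    (fun v hv j => (local_bound v j).2 (AdmissibleAbsValues.isNonarchimedean v hv))
  intro h
  simpa using congrFun h 0

end

end
end StackyCurve

/-! ### Northcott's theorem and heights of integer vectors -/

namespace StackyCurve
noncomputable section

open NumberField Height

theorem norm_embedding_le_mulHeight₁ {K : Type*} [Field K] [NumberField K] (x : K)
    (φ : K →+* ℂ) : ‖φ x‖ ≤ mulHeight₁ x := by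
  classical
  rw [NumberField.mulHeight₁_eq, prod_infinitePlace_pow_mult (fun v => max (v x) 1)]
  have h1 : (1 : ℝ) ≤ ∏ᶠ v : FinitePlace K, max (v x) 1 :=
    one_le_finprod fun v => le_max_right _ _
  have h2 : max ‖φ x‖ 1 ≤ ∏ φ : K →+* ℂ, max (InfinitePlace.mk φ x) 1 := by
    rw [← Finset.prod_erase_mul _ _ (Finset.mem_univ φ), InfinitePlace.apply]
    exact le_mul_of_one_le_left (by positivity)
      (Finset.prod_induction _ (fun r : ℝ => 1 ≤ r)
        (fun _ _ => one_le_mul_of_one_le_of_one_le) le_rfl fun ψ _ => le_max_right _ _)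
  calc ‖φ x‖ ≤ max ‖φ x‖ 1 := le_max_left _ _
    _ ≤ _ := h2
    _ ≤ _ := le_mul_of_one_le_right (Finset.prod_nonneg fun _ _ => by positivity) h1

/-- There are only finitely many algebraic numbers of bounded height and degree. -/
theorem finite_setOf_ht_le (T : ℝ) (D : ℕ) :
    {x : Qbar | ht ![1, x] ≤ T ∧ (minpoly ℚ x).natDegree ≤ D}.Finite := by
  classical
  set B : ℝ := max T 1 ^ D with hB
  have hB1 : 1 ≤ B := one_le_pow₀ (le_max_right _ _)
  set C := Nat.ceil ((B * B) ^ D * (2 : ℝ) ^ D) with hC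
  have hfin := Polynomial.bUnion_roots_finite (algebraMap ℤ Qbar) D (Set.finite_Icc (-C : ℤ) C)
  have hfin2 := (Set.finite_Icc 1 (Nat.floor B)).biUnion fun n hn =>
    hfin.preimage (f := fun x : Qbar => (n : Qbar) * x) (by
      intro x _ y _ h
      have : (n : Qbar) ≠ 0 := by
        have := (Set.mem_Icc.1 hn).1
        exact_mod_cast (by omega : n ≠ 0)
      exact mul_left_cancel₀ this h)
  refine hfin2.subset ?_
  rintro x ⟨hx, hxD⟩
  have hxi : IsIntegral ℚ x := (Algebra.IsAlgebraic.isAlgebraic x).isIntegral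
  let K := IntermediateField.adjoin ℚ {x}
  have hK : NumberField K := { to_finiteDimensional := IntermediateField.adjoin.finiteDimensional hxi }
  have hdeg : Module.finrank ℚ K = (minpoly ℚ x).natDegree := IntermediateField.adjoin.finrank hxi
  have hdD : Module.finrank ℚ K ≤ D := hdeg.trans_le hxD
  let x' : K := IntermediateField.AdjoinSimple.gen ℚ x
  have e1 := ht_pow_finrank K.val.toRingHom ![1, x']
  have e2 : (fun i => K.val.toRingHom (![1, x'] i)) = ![1, x] := by
    ext i
    fin_cases i
    · exact map_one _
    · rfl
  rw [e2, mulHeight_swap, ← mulHeight₁_eq_mulHeight] at e1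
  have h1 : mulHeight₁ x' ≤ B := by
    rw [← e1, hB]
    exact (pow_le_pow_left₀ (ht_pos _).le (hx.trans (le_max_left _ _)) _).trans
      (pow_le_pow_right₀ (le_max_right _ _) hdD)
  -- A denominator `n ≤ B` makes `n * x'` integral with conjugates of size at most `B * B`, so its
  -- minimal polynomial has bounded integer coefficients.
  obtain ⟨n, hn0, hn, hint⟩ := NumberField.exists_nat_le_mulHeight₁ x'
  have hnB : (n : ℝ) ≤ B := hn.trans h1
  rw [Set.mem_iUnion₂]
  refine ⟨n, Set.mem_Icc.2 ⟨Nat.pos_of_ne_zero hn0, Nat.le_floor hnB⟩, ?_⟩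
  have hφ : ∀ φ : K →+* ℂ, ‖φ (n * x')‖ ≤ B * B := by
    intro φ
    rw [map_mul, norm_mul, map_natCast, Complex.norm_natCast]
    exact mul_le_mul hnB ((norm_embedding_le_mulHeight₁ x' φ).trans h1) (norm_nonneg _)
      (by linarith)
  obtain ⟨p, hp, h_map⟩ : ∃ p : Polynomial ℤ, p.Monic ∧
      minpoly ℚ ((n : K) * x') = p.map (algebraMap ℤ ℚ) :=
    ⟨_, minpoly.monic hint, minpoly.isIntegrallyClosed_eq_field_fractions' ℚ hint⟩
  have hBB : 1 ≤ B * B := one_le_mul_of_one_le_of_one_le hB1 hB1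
  rw [Set.mem_preimage, Set.mem_iUnion₂]
  have hne : p.map (algebraMap ℤ Qbar) ≠ 0 := (hp.map _).ne_zero
  have hroot : Polynomial.aeval ((n : Qbar) * x) p = 0 := by
    have h2 := Polynomial.aeval_algHom_apply K.val ((n : K) * x') (minpoly ℚ ((n : K) * x'))
    rw [minpoly.aeval, map_zero, h_map, Polynomial.aeval_map_algebraMap] at h2
    have h3 : K.val ((n : K) * x') = (n : Qbar) * x := by
      rw [map_mul, map_natCast]; rfl
    rwa [h3] at h2
  refine ⟨p, ⟨?_, fun i => ?_⟩, ?_⟩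
  · rw [← hp.natDegree_map (algebraMap ℤ ℚ), ← h_map]
    exact (minpoly.natDegree_le _).trans hdD
  · rw [Set.mem_Icc, ← abs_le, ← @Int.cast_le ℝ]
    have h4 := Embeddings.coeff_bdd_of_norm_le (x := (n : K) * x') hφ i
    rw [h_map, Polynomial.coeff_map, eq_intCast, Int.norm_cast_rat, Int.norm_eq_abs,
      max_eq_left hBB] at h4
    have h5 : (((Module.finrank ℚ K).choose (Module.finrank ℚ K / 2) : ℕ) : ℝ) ≤ 2 ^ D := by
      have : (Module.finrank ℚ K).choose (Module.finrank ℚ K / 2) ≤ 2 ^ D :=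
        (Nat.choose_le_two_pow _ _).trans (Nat.pow_le_pow_right (by norm_num) hdD)
      exact_mod_cast this
    have h6 : (B * B) ^ Module.finrank ℚ K ≤ (B * B) ^ D := pow_le_pow_right₀ hBB hdD
    push_cast
    calc _ ≤ _ := h4
      _ ≤ (B * B) ^ D * (2 : ℝ) ^ D := by gcongr
      _ ≤ _ := Nat.le_ceil _
  · simpa [Polynomial.mem_roots hne, Polynomial.eval_map_algebraMap] using hroot

/-- The height of a family of integers whose greatest common divisor divides `R`. -/
theorem le_ht_intCast {ι : Type*} [Finite ι] (x : ι → ℤ) (R : ℤ) (hR : R ≠ 0)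
    (hx : ∀ g : ℤ, (∀ i, g ∣ x i) → g ∣ R) (i : ι) :
    (|x i| : ℝ) ≤ |(R : ℝ)| * ht (fun i => (x i : Qbar)) := by
  classical
  have := Fintype.ofFinite ι
  have : Nonempty ι := ⟨i⟩
  obtain ⟨y, hy, hy1⟩ := Finset.extract_gcd x (s := Finset.univ) ⟨i, Finset.mem_univ i⟩
  set g := Finset.univ.gcd x with hg
  have hgR : g ∣ R := hx g fun j => Finset.gcd_dvd (Finset.mem_univ j)
  have hg0 : g ≠ 0 := by
    rintro h
    rw [h, zero_dvd_iff] at hgR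
    exact hR hgR
  have h1 := ht_pow_finrank (algebraMap ℚ Qbar) (((↑) : ℤ → ℚ) ∘ y)
  rw [Module.finrank_self, pow_one, Rat.mulHeight_eq_max_abs_of_gcd_eq_one hy1] at h1
  have h2 : ht (fun i => (x i : Qbar)) = ht (fun i => algebraMap ℚ Qbar ((((↑) : ℤ → ℚ) ∘ y) i)) := by
    refine Eq.trans ?_ (ht_smul _ (c := (g : Qbar)) (by exact_mod_cast hg0))
    congr 1
    ext j
    rw [hy j (Finset.mem_univ j)]
    simp
  rw [h2, h1, hy i (Finset.mem_univ i)]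
  have h3 : |g| ≤ |R| := Int.le_of_dvd (abs_pos.2 hR) (by simpa using hgR)
  have h4 : |y i| ≤ ⨆ i, |y i| := Finite.le_ciSup (fun i => |y i|) i
  have h5 := mul_le_mul h3 h4 (abs_nonneg _) (abs_nonneg _)
  rw [← abs_mul] at h5
  exact_mod_cast h5

theorem ht_one_intCast (t : ℤ) : ht ![1, (t : Qbar)] = max 1 |(t : ℝ)| := by
  have h1 := ht_pow_finrank (algebraMap ℚ Qbar) (((↑) : ℤ → ℚ) ∘ ![1, t])
  have hg : Finset.univ.gcd ![1, t] = 1 := by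
    have : Finset.univ.gcd ![1, t] ∣ 1 := Finset.gcd_dvd (f := ![1, t]) (Finset.mem_univ 0)
    exact (Finset.normalize_gcd (s := Finset.univ) (f := ![1, t])).symm.trans
      (normalize_eq_one.2 (isUnit_of_dvd_one this))
  rw [Module.finrank_self, pow_one, Rat.mulHeight_eq_max_abs_of_gcd_eq_one hg] at h1
  have h2 : (fun i => algebraMap ℚ Qbar ((((↑) : ℤ → ℚ) ∘ ![1, t]) i)) = ![1, (t : Qbar)] := by
    ext i
    fin_cases i <;> simp
  rw [h2] at h1
  have h3 : ⨆ i, |![1, t] i| = max 1 |t| := by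
    refine le_antisymm (ciSup_le fun i => ?_) (max_le ?_ ?_)
    · fin_cases i <;> simp
    · exact (Finite.le_ciSup (fun i => |![1, t] i|) 0).trans_eq' (by simp)
    · exact (Finite.le_ciSup (fun i => |![1, t] i|) 1).trans_eq' (by simp)
  rw [h1, h3]
  push_cast
  rfl

/-- A polynomial family without common zeros has large heights at integers. -/
theorem exists_le_ht_eval {ι : Type*} [Fintype ι] (g : ι → Polynomial ℤ)
    (hg : ∃ (u : ι → Polynomial ℤ) (R : ℤ), R ≠ 0 ∧ ∑ j, u j * g j = Polynomial.C R) (j : ι) :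
    ∃ c : ℝ, 0 < c ∧ ∀ᶠ t : ℕ in Filter.atTop,
      c * (t : ℝ) ^ (g j).natDegree ≤ ht (fun j => (((g j).eval (t : ℤ) : ℤ) : Qbar)) := by
  obtain ⟨u, R, hR, hu⟩ := hg
  by_cases hj : g j = 0
  · exact ⟨1, one_pos, Filter.Eventually.of_forall fun t => by simpa [hj] using one_le_ht _⟩
  have hR' : 0 < |(R : ℝ)| := by positivity
  refine ⟨1 / (2 * |(R : ℝ)|), by positivity, ?_⟩
  let P : Polynomial ℝ := (g j).map (Int.castRingHom ℝ)
  have hPd : P.natDegree = (g j).natDegree :=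
    Polynomial.natDegree_map_eq_of_injective Int.cast_injective _
  have hP0 : P ≠ 0 := (Polynomial.map_ne_zero_iff Int.cast_injective).2 hj
  have hPl : P.leadingCoeff = ((g j).leadingCoeff : ℝ) :=
    Polynomial.leadingCoeff_map_of_injective Int.cast_injective _
  have h1 := Polynomial.div_tendsto_atTop_leadingCoeff_div_of_degree_eq P
    (Polynomial.X ^ (g j).natDegree) (by
      rw [Polynomial.degree_X_pow, Polynomial.degree_eq_natDegree hP0, hPd])
  rw [Polynomial.leadingCoeff_X_pow, div_one, hPl] at h1
  -- A nonzero integer has absolute value at least `1`; the value `1 / 2` leaves room for passing to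
  -- the limit.
  have h2 : (1 : ℝ) / 2 < |((g j).leadingCoeff : ℝ)| := by
    have h3 : 1 ≤ |(g j).leadingCoeff| :=
      Int.one_le_abs (Polynomial.leadingCoeff_ne_zero.2 hj)
    have h4 : (1 : ℝ) ≤ |((g j).leadingCoeff : ℝ)| := by exact_mod_cast h3
    linarith
  have h3 := (h1.abs.comp tendsto_natCast_atTop_atTop).eventually_const_lt h2
  filter_upwards [h3, Filter.eventually_gt_atTop 0] with t ht1 ht2
  have ht0 : (0 : ℝ) < (t : ℝ) ^ (g j).natDegree := by positivity
  simp only [Function.comp, Polynomial.eval_pow, Polynomial.eval_X, abs_div, abs_of_pos ht0] at ht1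
  rw [lt_div_iff₀ ht0] at ht1
  have h4 : P.eval (t : ℝ) = (((g j).eval (t : ℤ) : ℤ) : ℝ) := by
    simp [P]
  rw [h4] at ht1
  -- Evaluated at `t`, the identity for `R` shows that every common divisor of the values divides
  -- `R`.
  have h5 := le_ht_intCast (fun j => (g j).eval (t : ℤ)) R hR (fun d hd => by
    have h6 := congrArg (Polynomial.eval (t : ℤ)) hu
    rw [Polynomial.eval_finsetSum, Polynomial.eval_C] at h6
    rw [← h6]
    exact Finset.dvd_sum fun i _ => by rw [Polynomial.eval_mul]; exact (hd i).mul_left _) j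
  rw [one_div, mul_inv, mul_comm (2 : ℝ)⁻¹, mul_assoc, inv_mul_le_iff₀ hR']
  calc _ = 1 / 2 * (t : ℝ) ^ (g j).natDegree := by norm_num
    _ ≤ _ := ht1.le.trans h5

end
end StackyCurve

/-! ### Integrality over `ℤ[φ]` and heights of values -/

namespace StackyCurve
noncomputable section

section
variable {F : Type*} [Field F]

/-- `f` is integral over `ℤ[x]`. -/
def IntegralOver (x f : F) : Prop :=
  ∃ (d : ℕ) (c : ℕ → Polynomial ℤ), 0 < d ∧
      f ^ d = ∑ k ∈ Finset.range d, Polynomial.aeval x (c k) * f ^ k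

theorem IntegralOver.natCast_mul {x f : F} (h : IntegralOver x f) (M : ℕ) :
    IntegralOver x (M * f) := by
  obtain ⟨d, c, hd, h⟩ := h
  refine ⟨d, fun k => (M : Polynomial ℤ) ^ (d - k) * c k, hd, ?_⟩
  rw [mul_pow, h, Finset.mul_sum]
  refine Finset.sum_congr rfl fun k hk => ?_
  have hk' := Finset.mem_range.1 hk
  have : (M : F) ^ d = (M : F) ^ (d - k) * (M : F) ^ k := by rw [← pow_add]; congr 1; omega
  rw [map_mul, map_pow, map_natCast, this]
  ring

/-- For a common denominator `M` of the coefficients, the monic equation of degree `d` multiplied by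
`M ^ d` is monic in `M * f`, and every lower coefficient acquires a factor `M`. -/
theorem exists_integralOver [Algebra ℚ F] {x f : F} (h : IsIntegral (Algebra.adjoin ℚ {x}) f) :
    ∃ M : ℕ, M ≠ 0 ∧ IntegralOver x (M * f) := by
  classical
  obtain ⟨p, hp, hp0⟩ := h
  have h1 : ∀ k, ∃ (q : Polynomial ℤ) (b : ℤ), b ≠ 0 ∧
      (b : F) * (p.coeff k : F) = Polynomial.aeval x q := by
    intro k
    obtain ⟨q, hq⟩ : ∃ q : Polynomial ℚ, Polynomial.aeval x q = (p.coeff k : F) := by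
      have hk : (p.coeff k : F) ∈ (Polynomial.aeval (R := ℚ) x).range :=
        (Algebra.adjoin_singleton_eq_range_aeval ℚ x).le (p.coeff k).2
      exact hk
    obtain ⟨b, hb0, hb⟩ := IsLocalization.integerNormalization_spec (nonZeroDivisors ℤ) q
    refine ⟨IsLocalization.integerNormalization (nonZeroDivisors ℤ) q, b,
      nonZeroDivisors.ne_zero hb0, ?_⟩
    have h2 := congrArg (Polynomial.aeval x) hb
    rw [Polynomial.aeval_map_algebraMap] at h2
    rw [← hq, h2]
    simp
  choose q b hb hq using h1
  have hd : 0 < p.natDegree := by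
    by_contra! h0
    rw [Polynomial.eq_one_of_monic_natDegree_zero hp (by omega)] at hp0
    simp at hp0
  refine ⟨∏ k ∈ Finset.range p.natDegree, (b k).natAbs,
    Finset.prod_ne_zero_iff.2 fun k _ => Int.natAbs_ne_zero.2 (hb k), ?_⟩
  have h2 : ∀ k ∈ Finset.range p.natDegree, ∃ e : ℤ,
      ((∏ k ∈ Finset.range p.natDegree, (b k).natAbs : ℕ) : ℤ) = e * b k := by
    intro k hk
    obtain ⟨e, he⟩ := (Int.dvd_natCast (m := b k)).2 (Finset.dvd_prod_of_mem (fun k => (b k).natAbs) hk)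
    exact ⟨e, by rw [he, mul_comm]⟩
  set M : ℕ := ∏ k ∈ Finset.range p.natDegree, (b k).natAbs with hM
  choose! e he using h2
  refine ⟨p.natDegree, fun k => - ((M : Polynomial ℤ) ^ (p.natDegree - k - 1) *
    ((e k : Polynomial ℤ) * q k)), hd, ?_⟩
  rw [Polynomial.eval₂_eq_sum_range, Finset.sum_range_succ, hp.coeff_natDegree, map_one,
    one_mul] at hp0
  rw [mul_pow, eq_neg_of_add_eq_zero_right hp0, ← Finset.sum_neg_distrib, Finset.mul_sum]
  refine Finset.sum_congr rfl fun k hk => ?_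
  have hk' := Finset.mem_range.1 hk
  have h3 : (M : F) ^ p.natDegree = (M : F) ^ (p.natDegree - k - 1) * M * (M : F) ^ k := by
    rw [← pow_succ, ← pow_add]; congr 1; omega
  have h4 : (M : F) = e k * b k := by exact_mod_cast congrArg (Int.cast : ℤ → F) (he k hk)
  have h5 : algebraMap (Algebra.adjoin ℚ {x}) F (p.coeff k) = (p.coeff k : F) := rfl
  rw [map_neg, map_mul, map_pow, map_natCast, map_mul, map_intCast, ← hq, h3, h5]
  have h6 : (M : F) * (p.coeff k : F) = e k * (b k * (p.coeff k : F)) := by rw [h4]; ring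
  linear_combination (-(M : F) ^ (p.natDegree - k - 1) * (M : F) ^ k * f ^ k) * h6

end

namespace Curve
variable {C : Curve}

theorem eval_aeval (P : C.GeomPoint) (r : C.X.presheaf.stalk P.pt) (p : Polynomial ℤ) :
    P.eval (Polynomial.aeval r p) = Polynomial.aeval (P.eval r) p :=
  (Polynomial.aeval_algHom_apply (P.eval.toIntAlgHom) r p).symm

theorem eval_pow_eq_sum {P : C.GeomPoint} {φ f : C.FunField} {r s : C.X.presheaf.stalk P.pt}
    (hr : algebraMap _ C.FunField r = φ) (hs : algebraMap _ C.FunField s = f)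
    {d : ℕ} {c : ℕ → Polynomial ℤ}
    (h : f ^ d = ∑ k ∈ Finset.range d, Polynomial.aeval φ (c k) * f ^ k) :
    P.eval s ^ d = ∑ k ∈ Finset.range d, Polynomial.aeval (P.eval r) (c k) * P.eval s ^ k := by
  subst hr hs
  have hinj : Function.Injective (algebraMap (C.X.presheaf.stalk P.pt) C.FunField) :=
    IsFractionRing.injective _ _
  have h1 : s ^ d = ∑ k ∈ Finset.range d, Polynomial.aeval r (c k) * s ^ k := by
    apply hinj
    rw [map_pow, h, map_sum]
    refine Finset.sum_congr rfl fun k _ => ?_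
    rw [map_mul, map_pow, Polynomial.aeval_algebraMap_apply]
  rw [← map_pow, h1, map_sum]
  refine Finset.sum_congr rfl fun k _ => ?_
  rw [map_mul, map_pow, eval_aeval]

/-- Functions whose poles are bounded by `N` times the poles of `φ` have heights bounded by the
`N`-th power of the height of `φ`. -/
theorem exists_ht_eval_le {ι : Type*} [Fintype ι] {φ : C.FunField} (hφ : φ ≠ 0)
    (f : ι → C.FunField) (N : ℕ)
    (h : ∀ j z, N * min (Scheme.ord φ z) 0 ≤ Scheme.ord (f j) z) :
    ∃ K : ℝ, 0 < K ∧ ∀ (P : C.GeomPoint) (r : C.X.presheaf.stalk P.pt)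
      (s : ι → C.X.presheaf.stalk P.pt), algebraMap _ C.FunField r = φ →
      (∀ j, algebraMap _ C.FunField (s j) = f j) →
      ht (fun j => P.eval (s j)) ≤ K * ht ![1, P.eval r] ^ N := by
  classical
  -- The pole bound says that `f j` is integral over `ℚ[φ]` and `f j * φ⁻¹ ^ N` over `ℚ[φ⁻¹]`.
  have h1 : ∀ j, ∃ M : ℕ, M ≠ 0 ∧ IntegralOver φ (M * f j) ∧
      IntegralOver φ⁻¹ (M * (f j * φ⁻¹ ^ N)) := by
    intro j
    obtain ⟨M, hM, h2⟩ := exists_integralOver (isIntegral_adjoin_iff.2 fun z hz => by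
      have := h j z
      rw [min_eq_right hz] at this
      simpa using this : IsIntegral (Algebra.adjoin ℚ {φ}) (f j))
    obtain ⟨M', hM', h3⟩ := exists_integralOver (isIntegral_adjoin_iff.2 fun z hz => by
      by_cases hf : f j = 0
      · simp [hf]
      have := h j z
      rw [ord_inv] at hz
      rw [min_eq_left (by omega)] at this
      rw [Scheme.ord_mul hf (pow_ne_zero _ (inv_ne_zero hφ)), ord_pow, ord_inv]
      linarith : IsIntegral (Algebra.adjoin ℚ {φ⁻¹}) (f j * φ⁻¹ ^ N))
    refine ⟨M' * M, mul_ne_zero hM' hM, ?_, ?_⟩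
    · have := h2.natCast_mul M'
      rwa [← mul_assoc, ← Nat.cast_mul] at this
    · have := h3.natCast_mul M
      rwa [← mul_assoc, ← Nat.cast_mul, mul_comm M] at this
  choose M hM h2 h3 using h1
  choose d b hd hb using h2
  choose e c he hc using h3
  obtain ⟨K, hK, hK'⟩ := exists_ht_le_of_pow_eq_sum d e hd he b c N
  rcases isEmpty_or_nonempty ι with hι | hι
  · refine ⟨1, one_pos, fun P r s _ _ => ?_⟩
    rw [ht_eq_one_of_subsingleton, one_mul]
    exact one_le_pow₀ (one_le_ht _)
  -- A diagonal linear map removes the factors `M j` again.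
  obtain ⟨L, hL, hL'⟩ := ht_linearMap_le (ι := ι) (ι' := ι)
    (fun p => if p.1 = p.2 then (M p.1 : Qbar)⁻¹ else 0)
  refine ⟨L * K, mul_pos hL hK, fun P r s hr hs => ?_⟩
  have hMs : ∀ j, algebraMap _ C.FunField (M j * s j : C.X.presheaf.stalk P.pt) = M j * f j := by
    intro j
    rw [map_mul, map_natCast, hs]
  have h4 := hK' (P.eval r) (fun j => M j * P.eval (s j)) (fun j => by
      have := eval_pow_eq_sum hr (hMs j) (hb j)
      simpa using this) (fun hr0 j => by
      have hu : IsUnit r := isUnit_of_map_unit P.eval r (isUnit_iff_ne_zero.2 hr0)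
      obtain ⟨r', hr'⟩ := hu.exists_right_inv
      have h5 : algebraMap _ C.FunField r' = φ⁻¹ := by
        refine eq_inv_of_mul_eq_one_left ?_
        rw [← hr, ← map_mul, mul_comm, hr', map_one]
      have h6 : P.eval r' = (P.eval r)⁻¹ := by
        refine eq_inv_of_mul_eq_one_left ?_
        rw [← map_mul, mul_comm, hr', map_one]
      have := eval_pow_eq_sum h5 (s := (M j : C.X.presheaf.stalk P.pt) * (s j * r' ^ N)) (by
        rw [map_mul, map_natCast, map_mul, map_pow, hs, h5]) (hc j)
      rw [map_mul, map_natCast, map_mul, map_pow, h6, ← mul_assoc] at this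
      exact this)
  have h5 := hL' (fun j => M j * P.eval (s j))
  have h6 : (fun j => ∑ i, (if j = i then (M j : Qbar)⁻¹ else 0) * (M i * P.eval (s i))) =
      fun j => P.eval (s j) := by
    ext j
    have : (M j : Qbar) ≠ 0 := by exact_mod_cast hM j
    simp [this]
  simp only at h5
  rw [h6] at h5
  refine h5.trans ?_
  rw [mul_assoc]
  exact mul_le_mul_of_nonneg_left h4 hL.le

end Curve
end
end StackyCurve

/-! ### Heights of morphisms and heights of functions -/

namespace StackyCurve
noncomputable section
namespace Curve
variable {C : Curve}

theorem finite_setOf_pt_mem {S : Set C.X} (hS : S.Finite) :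
    {P : C.GeomPoint | P.pt ∈ S}.Finite := by
  have : {P : C.GeomPoint | P.pt ∈ S} ⊆
      ⋃ z ∈ S \ {genericPoint C.X}, {P : C.GeomPoint | P.pt = z} := by
    intro P hP
    simp only [Set.mem_iUnion]
    exact ⟨P.pt, ⟨hP, P.pt_ne_genericPoint⟩, rfl⟩
  exact (hS.sdiff.biUnion fun z hz => GeomPoint.finite_of_pt_eq hz.2).subset this

theorem eventually_exists_isUnit {f : C.FunField} (hf : f ≠ 0) :
    ∀ᶠ P : C.GeomPoint in Filter.cofinite, ∃ r : C.X.presheaf.stalk P.pt,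
      IsUnit r ∧ algebraMap _ C.FunField r = f := by
  refine (finite_setOf_pt_mem (finite_setOf_ord_ne_zero f)).subset fun P hP => ?_
  by_contra h
  apply hP
  have h0 : Scheme.ord f P.pt = 0 := not_not.1 h
  obtain ⟨r, hr⟩ := (ord_nonneg_iff P.pt_ne_genericPoint).1 h0.ge
  refine ⟨r, ?_, hr⟩
  rw [← hr] at h0
  refine (ord_algebraMap_eq_zero_iff P.pt_ne_genericPoint ?_).1 h0
  rintro rfl
  exact hf (by rw [← hr, map_zero])

theorem eventually_exists (f : C.FunField) :
    ∀ᶠ P : C.GeomPoint in Filter.cofinite, ∃ r : C.X.presheaf.stalk P.pt,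
      algebraMap _ C.FunField r = f := by
  by_cases hf : f = 0
  · exact Filter.Eventually.of_forall fun P => ⟨0, by rw [hf, map_zero]⟩
  · exact (eventually_exists_isUnit hf).mono fun P ⟨r, _, hr⟩ => ⟨r, hr⟩

theorem stalk_injective (z : C.X) :
    Function.Injective (algebraMap (C.X.presheaf.stalk z) C.FunField) := IsFractionRing.injective _ _

theorem eval_smul (P : C.GeomPoint) (q : ℚ) (r : C.X.presheaf.stalk P.pt) :
    P.eval (q • r) = algebraMap ℚ Qbar q * P.eval r := by
  rw [Algebra.smul_def, map_mul]
  congr 1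
  exact RingHom.congr_fun (RingHom.ext_rat (P.eval.comp (algebraMap ℚ _)) (algebraMap ℚ Qbar)) q

/-- Heights of morphisms to projective spaces are equivalent to heights of rational functions. -/
theorem exists_equiv_ht {n : ℕ} {s : Fin (n + 1) → C.FunField} {A : C.X →₀ ℤ}
    {h : C.GeomPoint → ℝ} (hs : Generates s A) (hh : IsMapHeight s h) :
    ∃ φ : C.FunField, φ ≠ 0 ∧ C.degDiv A = funDeg φ ∧ ∃ K : ℝ, 0 < K ∧
      ∀ᶠ P : C.GeomPoint in Filter.cofinite, ∃ r : C.X.presheaf.stalk P.pt,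
        algebraMap _ C.FunField r = φ ∧ h P ≤ K * ht ![1, P.eval r] ∧
          ht ![1, P.eval r] ≤ K * h P := by
  obtain ⟨c, d, hc, hd, hcd⟩ := exists_pencil hs
  set L₁ := ∑ i, c i • s i with hL₁
  set L₂ := ∑ i, d i • s i with hL₂
  have hφ : L₁ / L₂ ≠ 0 := div_ne_zero hc hd
  have hord : ∀ f : C.FunField, f ≠ 0 → ∀ z,
      Scheme.ord (f / L₂) z = Scheme.ord f z - Scheme.ord L₂ z := fun f hf z => by
    rw [div_eq_mul_inv, Scheme.ord_mul hf (inv_ne_zero hd), ord_inv, sub_eq_add_neg]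
  have hle : ∀ i z, (1 : ℕ) * min (Scheme.ord (L₁ / L₂) z) 0 ≤ Scheme.ord (s i / L₂) z := by
    intro i z
    by_cases hi : s i = 0
    · simp [hi]
    rw [hord _ hi, hord _ hc]
    have h1 := le_ord_of_generates hs (Pi.single i 1) z (by simpa [Pi.single_apply] using hi)
    have h2 := hcd z
    simp only [Pi.single_apply, ite_smul, one_smul, zero_smul, Finset.sum_ite_eq',
      Finset.mem_univ, if_true] at h1
    push_cast
    omega
  -- The functions `s i / L₂` have at most the poles of `L₁ / L₂`, which gives one inequality.
  -- Conversely `L₁` and `L₂` are linear combinations of the `s i`.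
  obtain ⟨K₁, hK₁, h1⟩ := exists_ht_eval_le hφ (fun i => s i / L₂) 1 hle
  obtain ⟨K₂, hK₂, h2⟩ := ht_linearMap_le (ι' := Fin 2)
    (fun p : Fin 2 × Fin (n + 1) => algebraMap ℚ Qbar (![d, c] p.1 p.2))
  refine ⟨L₁ / L₂, hφ, degDiv_eq_funDeg hc hd hcd, max K₁ K₂, lt_max_of_lt_left hK₁, ?_⟩
  obtain ⟨i₀, hi₀⟩ : ∃ i, s i ≠ 0 := by
    by_contra! h0
    exact hc (Finset.sum_eq_zero fun i _ => by rw [h0, Algebra.smul_def, mul_zero])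
  have e1 : ∀ᶠ P : C.GeomPoint in Filter.cofinite, ∀ i, ∃ r : C.X.presheaf.stalk P.pt,
      algebraMap _ C.FunField r = s i / L₂ :=
    Filter.eventually_all.2 fun i => eventually_exists _
  filter_upwards [e1, eventually_exists (L₁ / L₂),
    eventually_exists_isUnit (div_ne_zero hi₀ hd)] with P he ⟨r, hr⟩ ⟨w, hw, hw'⟩
  choose t ht using he
  have hloc : LocalCoords s P.pt L₂ t := by
    refine ⟨hd, fun i => by rw [ht, mul_div_cancel₀ _ hd], i₀, ?_⟩
    rwa [stalk_injective _ ((ht i₀).trans hw'.symm)]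
  have hP := hh P L₂ t hloc
  rw [absHeight_eq_ht] at hP
  refine ⟨r, hr, ?_, ?_⟩
  · rw [hP]
    refine (h1 P r t hr ht).trans ?_
    rw [pow_one]
    exact mul_le_mul_of_nonneg_right (le_max_left _ _) (ht_pos _).le
  · have h3 := h2 (fun i => P.eval (t i))
    have h4 : (fun j => ∑ i, algebraMap ℚ Qbar (![d, c] j i) * P.eval (t i)) = ![1, P.eval r] := by
      have h5 : ∀ (b : Fin (n + 1) → ℚ) (x : C.X.presheaf.stalk P.pt),
          algebraMap _ C.FunField x = (∑ i, b i • s i) / L₂ →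
          ∑ i, algebraMap ℚ Qbar (b i) * P.eval (t i) = P.eval x := by
        intro b x hx
        have : x = ∑ i, b i • t i := by
          apply stalk_injective
          rw [hx, map_sum, Finset.sum_div]
          refine Finset.sum_congr rfl fun i _ => ?_
          rw [Algebra.smul_def, Algebra.smul_def, map_mul, ht, mul_div_assoc,
            ← IsScalarTower.algebraMap_apply]
        rw [this, map_sum]
        exact Finset.sum_congr rfl fun i _ => (eval_smul P _ _).symm
      ext j
      fin_cases j
      · exact (h5 d 1 (by rw [map_one, ← hL₂, div_self hd])).trans (map_one _)
      · exact h5 c r hr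
    simp only at h3
    rw [h4] at h3
    rw [hP]
    exact h3.trans (mul_le_mul_of_nonneg_right (le_max_right _ _) (ht_pos _).le)

/-- With `g` from `exists_section`, both `g` and `g * ψ ^ N'` have poles bounded by `N` times those
of `φ`, while `(g : g * ψ ^ N')` is the point `(1 : ψ ^ N')`. -/
theorem exists_ht_pow_le {φ ψ : C.FunField} (hψ : ψ ≠ 0) (h : funDeg ψ < funDeg φ) :
    ∃ (N N' : ℕ) (K : ℝ), N < N' ∧ 0 < K ∧ ∀ᶠ P : C.GeomPoint in Filter.cofinite,
      ∀ r s : C.X.presheaf.stalk P.pt, algebraMap _ C.FunField r = φ →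
        algebraMap _ C.FunField s = ψ → ht ![1, P.eval s] ^ N' ≤ K * ht ![1, P.eval r] ^ N := by
  obtain ⟨N, N', g, hN, hg, hord⟩ := exists_section h
  have hφ : φ ≠ 0 := by
    rintro rfl
    exact transcendental_of_funDeg_pos (by omega : 0 < funDeg (0 : C.FunField)) isAlgebraic_zero
  obtain ⟨K, hK, hK'⟩ := exists_ht_eval_le hφ ![g, g * ψ ^ N'] N (by
    intro j z
    have h1 := hord z
    have h2 : (N' : ℤ) * (- Scheme.ord ψ z) ≤ N' * max (- Scheme.ord ψ z) 0 :=
      mul_le_mul_of_nonneg_left (le_max_left _ _) (by positivity)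
    have h3 : 0 ≤ (N' : ℤ) * max (- Scheme.ord ψ z) 0 := by positivity
    fin_cases j
    · change _ ≤ Scheme.ord g z
      linarith
    · change _ ≤ Scheme.ord (g * ψ ^ N') z
      rw [Scheme.ord_mul hg (pow_ne_zero _ hψ), ord_pow]
      linarith)
  refine ⟨N, N', K, hN, hK, ?_⟩
  filter_upwards [eventually_exists_isUnit hg] with P ⟨w, hw, hw'⟩ r s hr hs
  have h1 := hK' P r ![w, w * s ^ N'] hr (by
    intro j
    fin_cases j
    · exact hw'
    · change algebraMap _ _ (w * s ^ N') = g * ψ ^ N'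
      rw [map_mul, map_pow, hw', hs])
  refine le_trans (le_of_eq ?_) h1
  rw [← ht_fun_pow, ← ht_smul _ (hw.map P.eval).ne_zero]
  congr 1
  ext j
  fin_cases j <;> simp

theorem degree_le_deg (P : C.GeomPoint) (r : C.X.presheaf.stalk P.pt) :
    (minpoly ℚ (P.eval r)).natDegree ≤ P.deg := by
  have := (C.isDiscreteValuationRing_stalk P.pt_ne_genericPoint).2
  rw [GeomPoint.deg, degPt_eq]
  let σ : IsLocalRing.ResidueField (C.X.presheaf.stalk P.pt) →ₐ[ℚ] Qbar :=
    (IsLocalRing.ResidueField.lift P.eval).toRatAlgHom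
  have h1 : P.eval r = σ (IsLocalRing.residue _ r) := rfl
  rw [h1, minpoly.algHom_eq σ σ.toRingHom.injective]
  exact minpoly.natDegree_le _

/-- Only finitely many values occur, by Northcott's theorem, and a point with value `a` is a zero of
the nonzero function `minpoly(a)(φ)`. -/
theorem finite_setOf_ht_eval_le {φ : C.FunField} (hφ : Transcendental ℚ φ) (T : ℝ) (D : ℕ) :
    {P : C.GeomPoint | P.deg ≤ D ∧ ∃ r : C.X.presheaf.stalk P.pt,
      algebraMap _ C.FunField r = φ ∧ ht ![1, P.eval r] ≤ T}.Finite := by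
  refine ((finite_setOf_ht_le T D).biUnion fun a _ => finite_setOf_pt_mem
    (finite_setOf_ord_ne_zero (Polynomial.aeval φ (minpoly ℚ a)))).subset ?_
  rintro P ⟨hD, r, hr, hT⟩
  rw [Set.mem_iUnion₂]
  refine ⟨P.eval r, ⟨hT, (degree_le_deg P r).trans hD⟩, ?_⟩
  have h0 : Polynomial.aeval φ (minpoly ℚ (P.eval r)) ≠ 0 := by
    intro h
    exact minpoly.ne_zero (Algebra.IsIntegral.isIntegral (R := ℚ) (P.eval r))
      (transcendental_iff.1 hφ _ h)
  intro h
  rw [← hr, Polynomial.aeval_algebraMap_apply] at h h0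
  have hu := (ord_algebraMap_eq_zero_iff P.pt_ne_genericPoint
    (fun h1 => h0 (by rw [h1, map_zero]))).1 h
  have h2 := (hu.map P.eval).ne_zero
  apply h2
  have := (Polynomial.aeval_algHom_apply P.eval.toRatAlgHom r (minpoly ℚ (P.eval r))).symm
  exact this.trans (minpoly.aeval _ _)

end Curve
end
end StackyCurve

/-! ### Divisors of positive degree; extension of homomorphisms to algebraic points -/

namespace StackyCurve
noncomputable section
namespace Curve
variable {C : Curve}

/-- The part of the assertion for positive degree. -/
theorem strongNorthcott_of_funDeg_lt {H hA hB : C.GeomPoint → ℝ} {φ ψ : C.FunField} (hψ : ψ ≠ 0)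
    (h : funDeg ψ < funDeg φ) {c K L : ℝ} (hc : 0 < c) (hK : 0 < K) (hL : 0 < L)
    (hH : ∀ P, c⁻¹ * (hA P / hB P) ≤ H P)
    (hφ : ∀ᶠ P : C.GeomPoint in Filter.cofinite, ∃ r : C.X.presheaf.stalk P.pt,
        algebraMap _ C.FunField r = φ ∧ hA P ≤ K * ht ![1, P.eval r] ∧
          ht ![1, P.eval r] ≤ K * hA P)
    (hψ' : ∀ᶠ P : C.GeomPoint in Filter.cofinite, ∃ r : C.X.presheaf.stalk P.pt,
        algebraMap _ C.FunField r = ψ ∧ hB P ≤ L * ht ![1, P.eval r] ∧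
          ht ![1, P.eval r] ≤ L * hB P) :
    StrongNorthcott GeomPoint.deg H := by
  intro T D hT _
  obtain ⟨N, N', M, hN, hM, hev⟩ := exists_ht_pow_le hψ h
  have h1 : ∀ᶠ P : C.GeomPoint in Filter.cofinite, H P ≤ T → ∃ r : C.X.presheaf.stalk P.pt,
      algebraMap _ C.FunField r = φ ∧ ht ![1, P.eval r] ≤ (K * L * c * T) ^ N' * M := by
    filter_upwards [hφ, hψ', hev] with P ⟨r, hr, h1, h2⟩ ⟨s, hs, h3, h4⟩ h5 hPT
    refine ⟨r, hr, ?_⟩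
    have h6 := h5 r s hr hs
    have hx := one_le_ht ![1, P.eval r]
    have hy := ht_pos ![1, P.eval s]
    set x := ht ![1, P.eval r]
    set y := ht ![1, P.eval s]
    have hBP : 0 < hB P := by
      by_contra! h0
      nlinarith
    have h7 := (hH P).trans hPT
    rw [inv_mul_le_iff₀ hc, div_le_iff₀ hBP] at h7
    have h8 : x ≤ K * L * c * T * y := by
      calc x ≤ K * hA P := h2
        _ ≤ K * (c * T * hB P) := by gcongr
        _ ≤ K * (c * T * (L * y)) := by gcongr
        _ = _ := by ring
    have hx0 : 0 < x := by linarith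
    -- Because `N + 1 ≤ N'`, the factor `x ^ N` cancels and `x` itself is bounded.
    have h9 : x * x ^ N ≤ (K * L * c * T) ^ N' * M * x ^ N := by
      calc x * x ^ N = x ^ (N + 1) := by ring
        _ ≤ x ^ N' := pow_le_pow_right₀ hx hN
        _ ≤ (K * L * c * T * y) ^ N' := by gcongr
        _ = (K * L * c * T) ^ N' * y ^ N' := by rw [mul_pow]
        _ ≤ (K * L * c * T) ^ N' * (M * x ^ N) := by gcongr
        _ = _ := by ring
    exact le_of_mul_le_mul_right h9 (by positivity)
  have h2 := finite_setOf_ht_eval_le (transcendental_of_funDeg_pos (by omega : 0 < funDeg φ))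
    ((K * L * c * T) ^ N' * M) D
  refine (h2.union h1).subset ?_
  rintro P ⟨hPT, hPD⟩
  by_cases hP : H P ≤ T → ∃ r : C.X.presheaf.stalk P.pt,
      algebraMap _ C.FunField r = φ ∧ ht ![1, P.eval r] ≤ (K * L * c * T) ^ N' * M
  · exact Or.inl ⟨hPD, hP hPT⟩
  · exact Or.inr hP

open IsLocalRing in
/-- A homomorphism from a subring of the function field to `Qbar` is the evaluation at some
algebraic point. -/
theorem exists_geomPoint_of_subring (R : Subring C.FunField) (hR : ∀ q, algebraMap ℚ C.FunField q ∈ R)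
    (θ : R →+* Qbar) (hθ : ∃ x, x ≠ 0 ∧ θ x = 0) :
    ∃ P : C.GeomPoint, ∀ x : R, P.HasVal x (θ x) := by
  have hne : RingHom.ker θ ≠ ⊤ := RingHom.ker_ne_top θ
  -- A valuation ring containing `R`, with the kernel of `θ` among its nonunits, is nontrivial
  -- because `θ` is not injective; so it is the local ring of a point `z`.
  obtain ⟨V, hV, hV'⟩ := Ideal.image_subset_nonunits_valuationSubring (RingHom.ker θ) hne
  have hVtop : V ≠ ⊤ := by
    rintro rfl
    obtain ⟨x, hx0, hx⟩ := hθ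
    have := hV' ⟨x, hx, rfl⟩
    rw [SetLike.mem_coe, ValuationSubring.mem_nonunits_iff_exists_mem_maximalIdeal] at this
    obtain ⟨h1, h2⟩ := this
    rw [mem_maximalIdeal, mem_nonunits_iff] at h2
    apply h2
    refine isUnit_iff_exists_inv.2 ⟨⟨(x : C.FunField)⁻¹, trivial⟩, Subtype.ext ?_⟩
    exact mul_inv_cancel₀ (fun h => hx0 (Subtype.ext h))
  obtain ⟨z, hz, hrange⟩ := exists_range_eq_valuationSubring V (fun q => hV (hR q)) hVtop
  obtain ⟨g, hg⟩ := exists_lift_stalk R.subtype z (fun x => by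
    have : (x : C.FunField) ∈ V.toSubring := hV x.2
    rw [← hrange] at this
    exact this)
  have := (C.isDiscreteValuationRing_stalk hz).2
  let ρ : R →+* ResidueField (C.X.presheaf.stalk z) := (residue _).comp g
  have hker : ∀ x ∈ RingHom.ker θ, ρ x = 0 := by
    intro x hx
    change residue _ (g x) = 0
    rw [residue_eq_zero_iff, mem_maximalIdeal, mem_nonunits_iff]
    intro hu
    obtain ⟨w, hw⟩ := hu.exists_right_inv
    have h1 := hV' ⟨x, hx, rfl⟩
    rw [SetLike.mem_coe, ValuationSubring.mem_nonunits_iff_exists_mem_maximalIdeal] at h1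
    obtain ⟨h2, h3⟩ := h1
    rw [mem_maximalIdeal, mem_nonunits_iff] at h3
    apply h3
    have h4 : algebraMap _ C.FunField w ∈ V := by
      change _ ∈ V.toSubring
      rw [← hrange]
      exact ⟨w, rfl⟩
    refine isUnit_iff_exists_inv.2 ⟨⟨_, h4⟩, Subtype.ext ?_⟩
    change (x : C.FunField) * algebraMap _ C.FunField w = 1
    have h5 : algebraMap _ C.FunField (g x) = x := hg x
    rw [← h5, ← map_mul, hw, map_one]
  let j : ℚ →+* R := (algebraMap ℚ C.FunField).codRestrict R hR
  let : Algebra ℚ (R ⧸ RingHom.ker θ) := ((Ideal.Quotient.mk _).comp j).toAlgebra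
  -- The image of `θ` is algebraic over `ℚ`, hence a field. It also embeds into the residue field at
  -- `z`, and since `Qbar` is algebraically closed its embedding into `Qbar` extends to that residue
  -- field.
  have hfield : IsField (R ⧸ RingHom.ker θ) := by
    let θ' : R ⧸ RingHom.ker θ →ₐ[ℚ] Qbar := (RingHom.kerLift θ).toRatAlgHom
    have hinj : Function.Injective θ' := RingHom.kerLift_injective θ
    have : IsDomain (R ⧸ RingHom.ker θ) := hinj.isDomain θ'.toRingHom
    have : Algebra.IsIntegral ℚ (R ⧸ RingHom.ker θ) := Algebra.IsIntegral.of_injective θ' hinj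
    exact isField_of_isIntegral_of_isField' (Field.toIsField ℚ)
  let := hfield.toField
  let a₁ : Algebra (R ⧸ RingHom.ker θ) (ResidueField (C.X.presheaf.stalk z)) :=
    (Ideal.Quotient.lift _ ρ hker).toAlgebra
  let a₂ : Algebra (R ⧸ RingHom.ker θ) Qbar := (RingHom.kerLift θ).toAlgebra
  have := IsScalarTower.of_algebraMap_eq' (R := ℚ) (S := R ⧸ RingHom.ker θ)
    (A := ResidueField (C.X.presheaf.stalk z)) (RingHom.ext_rat _ _)
  have : Algebra.IsAlgebraic (R ⧸ RingHom.ker θ) (ResidueField (C.X.presheaf.stalk z)) :=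
    Algebra.IsAlgebraic.tower_top (K := ℚ) _
  let σ : ResidueField (C.X.presheaf.stalk z) →ₐ[R ⧸ RingHom.ker θ] Qbar := IsAlgClosed.lift
  obtain ⟨P, hP, hP'⟩ := C.exists_geomPoint z (σ.toRingHom.comp (residue _))
    (RingHom.isLocalHom_comp σ.toRingHom (residue _))
  refine ⟨P, fun x => ?_⟩
  have h6 := hP' (g x)
  have h7 : algebraMap _ C.FunField (g x) = x := hg x
  rw [h7] at h6
  have h8 : σ (ρ x) = θ x := σ.commutes (Ideal.Quotient.mk _ x)
  rwa [← h8]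

end Curve
end
end StackyCurve

/-! ### Algebraic relations between two functions -/

namespace StackyCurve
noncomputable section

open Polynomial IntermediateField IntermediateField.algebraAdjoinAdjoin

theorem exists_eq_mul_and_sum_eq_one {R ι : Type*} [CommRing R] [IsDomain R] [IsPrincipalIdealRing R]
    [Fintype ι] (q : ι → R) (hq : ∃ i, q i ≠ 0) :
    ∃ (h : R) (g u : ι → R), h ≠ 0 ∧ (∀ i, q i = h * g i) ∧ ∑ i, u i * g i = 1 := by
  obtain ⟨h, hh⟩ := (IsPrincipalIdealRing.principal (Ideal.span (Set.range q))).principal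
  have h0 : h ≠ 0 := by
    rintro rfl
    obtain ⟨i, hi⟩ := hq
    have : q i ∈ Ideal.span (Set.range q) := Ideal.subset_span ⟨i, rfl⟩
    rw [hh, Submodule.span_zero_singleton, Submodule.mem_bot] at this
    exact hi this
  have h1 : ∀ i, ∃ g, q i = h * g := fun i => by
    have : q i ∈ Ideal.span (Set.range q) := Ideal.subset_span ⟨i, rfl⟩
    rw [hh] at this
    obtain ⟨g, hg⟩ := Ideal.mem_span_singleton'.1 this
    exact ⟨g, by rw [← hg, mul_comm]⟩
  choose g hg using h1
  have h2 : h ∈ Ideal.span (Set.range q) := by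
    rw [hh]; exact Ideal.mem_span_singleton_self h
  obtain ⟨u, hu⟩ := (Submodule.mem_span_range_iff_exists_fun R).1 h2
  refine ⟨h, g, u, h0, hg, mul_left_cancel₀ h0 ?_⟩
  rw [mul_one]
  conv_rhs => rw [← hu]
  rw [Finset.mul_sum]
  refine Finset.sum_congr rfl fun i _ => ?_
  rw [smul_eq_mul, hg i]
  ring

theorem exists_intPolynomial {ι : Type*} [Fintype ι] (g : ι → ℚ[X]) :
    ∃ (M : ℤ) (G : ι → ℤ[X]), M ≠ 0 ∧ ∀ i, (G i).map (Int.castRingHom ℚ) = C (M : ℚ) * g i := by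
  classical
  have h1 : ∀ i, ∃ (b : ℤ) (G : ℤ[X]), b ≠ 0 ∧ G.map (Int.castRingHom ℚ) = C (b : ℚ) * g i := by
    intro i
    obtain ⟨b, hb0, hb⟩ := IsLocalization.integerNormalization_spec (nonZeroDivisors ℤ) (g i)
    refine ⟨b, _, nonZeroDivisors.ne_zero hb0, hb.trans ?_⟩
    rw [zsmul_eq_mul]
    simp
  choose b G hb hG using h1
  refine ⟨∏ i, b i, fun i => C (∏ j ∈ Finset.univ.erase i, b j) * G i,
    Finset.prod_ne_zero_iff.2 fun i _ => hb i, fun i => ?_⟩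
  rw [Polynomial.map_mul, hG, ← Finset.prod_erase_mul _ _ (Finset.mem_univ i), map_C]
  push_cast
  rw [C_mul]
  simp [mul_assoc]

section
variable {F : Type*} [Field F] [Algebra ℚ F]

/-- Here `p` is the minimal polynomial of `a(φ) ψ` over `ℚ[φ]`, transported to `ℚ[X]`. As `ℚ[φ]` is
integrally closed, it has the same degree as the one over `ℚ(φ)` and divides every relation. -/
theorem exists_integral_multiple_polynomial {φ ψ : F} (hφ : Transcendental ℚ φ)
    (hψ : IsIntegral ℚ⟮φ⟯ ψ) :
    ∃ (a : ℚ[X]) (p : ℚ[X][X]), a ≠ 0 ∧ p.Monic ∧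
      p.natDegree = (minpoly ℚ⟮φ⟯ (aeval φ a * ψ)).natDegree ∧
      eval₂ (aeval φ : ℚ[X] →ₐ[ℚ] F).toRingHom (aeval φ a * ψ) p = 0 ∧
      ∀ f : ℚ[X][X], eval₂ (aeval φ : ℚ[X] →ₐ[ℚ] F).toRingHom (aeval φ a * ψ) f = 0 → p ∣ f := by
  let A := Algebra.adjoin ℚ {φ}
  let E : ℚ[X] ≃ₐ[ℚ] A := Polynomial.algEquivOfTranscendental ℚ φ hφ
  have hE : ∀ q, ((E q : A) : F) = aeval φ q := fun q => by
    rw [show E q = aeval ⟨φ, Algebra.self_mem_adjoin_singleton ℚ φ⟩ q from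
      Polynomial.algEquivOfTranscendental_apply ℚ φ hφ q]
    induction q using Polynomial.induction_on' with
    | add p q hp hq => rw [map_add, map_add, ← hp, ← hq]; rfl
    | monomial n a => simp [aeval_monomial]
  have hPID : IsPrincipalIdealRing A :=
    IsPrincipalIdealRing.of_surjective E.toRingEquiv.toRingHom E.surjective
  obtain ⟨⟨m, hm⟩, hm'⟩ := IsIntegral.exists_multiple_integral_of_isLocalization
    (R := A) (nonZeroDivisors A) (Rₘ := ℚ⟮φ⟯) ψ hψ
  have hm0 : m ≠ 0 := nonZeroDivisors.ne_zero hm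
  have hEm : aeval φ (E.symm m) = (m : F) := by rw [← hE, E.apply_symm_apply]
  have hmψ : IsIntegral A ((m : F) * ψ) := hm'
  have hcomp : (aeval φ : ℚ[X] →ₐ[ℚ] F).toRingHom = (algebraMap A F).comp E.toRingEquiv.toRingHom :=
    RingHom.ext fun q => (hE q).symm
  have hcomp' : ((aeval φ : ℚ[X] →ₐ[ℚ] F).toRingHom).comp E.symm.toRingEquiv.toRingHom =
      algebraMap A F := RingHom.ext fun q => by
    change aeval φ (E.symm q) = (q : F)
    rw [← hE, E.apply_symm_apply]
  refine ⟨E.symm m, (minpoly A ((m : F) * ψ)).map E.symm.toRingEquiv.toRingHom, ?_,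
    (minpoly.monic hmψ).map _, ?_, ?_, fun f hf => ?_⟩
  · simpa using hm0
  · rw [hEm, minpoly.isIntegrallyClosed_eq_field_fractions' ℚ⟮φ⟯ hmψ,
      (minpoly.monic hmψ).natDegree_map, (minpoly.monic hmψ).natDegree_map]
  · rw [hEm, eval₂_map, hcomp']
    exact minpoly.aeval _ _
  · have h1 : aeval ((m : F) * ψ) (f.map E.toRingEquiv.toRingHom) = 0 := by
      rw [aeval_def, eval₂_map, ← hcomp, ← hEm]
      exact hf
    have h2 := Polynomial.map_dvd E.symm.toRingEquiv.toRingHom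
      (minpoly.isIntegrallyClosed_dvd hmψ h1)
    rw [Polynomial.map_map] at h2
    have h3 : E.symm.toRingEquiv.toRingHom.comp E.toRingEquiv.toRingHom = RingHom.id _ :=
      RingHom.ext fun q => E.symm_apply_apply q
    rwa [h3, Polynomial.map_id] at h2

theorem finrank_le_of_restrictScalars_le {k₁ k₂ : IntermediateField ℚ F}
    {E₁ : IntermediateField k₁ F} {E₂ : IntermediateField k₂ F} [FiniteDimensional E₁ F]
    (h : ∀ x ∈ E₁, x ∈ E₂) :
    Module.finrank E₂ F ≤ Module.finrank E₁ F := by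
  have h7 : FiniteDimensional (E₁.restrictScalars ℚ) F :=
    inferInstanceAs (FiniteDimensional E₁ F)
  have h8 : E₁.restrictScalars ℚ ≤ E₂.restrictScalars ℚ := h
  exact IntermediateField.finrank_le_of_le_left h8

/-- The field `ℚ(φ, b ψ)` lies in `ℚ(ψ, φ)`, so `F` has at least as large a degree over it; the
tower law turns the inequality of degrees of `F` into one for the minimal polynomials. -/
theorem natDegree_minpoly_le_of_finrank_le {φ ψ b : F} [FiniteDimensional ℚ⟮φ⟯ F]
    [FiniteDimensional ℚ⟮ψ⟯ F] (hb : b ∈ ℚ⟮φ⟯)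
    (h : Module.finrank ℚ⟮φ⟯ F ≤ Module.finrank ℚ⟮ψ⟯ F) :
    (minpoly ℚ⟮φ⟯ (b * ψ)).natDegree ≤ (minpoly ℚ⟮ψ⟯ φ).natDegree := by
  have h1 := Module.finrank_mul_finrank ℚ⟮φ⟯ ℚ⟮φ⟯⟮b * ψ⟯ F
  have h2 := Module.finrank_mul_finrank ℚ⟮ψ⟯ ℚ⟮ψ⟯⟮φ⟯ F
  rw [IntermediateField.adjoin.finrank (Algebra.IsIntegral.isIntegral _)] at h1 h2
  have h4 : φ ∈ ℚ⟮ψ⟯⟮φ⟯ := mem_adjoin_simple_self _ φ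
  have h5 : ψ ∈ ℚ⟮ψ⟯⟮φ⟯ := ℚ⟮ψ⟯⟮φ⟯.algebraMap_mem ⟨ψ, mem_adjoin_simple_self _ ψ⟩
  have h6 : ∀ x ∈ ℚ⟮φ⟯, x ∈ ℚ⟮ψ⟯⟮φ⟯ := fun x hx => by
    have : ℚ⟮φ⟯ ≤ ℚ⟮ψ⟯⟮φ⟯.restrictScalars ℚ := adjoin_simple_le_iff.2 h4
    exact this hx
  have h3 : ∀ x ∈ ℚ⟮φ⟯⟮b * ψ⟯, x ∈ ℚ⟮ψ⟯⟮φ⟯ := fun x hx => by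
    induction hx using IntermediateField.adjoin_induction with
    | mem x hx =>
      rw [Set.mem_singleton_iff.1 hx]
      exact mul_mem (h6 b hb) h5
    | algebraMap x => exact h6 _ x.2
    | add x y _ _ hx hy => exact add_mem hx hy
    | mul x y _ _ hx hy => exact mul_mem hx hy
    | inv x _ hx => exact inv_mem hx
  have h8 : Module.finrank ℚ⟮ψ⟯⟮φ⟯ F ≤ Module.finrank ℚ⟮φ⟯⟮b * ψ⟯ F :=
    finrank_le_of_restrictScalars_le h3
  have h9 : 0 < Module.finrank ℚ⟮ψ⟯⟮φ⟯ F := Module.finrank_pos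
  rw [← h1, ← h2] at h
  by_contra! h10
  have h11 : (minpoly ℚ⟮ψ⟯ φ).natDegree * Module.finrank ℚ⟮ψ⟯⟮φ⟯ F <
      (minpoly ℚ⟮φ⟯ (b * ψ)).natDegree * Module.finrank ℚ⟮φ⟯⟮b * ψ⟯ F :=
    calc _ < (minpoly ℚ⟮φ⟯ (b * ψ)).natDegree * Module.finrank ℚ⟮ψ⟯⟮φ⟯ F :=
          Nat.mul_lt_mul_of_pos_right h10 h9
      _ ≤ _ := Nat.mul_le_mul_left _ h8
  omega

/-- Read as a polynomial in `φ` over `ℚ(ψ)`, the relation is nonzero, so its degree is at least that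
of the minimal polynomial of `φ`. -/
theorem exists_natDegree_minpoly_le {φ ψ : F} (hψ : Transcendental ℚ ψ) {n : ℕ}
    (g : Fin n → ℚ[X]) (hg : ∃ i, g i ≠ 0) (h : ∑ i, aeval φ (g i) * ψ ^ (i : ℕ) = 0) :
    ∃ i, (minpoly ℚ⟮ψ⟯ φ).natDegree ≤ (g i).natDegree := by
  let ψ' : ℚ⟮ψ⟯ := IntermediateField.AdjoinSimple.gen ℚ ψ
  let Q : ℚ⟮ψ⟯[X] := ∑ i, (g i).map (algebraMap ℚ ℚ⟮ψ⟯) * C (ψ' ^ (i : ℕ))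
  have hQ : aeval φ Q = 0 := by
    simp only [Q, map_sum, map_mul, aeval_map_algebraMap, aeval_C, map_pow]
    exact h
  have hQ0 : Q ≠ 0 := by
    intro h0
    obtain ⟨i, hi⟩ := hg
    obtain ⟨k, hk⟩ : ∃ k, (g i).coeff k ≠ 0 := by
      by_contra! h1
      exact hi (Polynomial.ext h1)
    have h1 := congrArg (fun q => (q.coeff k : ℚ⟮ψ⟯)) h0
    simp only [Q, finsetSum_coeff, coeff_mul_C, coeff_map, coeff_zero] at h1
    have h2 : aeval ψ (∑ i : Fin n, C ((g i).coeff k) * X ^ (i : ℕ)) = 0 := by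
      have h3 := congrArg (algebraMap ℚ⟮ψ⟯ F) h1
      rw [map_sum, map_zero] at h3
      rw [map_sum, ← h3]
      refine Finset.sum_congr rfl fun j _ => ?_
      rw [map_mul, map_mul, aeval_C, map_pow, aeval_X, map_pow,
        ← IsScalarTower.algebraMap_apply]
      rfl
    have h4 := congrArg (fun q => coeff q (i : ℕ)) (transcendental_iff.1 hψ _ h2)
    simp only [finsetSum_coeff, coeff_C_mul, coeff_X_pow, coeff_zero] at h4
    rw [Finset.sum_eq_single i] at h4
    · simp at h4; exact hk h4
    · intro j _ hj
      rw [if_neg (fun h => hj (Fin.ext h.symm)), mul_zero]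
    · simp
  have h1 := Polynomial.natDegree_le_natDegree (minpoly.degree_le_of_ne_zero ℚ⟮ψ⟯ φ hQ0 hQ)
  by_contra! h2
  have h3 : Q.natDegree < (minpoly ℚ⟮ψ⟯ φ).natDegree := by
    obtain ⟨i, hi⟩ := hg
    have h0 : 0 < (minpoly ℚ⟮ψ⟯ φ).natDegree := (Nat.zero_le _).trans_lt (h2 i)
    refine (Nat.lt_iff_le_pred h0).2 (natDegree_sum_le_of_forall_le _ _ fun j _ => ?_)
    refine (natDegree_mul_C_le _ _).trans (natDegree_map_le.trans ?_)
    have := h2 j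
    omega
  omega

end

end
end StackyCurve

/-! ### Specialization and points of large height -/

namespace StackyCurve
noncomputable section

open Polynomial IntermediateField

section
variable {F : Type*} [Field F] [Algebra ℚ F]

/-- An equation between two functions, with coprime coefficients. -/
theorem exists_equation {φ ψ : F} (hφ : Transcendental ℚ φ) (hψ : Transcendental ℚ ψ)
    [FiniteDimensional ℚ⟮φ⟯ F] [FiniteDimensional ℚ⟮ψ⟯ F]
    (h : Module.finrank ℚ⟮φ⟯ F ≤ Module.finrank ℚ⟮ψ⟯ F) :
    ∃ (e : ℕ) (a b : ℚ[X]) (p : ℚ[X][X]) (G u : Fin (e + 1) → ℤ[X]) (R : ℤ) (j : Fin (e + 1)),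
      0 < e ∧ a ≠ 0 ∧ b ≠ 0 ∧ p.Monic ∧ p.natDegree = e ∧
      (∀ f : ℚ[X][X], eval₂ (aeval φ : ℚ[X] →ₐ[ℚ] F).toRingHom (aeval φ a * ψ) f = 0 → p ∣ f) ∧
      (∀ i : Fin (e + 1), p.coeff (i : ℕ) * a ^ (i : ℕ) = b * (G i).map (Int.castRingHom ℚ)) ∧
      R ≠ 0 ∧ ∑ i, u i * G i = C R ∧ e ≤ (G j).natDegree := by
  obtain ⟨a, p, ha, hp, hpd, hp0, hpdvd⟩ := exists_integral_multiple_polynomial hφ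
    (Algebra.IsIntegral.isIntegral (R := ℚ⟮φ⟯) ψ)
  set e := p.natDegree with he
  have hmem : aeval φ a ∈ ℚ⟮φ⟯ := algebra_adjoin_le_adjoin ℚ _ (aeval_mem_adjoin_singleton ℚ φ)
  have hdeg := natDegree_minpoly_le_of_finrank_le (ψ := ψ) hmem h
  have he0 : 0 < e := by
    rw [hpd]
    exact minpoly.natDegree_pos (Algebra.IsIntegral.isIntegral _)
  -- Division by the greatest common divisor makes the coefficients of the equation for `ψ` coprime;
  -- this later bounds the common divisors of their integral multiples at integers.
  obtain ⟨d, g, u, hd, hg, hu⟩ := exists_eq_mul_and_sum_eq_one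
    (fun i : Fin (e + 1) => p.coeff i * a ^ (i : ℕ)) ⟨Fin.last e, by
      rw [Fin.val_last, he, hp.coeff_natDegree, one_mul]
      exact pow_ne_zero _ ha⟩
  have hdφ : aeval φ d ≠ 0 := fun h0 => hd (transcendental_iff.1 hφ _ h0)
  have hrel : ∑ i, aeval φ (g i) * ψ ^ (i : ℕ) = 0 := by
    apply mul_left_cancel₀ hdφ
    rw [mul_zero, ← hp0, eval₂_eq_sum_range, Finset.sum_range, Finset.mul_sum]
    refine Finset.sum_congr rfl fun i _ => ?_
    have := congrArg (aeval φ) (hg i)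
    rw [map_mul, map_mul, map_pow] at this
    rw [← mul_assoc, ← this]
    change _ = aeval φ (p.coeff i) * (aeval φ a * ψ) ^ (i : ℕ)
    rw [mul_pow, mul_assoc]
  have hgne : ∃ i, g i ≠ 0 := by
    by_contra! h0
    simp [h0] at hu
  obtain ⟨j, hj⟩ := exists_natDegree_minpoly_le hψ g hgne hrel
  obtain ⟨M, G, hM, hG⟩ := exists_intPolynomial g
  obtain ⟨M', U, hM', hU⟩ := exists_intPolynomial u
  have hMq : (C (M : ℚ)) ≠ 0 := by simpa using hM
  have hinj : Function.Injective (Polynomial.map (Int.castRingHom ℚ)) :=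
    Polynomial.map_injective _ Int.cast_injective
  refine ⟨e, a, d * C (M : ℚ)⁻¹, p, G, U, M' * M, j, he0, ha,
    mul_ne_zero hd (by simpa using hM), hp, rfl, hpdvd, fun i => ?_, mul_ne_zero hM' hM, ?_, ?_⟩
  · rw [hg i, hG i]
    have : (C (M : ℚ)⁻¹ : ℚ[X]) * C (M : ℚ) = 1 := by
      rw [← C_mul, inv_mul_cancel₀ (by exact_mod_cast hM), C_1]
    linear_combination (- d * g i) * this
  · apply hinj
    rw [Polynomial.map_sum]
    have h1 : ∀ i, (U i * G i).map (Int.castRingHom ℚ) = C (M' : ℚ) * C (M : ℚ) * (u i * g i) := by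
      intro i
      rw [Polynomial.map_mul, hU, hG]
      ring
    simp_rw [h1]
    rw [← Finset.mul_sum, hu, mul_one, map_C]
    simp
  · have h2 : (G j).natDegree = (g j).natDegree := by
      rw [← natDegree_map_eq_of_injective (f := Int.castRingHom ℚ) Int.cast_injective, hG,
        natDegree_C_mul (by exact_mod_cast hM)]
    omega

end

theorem exists_eq_prod_X_sub_C {K : Type*} [Field K] [IsAlgClosed K] {f : K[X]} (hf : f.Monic)
    {e : ℕ} (he : f.natDegree = e) : ∃ y : Fin e → K, f = ∏ i, (X - C (y i)) := by
  have hs := IsAlgClosed.splits f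
  have h1 := hs.eq_prod_roots_of_monic hf
  have h2 := hs.natDegree_eq_card_roots
  obtain ⟨l, hl⟩ := Quot.exists_rep f.roots
  have hl' : (l : Multiset K) = f.roots := hl
  rw [← hl'] at h1 h2
  rw [he, Multiset.coe_card] at h2
  subst h2
  refine ⟨l.get, h1.trans ?_⟩
  rw [Multiset.map_coe, Multiset.prod_coe, ← List.prod_ofFn]
  congr 1
  exact (List.ofFn_getElem_eq_map l fun a => X - C a).symm

/-- A polynomial that is large for most values of the parameter has a large root. -/
theorem exists_le_ht_root {e : ℕ} {a b : ℚ[X]} {p : ℚ[X][X]} {G u : Fin (e + 1) → ℤ[X]} {R : ℤ}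
    {j : Fin (e + 1)} (he : 0 < e) (ha : a ≠ 0) (hb : b ≠ 0) (hp : p.Monic) (hpd : p.natDegree = e)
    (hG : ∀ i : Fin (e + 1), p.coeff (i : ℕ) * a ^ (i : ℕ) = b * (G i).map (Int.castRingHom ℚ))
    (hR : R ≠ 0) (hu : ∑ i, u i * G i = C R) (hj : e ≤ (G j).natDegree) :
    ∃ c : ℝ, 0 < c ∧ ∀ᶠ t : ℕ in Filter.atTop, aeval ((t : ℤ) : Qbar) a ≠ 0 ∧ ∃ y : Qbar,
      eval₂ (aeval ((t : ℤ) : Qbar) : ℚ[X] →ₐ[ℚ] Qbar).toRingHom (aeval ((t : ℤ) : Qbar) a * y) p = 0 ∧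
        c * t ≤ ht ![1, y] := by
  obtain ⟨c, hc, hct⟩ := exists_le_ht_eval G ⟨u, R, hR, hu⟩ j
  obtain ⟨M, hM, hMe⟩ := ht_coeff_prod_le e
  have hne : ∀ q : ℚ[X], q ≠ 0 → ∀ᶠ t : ℕ in Filter.atTop, aeval ((t : ℤ) : Qbar) q ≠ 0 := by
    intro q hq
    rw [← Nat.cofinite_eq_atTop]
    refine Set.Finite.subset (Set.Finite.preimage (f := fun t : ℕ => (t : ℚ))
      (fun _ _ _ _ h => Nat.cast_injective h) (Polynomial.finite_setOfPred_isRoot hq)) ?_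
    intro t ht
    have h1 : aeval ((t : ℤ) : Qbar) q = 0 := not_not.1 ht
    have h2 : ((t : ℤ) : Qbar) = algebraMap ℚ Qbar (t : ℚ) := by simp
    rw [h2, aeval_algebraMap_apply, map_eq_zero] at h1
    exact h1
  -- The minimum with `1` ensures that its `e`-th power is at most `c / M`.
  refine ⟨min 1 (c / M), by positivity, ?_⟩
  filter_upwards [hct, hne a ha, hne b hb, Filter.eventually_ge_atTop 1] with t hct ha hb ht1
  refine ⟨ha, ?_⟩
  set A := aeval ((t : ℤ) : Qbar) a with hA
  let f := p.map (aeval ((t : ℤ) : Qbar) : ℚ[X] →ₐ[ℚ] Qbar).toRingHom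
  have hf : f.Monic := hp.map _
  have hfe : f.natDegree = e := by rw [hp.natDegree_map, hpd]
  obtain ⟨y, hy⟩ := exists_eq_prod_X_sub_C hf hfe
  -- Substituting `A X` for `X` produces the roots `yᵢ / A`, and the resulting coefficients are
  -- proportional to the values of the `G k` at `t`.
  have hcoeff : ∀ k : Fin (e + 1), (∏ i, (X - C (y i / A))).coeff k =
      aeval ((t : ℤ) : Qbar) b / A ^ e * (((G k).eval (t : ℤ) : ℤ) : Qbar) := by
    intro k
    have h1 : f.comp (C A * X) = C (A ^ e) * ∏ i, (X - C (y i / A)) := by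
      rw [hy, Polynomial.prod_comp]
      have : ∀ i, (X - C (y i)).comp (C A * X) = C A * (X - C (y i / A)) := fun i => by
        rw [sub_comp, X_comp, C_comp, mul_sub, ← C_mul, mul_div_cancel₀ _ ha]
      simp_rw [this]
      rw [Finset.prod_mul_distrib, Finset.prod_const, Finset.card_univ, Fintype.card_fin, C_pow]
    have h2 := congrArg (fun q => q.coeff (k : ℕ)) h1
    simp only [comp_C_mul_X_coeff, coeff_C_mul] at h2
    have h3 := congrArg (aeval ((t : ℤ) : Qbar)) (hG k)
    rw [map_mul, map_mul, map_pow] at h3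
    have h4 : f.coeff k = aeval ((t : ℤ) : Qbar) (p.coeff k) := coeff_map _ _
    have h5 : aeval ((t : ℤ) : Qbar) ((G k).map (Int.castRingHom ℚ)) =
        (((G k).eval (t : ℤ) : ℤ) : Qbar) := by
      rw [aeval_def, eval₂_map, RingHom.ext_int ((algebraMap ℚ Qbar).comp _) (Int.castRingHom Qbar)]
      exact eval₂_at_apply (Int.castRingHom Qbar) (t : ℤ)
    rw [← h4, h5, h2] at h3
    rw [div_mul_eq_mul_div, ← h3]
    field_simp
  have h1 := hMe fun i => y i / A
  simp_rw [hcoeff] at h1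
  rw [ht_smul _ (div_ne_zero hb (pow_ne_zero _ ha))] at h1
  have ht1' : (1 : ℝ) ≤ t := by exact_mod_cast ht1
  -- The coefficient vector has height at least `c t ^ e` and at most `M` times the product of the
  -- heights of the `e` roots, so some root has height of order at least `t`.
  have h2 : c * (t : ℝ) ^ e ≤ M * ∏ i, ht ![1, y i / A] :=
    ((mul_le_mul_of_nonneg_left (pow_le_pow_right₀ ht1' hj) hc.le).trans hct).trans h1
  obtain ⟨i, hi⟩ : ∃ i, min 1 (c / M) * t ≤ ht ![1, y i / A] := by
    by_contra! h
    have hd : (0 : ℝ) < min 1 (c / M) := by positivity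
    have h3 : ∏ i, ht ![1, y i / A] < ∏ _i : Fin e, min 1 (c / M) * (t : ℝ) :=
      Finset.prod_lt_prod_of_nonempty (fun i _ => ht_pos _) (fun i _ => h i)
        ⟨⟨0, he⟩, Finset.mem_univ _⟩
    rw [Finset.prod_const, Finset.card_univ, Fintype.card_fin, mul_pow] at h3
    have h4 : min 1 (c / M) ^ e ≤ c / M :=
      (pow_le_of_le_one hd.le (min_le_left _ _) he.ne').trans (min_le_right _ _)
    have h5 : min 1 (c / M) ^ e * (t : ℝ) ^ e ≤ c / M * (t : ℝ) ^ e := by gcongr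
    have h6 := h2.trans_lt (mul_lt_mul_of_pos_left (h3.trans_le h5) hM)
    have h7 : M * (c / M * (t : ℝ) ^ e) = c * (t : ℝ) ^ e := by field_simp
    linarith
  refine ⟨y i / A, ?_, hi⟩
  rw [mul_div_cancel₀ _ ha, ← Polynomial.eval_map]
  change f.eval (y i) = 0
  rw [hy, eval_prod]
  exact Finset.prod_eq_zero (Finset.mem_univ i) (by simp)

namespace Curve
variable {C : Curve}

theorem finrank_adjoin_sub_intCast (φ : C.FunField) (t : ℤ) : funDeg (φ - (t : C.FunField)) = funDeg φ := by
  have : ∀ (g : C.FunField) (t : ℤ), ℚ⟮g - (t : C.FunField)⟯ ≤ ℚ⟮g⟯ := fun g t =>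
    adjoin_simple_le_iff.2 (sub_mem (mem_adjoin_simple_self ℚ g) (intCast_mem _ _))
  unfold funDeg
  rw [le_antisymm (this φ t) (by simpa using this (φ - (t : C.FunField)) (-t))]

/-- The degree of a point is at most the degree of a function with a rational value there. -/
theorem deg_le_funDeg {φ : C.FunField} (hφ : Transcendental ℚ φ) {P : C.GeomPoint}
    {r : C.X.presheaf.stalk P.pt} (hr : algebraMap _ C.FunField r = φ) {t : ℤ}
    (ht : P.eval r = t) : P.deg ≤ funDeg φ := by
  have h0 : φ - (t : C.FunField) ≠ 0 := by
    intro h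
    apply hφ
    rw [sub_eq_zero.1 h]
    exact isAlgebraic_intCast t
  have h1 : 0 < Scheme.ord (φ - (t : C.FunField)) P.pt := by
    have h2 : algebraMap _ C.FunField (r - (t : C.X.presheaf.stalk P.pt)) = φ - (t : C.FunField) := by
      rw [map_sub, hr, map_intCast]
    rw [← h2]
    refine lt_of_le_of_ne (ord_algebraMap_nonneg _) fun h3 => ?_
    have h4 := (ord_algebraMap_eq_zero_iff P.pt_ne_genericPoint (fun h5 => h0 (by
      rw [← h2, h5, map_zero]))).1 h3.symm
    have h5 := (h4.map P.eval).ne_zero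
    rw [map_sub, map_intCast, ht, sub_self] at h5
    exact h5 rfl
  have h2 := finsum_zeros (φ - (t : C.FunField))
  rw [finrank_adjoin_sub_intCast] at h2
  have h3 : max (Scheme.ord (φ - (t : C.FunField)) P.pt) 0 * (C.degPt P.pt : ℤ) ≤
      ∑ᶠ z, max (Scheme.ord (φ - (t : C.FunField)) z) 0 * (C.degPt z : ℤ) := by
    refine single_le_finsum (f := fun z => max (Scheme.ord (φ - (t : C.FunField)) z) 0 *
      (C.degPt z : ℤ)) P.pt ?_ fun z => by positivity
    refine (finite_setOf_ord_pos (φ - (t : C.FunField))).subset fun z hz => ?_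
    by_contra h4
    apply hz
    have h5 : Scheme.ord (φ - (t : C.FunField)) z ≤ 0 := not_lt.1 h4
    simp [max_eq_right h5]
  rw [h2] at h3
  have h4 : (1 : ℤ) * (C.degPt P.pt : ℤ) ≤ max (Scheme.ord (φ - (t : C.FunField)) P.pt) 0 * (C.degPt P.pt : ℤ) :=
    mul_le_mul_of_nonneg_right (le_max_of_le_left h1) (by positivity)
  have h5 : (C.degPt P.pt : ℤ) ≤ funDeg φ := by linarith
  exact_mod_cast h5

/-- Points with prescribed values of two functions. -/
theorem exists_geomPoint_of_root {φ ψ : C.FunField} (hφ : Transcendental ℚ φ)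
    {a : ℚ[X]} {p : ℚ[X][X]}
    (hp : ∀ f : ℚ[X][X], eval₂ (aeval φ : ℚ[X] →ₐ[ℚ] C.FunField).toRingHom (aeval φ a * ψ) f = 0 →
      p ∣ f) {t : ℤ} {y : Qbar} (hat : aeval (t : Qbar) a ≠ 0)
    (hy : eval₂ (aeval (t : Qbar) : ℚ[X] →ₐ[ℚ] Qbar).toRingHom (aeval (t : Qbar) a * y) p = 0) :
    ∃ P : C.GeomPoint, P.HasVal φ t ∧ P.HasVal ψ y := by
  let f₁ : ℚ[X][X] →+* C.FunField :=
    eval₂RingHom (aeval φ : ℚ[X] →ₐ[ℚ] C.FunField).toRingHom (aeval φ a * ψ)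
  let f₂ : ℚ[X][X] →+* Qbar :=
    eval₂RingHom (aeval (t : Qbar) : ℚ[X] →ₐ[ℚ] Qbar).toRingHom (aeval (t : Qbar) a * y)
  -- The ring `ℚ[φ, a(φ) ψ]` is the quotient of `ℚ[X][Y]` by a multiple-of-`p` ideal of relations;
  -- since `a(t) y` is a root of `p` specialized at `t`, the assignment to values in `Qbar` respects
  -- all relations.
  have hker : RingHom.ker f₁.rangeRestrict ≤ RingHom.ker f₂ := by
    intro f hf
    rw [RingHom.ker_rangeRestrict] at hf
    obtain ⟨q, rfl⟩ := hp f hf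
    rw [RingHom.mem_ker, map_mul]
    have : f₂ p = 0 := hy
    rw [this, zero_mul]
  let θ : f₁.range →+* Qbar :=
    RingHom.liftOfSurjective f₁.rangeRestrict f₁.rangeRestrict_surjective ⟨f₂, hker⟩
  have hθ : ∀ f, θ (f₁.rangeRestrict f) = f₂ f := fun f =>
    RingHom.liftOfRightInverse_comp_apply _ _ _ ⟨f₂, hker⟩ f
  have hC₁ : ∀ q : ℚ[X], f₁ (Polynomial.C q) = aeval φ q := fun q => eval₂_C _ _
  have hC₂ : ∀ q : ℚ[X], f₂ (Polynomial.C q) = aeval (t : Qbar) q := fun q => eval₂_C _ _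
  have hX₁ : f₁ Polynomial.X = aeval φ a * ψ := eval₂_X _ _
  have hX₂ : f₂ Polynomial.X = aeval (t : Qbar) a * y := eval₂_X _ _
  obtain ⟨P, hP⟩ := exists_geomPoint_of_subring f₁.range
    (fun q => ⟨Polynomial.C (Polynomial.C q), by rw [hC₁, aeval_C]⟩) θ
    -- The nonzero element `φ - t` is in the kernel, so the homomorphism is not injective.
    ⟨f₁.rangeRestrict (Polynomial.C (Polynomial.X - Polynomial.C (t : ℚ))), by
      intro h
      have h2 := congrArg Subtype.val h
      rw [RingHom.coe_rangeRestrict, hC₁] at h2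
      exact X_sub_C_ne_zero (t : ℚ) (transcendental_iff.1 hφ _ h2), by
      rw [hθ, hC₂, map_sub, aeval_X, aeval_C]
      simp⟩
  have hP' : ∀ f, P.HasVal (f₁ f) (f₂ f) := fun f => by
    have := hP (f₁.rangeRestrict f)
    rwa [hθ, RingHom.coe_rangeRestrict] at this
  refine ⟨P, by simpa only [hC₁, hC₂, aeval_X] using hP' (Polynomial.C Polynomial.X), ?_⟩
  obtain ⟨r, hr, hr'⟩ := hP' (Polynomial.C a)
  obtain ⟨s, hs, hs'⟩ := hP' Polynomial.X
  rw [hC₁] at hr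
  rw [hC₂] at hr'
  have hu : IsUnit r := by
    by_contra h
    exact h (isUnit_of_map_unit P.eval r (hr' ▸ isUnit_iff_ne_zero.2 hat))
  obtain ⟨u, rfl⟩ := hu
  have h1 : algebraMap _ C.FunField ((u⁻¹ : (C.X.presheaf.stalk P.pt)ˣ) : C.X.presheaf.stalk P.pt) *
      aeval φ a = 1 := by
    rw [← hr, ← map_mul, Units.inv_mul, map_one]
  have h2 : P.eval ((u⁻¹ : (C.X.presheaf.stalk P.pt)ˣ) : C.X.presheaf.stalk P.pt) *
      aeval (t : Qbar) a = 1 := by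
    rw [← hr', ← map_mul, Units.inv_mul, map_one]
  refine ⟨(u⁻¹ : (C.X.presheaf.stalk P.pt)ˣ) * s, ?_, ?_⟩
  · rw [map_mul, hs, hX₁, ← mul_assoc, h1, one_mul]
  · rw [map_mul, hs', hX₂, ← mul_assoc, h2, one_mul]

/-- For large integers `t` there is a point with `φ = t`, where `φ` has height exactly `t` and `ψ`
height at least `c t`. Its degree is at most `funDeg φ`, and different `t` give different points. -/
theorem exists_infinite_ht_le {φ ψ : C.FunField} (hφ : Transcendental ℚ φ)
    (hψ : Transcendental ℚ ψ) (h : funDeg φ ≤ funDeg ψ) :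
    ∃ (D : ℕ) (K : ℝ), 0 < K ∧ {P : C.GeomPoint | P.deg ≤ D ∧ ∃ r s : C.X.presheaf.stalk P.pt,
      algebraMap _ C.FunField r = φ ∧ algebraMap _ C.FunField s = ψ ∧
        ht ![1, P.eval r] ≤ K * ht ![1, P.eval s]}.Infinite := by
  have : Fact (Transcendental ℚ φ) := ⟨hφ⟩
  have : Fact (Transcendental ℚ ψ) := ⟨hψ⟩
  obtain ⟨e, a, b, p, G, u, R, j, he, ha, hb, hp, hpd, hdvd, hG, hR, hu, hj⟩ :=
    exists_equation hφ hψ h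
  obtain ⟨c, hc, hev⟩ := exists_le_ht_root he ha hb hp hpd hG hR hu hj
  obtain ⟨N, hN⟩ := Filter.eventually_atTop.1 hev
  have hP : ∀ t : ℕ, ∃ P : C.GeomPoint, ∃ r s : C.X.presheaf.stalk P.pt,
      algebraMap _ C.FunField r = φ ∧ algebraMap _ C.FunField s = ψ ∧
      P.eval r = (((t + N + 1 : ℕ) : ℤ) : Qbar) ∧ c * (t + N + 1 : ℕ) ≤ ht ![1, P.eval s] := by
    intro t
    obtain ⟨hat, y, hy, hcy⟩ := hN (t + N + 1) (by omega)
    obtain ⟨P, ⟨r, hr, hr'⟩, s, hs, hs'⟩ := exists_geomPoint_of_root hφ hdvd hat hy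
    exact ⟨P, r, s, hr, hs, hr', hs'.symm ▸ hcy⟩
  choose P r s hr hs hr' hs' using hP
  refine ⟨funDeg φ, c⁻¹, by positivity, Set.infinite_of_injective_forall_mem (f := P) ?_ ?_⟩
  · intro t t' h
    have h1 : ∀ (Q Q' : C.GeomPoint) (r : C.X.presheaf.stalk Q.pt) (r' : C.X.presheaf.stalk Q'.pt),
        Q = Q' → algebraMap _ C.FunField r = φ → algebraMap _ C.FunField r' = φ →
        Q.eval r = Q'.eval r' := by
      rintro Q Q' r r' rfl h h'
      rw [stalk_injective _ (h.trans h'.symm)]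
    have h2 := h1 _ _ _ _ h (hr t) (hr t')
    rw [hr', hr'] at h2
    have h3 : t + N + 1 = t' + N + 1 := by exact_mod_cast h2
    omega
  · intro t
    refine ⟨deg_le_funDeg hφ (hr t) (hr' t), r t, s t, hr t, hs t, ?_⟩
    rw [hr', ht_one_intCast]
    have h1 : (1 : ℝ) ≤ (t + N + 1 : ℕ) := by exact_mod_cast Nat.le_add_left 1 (t + N)
    rw [Int.cast_natCast, abs_of_nonneg (by positivity), max_eq_right h1, ← div_eq_inv_mul,
      le_div_iff₀ hc, mul_comm]
    exact hs' t

end Curve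
end
end StackyCurve

/-! ### Weil heights on curves -/

namespace StackyCurve
noncomputable section
namespace Curve
variable {C : Curve}

theorem degDiv_sub (A B : C.X →₀ ℤ) : C.degDiv (A - B) = C.degDiv A - C.degDiv B :=
  Finsupp.sum_sub_index fun _ _ _ => sub_mul _ _ _

theorem not_strongNorthcott_of_infinite {α : Type*} {deg : α → ℕ} {H : α → ℝ} {T : ℝ} {D : ℕ}
    {p : α → Prop} (hp : ∀ᶠ P in Filter.cofinite, p P) {S : Set α} (hS : S.Infinite)
    (h : ∀ P ∈ S, p P → H P ≤ T ∧ deg P ≤ D) : ¬ StrongNorthcott deg H := by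
  intro hN
  have h1 := hN (max T 1) (max D 1) (by positivity) (by positivity)
  refine (hS.sdiff hp).mono ?_ h1
  rintro P ⟨hP, hP'⟩
  obtain ⟨h2, h3⟩ := h P hP (not_not.1 hP')
  exact ⟨h2.trans (le_max_left _ _), h3.trans (le_max_left _ _)⟩

theorem exists_ht_eval_le_of_isAlgebraic {φ : C.FunField} (hφ : IsAlgebraic ℚ φ) :
    ∃ M : ℝ, ∀ (P : C.GeomPoint) (r : C.X.presheaf.stalk P.pt), algebraMap _ C.FunField r = φ →
      ht ![1, P.eval r] ≤ M := by
  obtain ⟨q, hq, hq0⟩ := (IsFractionRing.isAlgebraic_iff ℤ ℚ C.FunField).2 hφ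
  have hfin : {a : Qbar | Polynomial.aeval a q = 0}.Finite := by
    refine (Polynomial.rootSet_finite q Qbar).subset fun a ha => ?_
    rw [Polynomial.mem_rootSet]
    exact ⟨hq, ha⟩
  obtain ⟨M, hM⟩ := (hfin.image fun a => ht ![1, a]).bddAbove
  refine ⟨M, fun P r hr => hM ⟨_, ?_, rfl⟩⟩
  change Polynomial.aeval (P.eval r) q = 0
  rw [← eval_aeval]
  rw [show Polynomial.aeval r q = 0 from stalk_injective _ (by
    rw [map_zero, ← Polynomial.aeval_algebraMap_apply, hr, hq0]), map_zero]

theorem not_strongNorthcott_of_funDeg_le {H hA hB : C.GeomPoint → ℝ} {φ ψ : C.FunField}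
    (h : funDeg φ ≤ funDeg ψ) {c K L : ℝ} (hc : 0 < c) (hK : 0 < K) (hL : 0 < L)
    (hH : ∀ P, H P ≤ c * (hA P / hB P))
    (hφ : ∀ᶠ P : C.GeomPoint in Filter.cofinite, ∃ r : C.X.presheaf.stalk P.pt,
        algebraMap _ C.FunField r = φ ∧ hA P ≤ K * ht ![1, P.eval r] ∧
          ht ![1, P.eval r] ≤ K * hA P)
    (hψ' : ∀ᶠ P : C.GeomPoint in Filter.cofinite, ∃ r : C.X.presheaf.stalk P.pt,
        algebraMap _ C.FunField r = ψ ∧ hB P ≤ L * ht ![1, P.eval r] ∧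
          ht ![1, P.eval r] ≤ L * hB P) :
    ¬ StrongNorthcott GeomPoint.deg H := by
  -- It is enough to bound the quotient of the heights of the two functions.
  have key : ∀ (D : ℕ) (M : ℝ) (S : Set C.GeomPoint), S.Infinite → 0 < M →
      (∀ P ∈ S, P.deg ≤ D ∧ ∀ r s : C.X.presheaf.stalk P.pt, algebraMap _ C.FunField r = φ →
        algebraMap _ C.FunField s = ψ → ht ![1, P.eval r] ≤ M * ht ![1, P.eval s]) →
      ¬ StrongNorthcott GeomPoint.deg H := by
    intro D M S hS hM hb
    refine not_strongNorthcott_of_infinite (hφ.and hψ') hS (T := c * (K * M * L)) (D := D) ?_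
    rintro P hP ⟨⟨r, hr, hr1, -⟩, s, hs, -, hs2⟩
    obtain ⟨h1, h2⟩ := hb P hP
    refine ⟨(hH P).trans (mul_le_mul_of_nonneg_left ?_ hc.le), h1⟩
    have h3 : 0 < hB P := pos_of_mul_pos_right ((ht_pos _).trans_le hs2) hL.le
    rw [div_le_iff₀ h3]
    calc hA P ≤ K * ht ![1, P.eval r] := hr1
      _ ≤ K * (M * ht ![1, P.eval s]) := by gcongr; exact h2 r s hr hs
      _ ≤ K * (M * (L * hB P)) := by gcongr
      _ = K * M * L * hB P := by ring
  by_cases hφt : Transcendental ℚ φ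
  · obtain ⟨D, M, hM, hS⟩ := exists_infinite_ht_le hφt
      (transcendental_of_funDeg_pos ((funDeg_pos hφt).trans_le h)) h
    refine key D M _ hS hM ?_
    rintro P ⟨hD, r, s, hr, hs, hrs⟩
    refine ⟨hD, fun r' s' hr' hs' => ?_⟩
    rwa [stalk_injective _ (hr'.trans hr.symm), stalk_injective _ (hs'.trans hs.symm)]
  -- A constant `φ` has bounded height and `ψ` has height at least `1`, so any infinite set of
  -- points of bounded degree will do; a transcendental function provides one.
  · obtain ⟨x, hx⟩ := exists_transcendental ℚ C.FunField C.finrank_kaehlerDifferential_funField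
    obtain ⟨D, _, _, hS⟩ := exists_infinite_ht_le hx hx le_rfl
    obtain ⟨M, hM⟩ := exists_ht_eval_le_of_isAlgebraic (not_not.1 hφt)
    refine key D (max M 1) _ hS (by positivity) ?_
    rintro P ⟨hD, -⟩
    refine ⟨hD, fun r s hr hs => ?_⟩
    calc ht ![1, P.eval r] ≤ max M 1 := (hM P r hr).trans (le_max_left _ _)
      _ ≤ max M 1 * ht ![1, P.eval s] := le_mul_of_one_le_right (by positivity) (one_le_ht _)

/-- A Weil height on a curve is strongly Northcott if and only if the degree of its divisor is
positive. -/
theorem IsWeilHeight.strongNorthcott_iff {D : C.X →₀ ℤ} {H : C.GeomPoint → ℝ}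
    (hD : IsWeilHeight D H) : StrongNorthcott GeomPoint.deg H ↔ 0 < C.degDiv D := by
  obtain ⟨A, B, p, q, s, t, hA, hB, c, rfl, hs, ht, hsA, htB, hc, hH⟩ := hD
  obtain ⟨φ, hφ, hAφ, K, hK, hK'⟩ := exists_equiv_ht hs hsA
  obtain ⟨ψ, hψ, hBψ, L, hL, hL'⟩ := exists_equiv_ht ht htB
  rw [degDiv_sub, hAφ, hBψ, sub_pos, Nat.cast_lt]
  refine ⟨fun h => ?_, fun h => strongNorthcott_of_funDeg_lt hψ h hc hK hL (fun P => (hH P).1)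
    hK' hL'⟩
  by_contra hlt
  exact not_strongNorthcott_of_funDeg_le (not_lt.1 hlt) hc hK hL (fun P => (hH P).2) hK' hL' h

end Curve
end
end StackyCurve

/-! ### Local factors and heights of rational points -/

namespace StackyCurve
noncomputable section

theorem exists_phi_spec {m : ℕ} (hm : m ≠ 0) (n : ℕ) : {k : ℕ | 0 < k ∧ ∃ r : ℕ, n * k = r ^ m}.Nonempty := by
  rcases Nat.eq_zero_or_pos n with rfl | hn
  · exact ⟨1, one_pos, 0, by simp [hm]⟩
  · exact ⟨n ^ (m - 1), pow_pos hn _, n, by rw [← pow_succ', Nat.sub_add_cancel (Nat.pos_of_ne_zero hm)]⟩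

theorem phi_pos {m : ℕ} (hm : m ≠ 0) (n : ℕ) : 0 < phi m n :=
  (Nat.sInf_mem (exists_phi_spec hm n)).1

theorem exists_mul_phi_eq {m : ℕ} (hm : m ≠ 0) (n : ℕ) : ∃ r : ℕ, n * phi m n = r ^ m :=
  (Nat.sInf_mem (exists_phi_spec hm n)).2

theorem phi_le {m n k r : ℕ} (hk : 0 < k) (h : n * k = r ^ m) : phi m n ≤ k :=
  Nat.sInf_le ⟨hk, r, h⟩

theorem phi_zero {m : ℕ} (hm : m ≠ 0) : phi m 0 = 1 :=
  le_antisymm (phi_le one_pos (r := 0) (by simp [hm])) (phi_pos hm 0)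

theorem phi_one (n : ℕ) : phi 1 n = 1 :=
  le_antisymm (phi_le one_pos (r := n) (by simp)) (phi_pos one_ne_zero n)

theorem one_le_prod_phi {n : ℕ} {m : Fin n → ℕ} (hm : ∀ i, 2 ≤ m i) (k : Fin n → ℕ) :
    (1 : ℝ) ≤ ∏ i, (phi (m i) (k i) : ℝ) ^ (1 / (m i : ℝ)) := by
  refine Finset.prod_induction _ (1 ≤ ·) (fun _ _ => one_le_mul_of_one_le_of_one_le) le_rfl
    fun i _ => Real.one_le_rpow ?_ (by positivity)
  have hi := hm i
  exact_mod_cast phi_pos (by omega) _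

/-- Comparison of the local factors of the height for different multiplicities. -/
theorem phi_rpow_le {m m' k : ℕ} (hm' : 1 ≤ m') (h : m' ≤ m) {B E : ℝ} (hE : 1 ≤ E)
    (hB : 1 ≤ B) (hk : (k : ℝ) ≤ B) (hp : (phi m' k : ℝ) ≤ E) :
    (phi m k : ℝ) ^ (1 / (m : ℝ)) ≤ B ^ (1 / (m' : ℝ) - 1 / (m : ℝ)) * E := by
  have hm : 1 ≤ m := hm'.trans h
  have hm0 : (0 : ℝ) < m := by exact_mod_cast hm
  have hm0' : (0 : ℝ) < m' := by exact_mod_cast hm'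
  have he : 0 ≤ 1 / (m' : ℝ) - 1 / (m : ℝ) :=
    sub_nonneg.2 (one_div_le_one_div_of_le hm0' (by exact_mod_cast h))
  rcases Nat.eq_zero_or_pos k with rfl | hk0
  · rw [phi_zero (by omega), Nat.cast_one, Real.one_rpow]
    exact one_le_mul_of_one_le_of_one_le (Real.one_le_rpow hB he) hE
  obtain ⟨r, hr⟩ := exists_mul_phi_eq (m := m') (by omega) k
  have hr0 : 0 < r := by
    rcases Nat.eq_zero_or_pos r with rfl | h0
    · rw [zero_pow (by omega)] at hr
      exact absurd hr (Nat.mul_pos hk0 (phi_pos (by omega) k)).ne'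
    · exact h0
  -- From `k * phi m' k = r ^ m'` and `m' ≤ m` it follows that `k ∣ r ^ m`, so `r ^ m / k` is an
  -- upper bound for `phi m k`.
  obtain ⟨q, hq⟩ : k ∣ r ^ m := (Dvd.intro _ hr).trans (pow_dvd_pow r h)
  have hq0 : 0 < q := Nat.pos_of_ne_zero fun h0 => by
    rw [h0, mul_zero] at hq
    exact (pow_pos hr0 m).ne' hq
  have hk0' : (0 : ℝ) < k := by exact_mod_cast hk0
  have h1 : (phi m k : ℝ) ≤ (r : ℝ) ^ m / k := by
    rw [le_div_iff₀ hk0', mul_comm]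
    have := Nat.mul_le_mul_left k (phi_le hq0 hq.symm)
    rw [← hq] at this
    exact_mod_cast this
  have h2 : (r : ℝ) = ((k : ℝ) * phi m' k) ^ (1 / (m' : ℝ)) := by
    have : (k : ℝ) * phi m' k = (r : ℝ) ^ m' := by exact_mod_cast hr
    rw [this, ← Real.rpow_natCast, ← Real.rpow_mul (by positivity), mul_one_div_cancel hm0'.ne',
      Real.rpow_one]
  calc (phi m k : ℝ) ^ (1 / (m : ℝ)) ≤ ((r : ℝ) ^ m / k) ^ (1 / (m : ℝ)) := by gcongr
    _ = r / (k : ℝ) ^ (1 / (m : ℝ)) := by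
        rw [Real.div_rpow (by positivity) (by positivity), ← Real.rpow_natCast,
          ← Real.rpow_mul (by positivity), mul_one_div_cancel hm0.ne', Real.rpow_one]
    _ = (k : ℝ) ^ (1 / (m' : ℝ) - 1 / (m : ℝ)) * (phi m' k : ℝ) ^ (1 / (m' : ℝ)) := by
        rw [h2, Real.mul_rpow (by positivity) (by positivity), Real.rpow_sub hk0']
        ring
    _ ≤ B ^ (1 / (m' : ℝ) - 1 / (m : ℝ)) * E := by
        gcongr
        calc (phi m' k : ℝ) ^ (1 / (m' : ℝ)) ≤ E ^ (1 / (m' : ℝ)) := by gcongr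
          _ ≤ E ^ (1 : ℝ) := Real.rpow_le_rpow_of_exponent_le hE
              ((div_le_one hm0').2 (by exact_mod_cast hm'))
          _ = E := Real.rpow_one E

/-- The pairing of two vectors whose vanishing means that they are proportional. -/
def pairing (a v : Fin 2 → ℤ) : ℤ := a 0 * v 1 - a 1 * v 0

theorem coords_isCoprime (P : P1Q) : IsCoprime (coords P 0) (coords P 1) :=
  (exists_coprime_coords P).choose_spec.1

theorem exists_rep_eq (P : P1Q) : ∃ c : ℚ, c ≠ 0 ∧ ∀ i, P.rep i = c * (coords P i : ℚ) :=
  (exists_coprime_coords P).choose_spec.2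

theorem coords_injective : Function.Injective coords := by
  intro P Q h
  obtain ⟨c, hc, hP⟩ := exists_rep_eq P
  obtain ⟨d, hd, hQ⟩ := exists_rep_eq Q
  rw [← P.mk_rep, ← Q.mk_rep, Projectivization.mk_eq_mk_iff']
  refine ⟨c / d, funext fun i => ?_⟩
  rw [Pi.smul_apply, smul_eq_mul, hP, hQ, h]
  field_simp

theorem exists_eq_mul_coords {v : Fin 2 → ℤ} (hv : v ≠ 0) :
    ∃ (P : P1Q) (g : ℤ), g ≠ 0 ∧ ∀ i, v i = g * coords P i := by
  have hv' : (fun i => (v i : ℚ)) ≠ 0 := fun h => hv (funext fun i => by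
    simpa using congrFun h i)
  obtain ⟨u, hu⟩ := Projectivization.exists_smul_eq_mk_rep ℚ _ hv'
  set P := Projectivization.mk ℚ _ hv' with hP
  obtain ⟨c, hc, hPc⟩ := exists_rep_eq P
  have h1 : ∀ i, (v i : ℚ) = c / u * coords P i := fun i => by
    have := congrFun hu i
    rw [hPc, Pi.smul_apply, Units.smul_def, smul_eq_mul] at this
    have hu0 : (u : ℚ) ≠ 0 := u.ne_zero
    field_simp
    linarith
  obtain ⟨x, y, hxy⟩ := coords_isCoprime P
  have h2 : c / u = ((x * v 0 + y * v 1 : ℤ) : ℚ) := by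
    push_cast
    rw [h1, h1]
    have : ((x * coords P 0 + y * coords P 1 : ℤ) : ℚ) = 1 := by rw [hxy, Int.cast_one]
    push_cast at this
    linear_combination (- (c / u)) * this
  have h3 : ∀ i, v i = (x * v 0 + y * v 1) * coords P i := fun i => by
    have := h1 i
    rw [h2] at this
    exact_mod_cast this
  refine ⟨P, _, fun h => hv (funext fun i => ?_), h3⟩
  rw [h3, h, zero_mul, Pi.zero_apply]

theorem pairing_coords_ne_zero {P Q : P1Q} (h : P ≠ Q) : pairing (coords P) (coords Q) ≠ 0 := by
  intro h0
  obtain ⟨c, hc, hP⟩ := exists_rep_eq P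
  obtain ⟨d, hd, hQ⟩ := exists_rep_eq Q
  apply h
  obtain ⟨x, y, hxy⟩ := coords_isCoprime Q
  have h1 : ∀ i, coords P i = (x * coords P 0 + y * coords P 1) * coords Q i := by
    have h0' : coords P 0 * coords Q 1 = coords P 1 * coords Q 0 := sub_eq_zero.1 h0
    intro i
    fin_cases i
    · change coords P 0 = (x * coords P 0 + y * coords P 1) * coords Q 0
      linear_combination (- coords P 0) * hxy + y * h0'
    · change coords P 1 = (x * coords P 0 + y * coords P 1) * coords Q 1
      linear_combination (- coords P 1) * hxy - x * h0'
  rw [← P.mk_rep, ← Q.mk_rep, Projectivization.mk_eq_mk_iff']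
  refine ⟨c * ((x * coords P 0 + y * coords P 1 : ℤ) : ℚ) / d, funext fun i => ?_⟩
  rw [Pi.smul_apply, smul_eq_mul, hP, hQ, h1 i]
  push_cast
  field_simp

/-- Vectors with content bounded by `G` suffice, since dividing by the content `g` only replaces the
cofactor `e` by `g e`. If the set were finite, all pairings would be bounded, against the choice of
`N`. -/
theorem infinite_setOf_phi_le {k : ℕ} (b : Fin k → P1Q) (M : Fin k → ℕ) {G E : ℕ}
    (h : ∀ N : ℕ, ∃ v : Fin 2 → ℤ, (∀ d : ℤ, d ∣ v 0 → d ∣ v 1 → d.natAbs ≤ G) ∧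
      (∃ j, N ≤ (pairing (coords (b j)) v).natAbs) ∧
      ∀ j, ∃ e s : ℤ, e ≠ 0 ∧ e.natAbs ≤ E ∧ pairing (coords (b j)) v * e = s ^ M j) :
    {P : P1Q | ∀ j, phi (M j) (pairing (coords (b j)) (coords P)).natAbs ≤ G * E}.Infinite := by
  intro hfin
  obtain ⟨B, hB⟩ := (hfin.image fun P =>
    ∑ j, (pairing (coords (b j)) (coords P)).natAbs).bddAbove
  obtain ⟨v, hd, ⟨j, hj⟩, hv⟩ := h (G * B + 1)
  have hv0 : v ≠ 0 := by
    rintro rfl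
    have := hd (G + 1) (dvd_zero _) (dvd_zero _)
    omega
  obtain ⟨P, g, hg, hP⟩ := exists_eq_mul_coords hv0
  have hgG : g.natAbs ≤ G := hd g (Dvd.intro _ (hP 0).symm) (Dvd.intro _ (hP 1).symm)
  have hpair : ∀ a : Fin 2 → ℤ, pairing a v = g * pairing a (coords P) := fun a => by
    unfold pairing
    rw [hP, hP]
    ring
  have hmem : P ∈ {P : P1Q | ∀ j, phi (M j) (pairing (coords (b j)) (coords P)).natAbs ≤ G * E} := by
    intro i
    obtain ⟨e, s, he, heE, hes⟩ := hv i
    refine (phi_le (k := g.natAbs * e.natAbs) (r := s.natAbs) ?_ ?_).trans (Nat.mul_le_mul hgG heE)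
    · exact Nat.mul_pos (Int.natAbs_pos.2 hg) (Int.natAbs_pos.2 he)
    · rw [← Int.natAbs_pow, ← hes, hpair, Int.natAbs_mul, Int.natAbs_mul]
      ring
  have h1 := hB ⟨P, hmem, rfl⟩
  have h2 : (pairing (coords (b j)) (coords P)).natAbs ≤ B :=
    (Finset.single_le_sum (f := fun j => (pairing (coords (b j)) (coords P)).natAbs)
      (fun _ _ => Nat.zero_le _) (Finset.mem_univ j)).trans h1
  rw [hpair, Int.natAbs_mul] at hj
  have := Nat.mul_le_mul hgG h2
  omega

theorem one_le_max_abs_coords (P : P1Q) : (1 : ℝ) ≤ max |(coords P 0 : ℝ)| |(coords P 1 : ℝ)| := by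
  have h : coords P 0 ≠ 0 ∨ coords P 1 ≠ 0 := by
    by_contra! h
    have := coords_isCoprime P
    rw [h.1, h.2] at this
    exact not_isCoprime_zero_zero this
  rcases h with h | h
  · exact le_max_of_le_left (by exact_mod_cast Int.one_le_abs h)
  · exact le_max_of_le_right (by exact_mod_cast Int.one_le_abs h)

/-- The anti-canonical height is bounded on the points that are nearly integral for smaller
multiplicities of Euler characteristic `0`. -/
theorem exists_antiCanHeight_le {n : ℕ} (a : Fin n → P1Q) {m m' : Fin n → ℕ}
    (hm' : ∀ i, 1 ≤ m' i) (h : ∀ i, m' i ≤ m i) (h0 : eulerChar m' = 0) (E : ℕ) :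
    ∃ T : ℝ, ∀ P : P1Q, (∀ i, phi (m' i) (pairing (coords (a i)) (coords P)).natAbs ≤ E) →
      antiCanHeight a m P ≤ T := by
  set K : ℝ := 1 + ∑ i, (|(coords (a i) 0 : ℝ)| + |(coords (a i) 1 : ℝ)|) with hK
  have hK1 : 1 ≤ K := le_add_of_nonneg_right (Finset.sum_nonneg fun i _ => by positivity)
  refine ⟨∏ i, (K ^ (1 / (m' i : ℝ) - 1 / (m i : ℝ)) * (max 1 E : ℝ)), fun P hP => ?_⟩
  set B := max |(coords P 0 : ℝ)| |(coords P 1 : ℝ)| with hB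
  have hB1 : 1 ≤ B := one_le_max_abs_coords P
  have hB0 : 0 < B := zero_lt_one.trans_le hB1
  have h1 : ∀ i, (phi (m i) (pairing (coords (a i)) (coords P)).natAbs : ℝ) ^ (1 / (m i : ℝ)) ≤
      (K * B) ^ (1 / (m' i : ℝ) - 1 / (m i : ℝ)) * (max 1 E : ℝ) := by
    intro i
    refine phi_rpow_le (hm' i) (h i) (le_max_left _ _) (one_le_mul_of_one_le_of_one_le hK1 hB1) ?_
      (le_max_of_le_right (by exact_mod_cast hP i))
    have h2 : (((pairing (coords (a i)) (coords P)).natAbs : ℕ) : ℝ) =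
        |(coords (a i) 0 : ℝ) * coords P 1 - coords (a i) 1 * coords P 0| := by
      rw [Nat.cast_natAbs, Int.cast_abs, pairing]
      push_cast
      rfl
    rw [h2]
    calc _ ≤ |(coords (a i) 0 : ℝ) * coords P 1| + |(coords (a i) 1 : ℝ) * coords P 0| := abs_sub _ _
      _ = |(coords (a i) 0 : ℝ)| * |(coords P 1 : ℝ)| + |(coords (a i) 1 : ℝ)| * |(coords P 0 : ℝ)| := by
          rw [abs_mul, abs_mul]
      _ ≤ |(coords (a i) 0 : ℝ)| * B + |(coords (a i) 1 : ℝ)| * B := by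
          gcongr
          · exact le_max_right _ _
          · exact le_max_left _ _
      _ = (|(coords (a i) 0 : ℝ)| + |(coords (a i) 1 : ℝ)|) * B := by ring
      _ ≤ K * B := by
          gcongr
          have := Finset.single_le_sum (f := fun i => |(coords (a i) 0 : ℝ)| + |(coords (a i) 1 : ℝ)|)
            (fun i _ => by positivity) (Finset.mem_univ i)
          linarith
  -- The exponents of `B` add up to the Euler characteristic of `m'`, which is zero.
  have h3 : eulerChar m + ∑ i, (1 / (m' i : ℝ) - 1 / (m i : ℝ)) = 0 := by
    rw [← h0, eulerChar, eulerChar, sub_add_eq_add_sub, add_sub_assoc, ← Finset.sum_sub_distrib,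
      sub_eq_add_neg, ← Finset.sum_neg_distrib]
    congr 1
    exact Finset.sum_congr rfl fun i _ => by ring
  calc antiCanHeight a m P ≤ B ^ eulerChar m *
        ∏ i, ((K * B) ^ (1 / (m' i : ℝ) - 1 / (m i : ℝ)) * (max 1 E : ℝ)) := by
        unfold antiCanHeight
        exact mul_le_mul_of_nonneg_left (Finset.prod_le_prod (fun i _ => by positivity)
          fun i _ => h1 i) (by positivity)
    _ = B ^ (eulerChar m + ∑ i, (1 / (m' i : ℝ) - 1 / (m i : ℝ))) *
        ∏ i, (K ^ (1 / (m' i : ℝ) - 1 / (m i : ℝ)) * (max 1 E : ℝ)) := by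
        rw [Real.rpow_add hB0, Real.rpow_sum_of_pos hB0, mul_assoc, ← Finset.prod_mul_distrib]
        congr 1
        refine Finset.prod_congr rfl fun i _ => ?_
        rw [Real.mul_rpow (by positivity) hB0.le]
        ring
    _ = _ := by rw [h3, Real.rpow_zero, one_mul]

/-- The local factors are at least `1`, so the height dominates a positive power of the largest
coordinate. -/
theorem northcott_antiCanHeight {n : ℕ} (a : Fin n → P1Q) {m : Fin n → ℕ} (hm : ∀ i, 2 ≤ m i)
    (h : 0 < eulerChar m) : Northcott (antiCanHeight a m) := by
  refine ⟨fun T => ?_⟩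
  obtain ⟨B, hB⟩ := exists_nat_ge (T ^ (eulerChar m)⁻¹)
  refine ((Set.Finite.pi' fun _ : Fin 2 => Set.finite_Icc (-(B : ℤ)) B).preimage
    coords_injective.injOn).subset ?_
  intro P hP
  have h1 : (max |(coords P 0 : ℝ)| |(coords P 1 : ℝ)|) ^ eulerChar m ≤ T :=
    (le_mul_of_one_le_right (by positivity) (one_le_prod_phi hm _)).trans hP
  have h2 : max |(coords P 0 : ℝ)| |(coords P 1 : ℝ)| ≤ B := by
    refine le_trans ?_ hB
    rw [← Real.rpow_le_rpow_iff (by positivity) (Real.rpow_nonneg ((by positivity : (0:ℝ) ≤ _).trans h1) _) h,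
      ← Real.rpow_mul ((by positivity : (0:ℝ) ≤ _).trans h1), inv_mul_cancel₀ h.ne', Real.rpow_one]
    exact h1
  have h3 : ∀ i, |(coords P i : ℝ)| ≤ B := by
    intro i
    fin_cases i
    · exact (le_max_left _ _).trans h2
    · exact (le_max_right _ _).trans h2
  intro i
  rw [Set.mem_Icc, ← abs_le]
  exact_mod_cast h3 i

end
end StackyCurve

/-! ### Diophantine equations solved by duplication on curves of genus one -/

namespace StackyCurve
noncomputable section

/-- Coprime solutions of `u ^ 3 + v ^ 3 = 19 * w ^ 3`. -/
theorem exists_cubes (n : ℕ) : ∃ u v w : ℤ, u ^ 3 + v ^ 3 = 19 * w ^ 3 ∧ IsCoprime u v ∧ Odd u ∧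
    Odd v ∧ 3 ∣ u ∧ w ≠ 0 ∧ 2 ^ n ∣ w := by
  induction n with
  | zero => exact ⟨3, 5, 2, by norm_num, ⟨2, -1, by norm_num⟩, by decide, by decide, by decide,
      by decide, one_dvd _⟩
  | succ n ih =>
    obtain ⟨u, v, w, h, hc, hu, hv, h3, hw, hn⟩ := ih
    have hu3 := hu.pow (n := 3)
    have hv3 := hv.pow (n := 3)
    have h3v : IsCoprime (3 : ℤ) v := hc.of_isCoprime_of_dvd_left h3
    have hprime : Prime (3 : ℤ) := Int.prime_three
    have hne : u ^ 3 - v ^ 3 ≠ 0 := by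
      intro h0
      have h1 : u = v := (Odd.strictMono_pow (n := 3) (by decide)).injective (sub_eq_zero.1 h0)
      rw [← h1] at h3v
      exact hprime.not_isUnit (h3v.isUnit_of_dvd' dvd_rfl h3)
    -- This is the third intersection of the tangent with the cubic. As `u` and `v` are odd, `u ^ 3
    -- - v ^ 3` contributes a factor `2`; the condition `3 ∣ u` excludes the only possible common
    -- factor `3` of `u ^ 3 + 2 * v ^ 3` and `2 * u ^ 3 + v ^ 3`.
    refine ⟨u * (u ^ 3 + 2 * v ^ 3), -(v * (2 * u ^ 3 + v ^ 3)), w * (u ^ 3 - v ^ 3), ?_, ?_, ?_, ?_,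
      h3.mul_right _, mul_ne_zero hw hne, ?_⟩
    · linear_combination ((u ^ 3 - v ^ 3) ^ 3) * h
    · rw [IsCoprime.neg_right_iff]
      have e1 : IsCoprime u (2 * u ^ 3 + v ^ 3) := by
        have : IsCoprime u (v ^ 3 + u * (2 * u ^ 2)) := hc.pow_right.add_mul_left_right _
        convert this using 1
        ring
      have e2 : IsCoprime (u ^ 3 + 2 * v ^ 3) v := by
        have : IsCoprime (u ^ 3 + v * (2 * v ^ 2)) v := hc.pow_left.add_mul_left_left _
        convert this using 1
        ring
      have e3 : IsCoprime (u ^ 3 + 2 * v ^ 3) (2 * u ^ 3 + v ^ 3) := by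
        have e4 : IsCoprime (2 * u ^ 3 + v ^ 3) 3 := by
          have : IsCoprime (v ^ 3 + u * (2 * u ^ 2)) 3 := by
            obtain ⟨c, hc'⟩ := h3
            have : IsCoprime (v ^ 3 + 3 * (c * (2 * u ^ 2))) 3 :=
              h3v.symm.pow_left.add_mul_left_left _
            convert this using 1
            rw [hc']
            ring
          convert this using 1
          ring
        have e5 : IsCoprime (2 * u ^ 3 + v ^ 3) (3 * v ^ 3) := by
          refine e4.mul_right (IsCoprime.pow_right ?_)
          have : IsCoprime (2 * u ^ 3 + v * v ^ 2) v :=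
            IsCoprime.add_mul_left_left (IsCoprime.mul_left ?_ hc.pow_left) _
          · convert this using 1
            ring
          · exact Int.isCoprime_two_left.2 hv
        have : IsCoprime (2 * (u ^ 3 + 2 * v ^ 3)) (2 * u ^ 3 + v ^ 3) := by
          have : IsCoprime (3 * v ^ 3 + (2 * u ^ 3 + v ^ 3) * 1) (2 * u ^ 3 + v ^ 3) :=
            e5.symm.add_mul_left_left _
          convert this using 1
          ring
        exact this.of_mul_left_right
      exact (hc.mul_right e1).mul_left (e2.mul_right e3)
    · exact hu.mul (hu3.add_even (even_two_mul _))
    · exact (hv.mul ((even_two_mul _).add_odd hv3)).neg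
    · rw [pow_succ]
      exact mul_dvd_mul hn (hu3.sub_odd hv3).two_dvd

/-- Coprime solutions of `u ^ 4 + 8 * v ^ 4 = w ^ 2`. -/
theorem exists_fourth_powers (n : ℕ) : ∃ u v w : ℤ, u ^ 4 + 8 * v ^ 4 = w ^ 2 ∧ IsCoprime u v ∧
    Odd u ∧ v ≠ 0 ∧ 2 ^ n ∣ v := by
  induction n with
  | zero => exact ⟨1, 1, 3, by norm_num, isCoprime_one_left, by decide, by decide, one_dvd _⟩
  | succ n ih =>
    obtain ⟨u, v, w, h, hc, hu, hv, hn⟩ := ih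
    have h8 : Even (8 * v ^ 4) := ⟨4 * v ^ 4, by ring⟩
    have hw : Odd w := by
      have : Odd (w ^ 2) := h ▸ hu.pow.add_even h8
      exact (Int.odd_pow.1 this).resolve_right (by decide)
    have hu' : Odd (u ^ 4 - 8 * v ^ 4) := hu.pow.sub_even h8
    have h2u := Int.isCoprime_two_left.2 hu
    -- With `a = u ^ 4` and `b = 8 * v ^ 4` this duplication formula is the identity `(a - b) ^ 4 +
    -- 16 * a * b * (a + b) ^ 2 = ((a + b) ^ 2 + 4 * a * b) ^ 2`.
    refine ⟨u ^ 4 - 8 * v ^ 4, 2 * u * v * w, w ^ 4 + 32 * (u * v) ^ 4, ?_, ?_, hu', ?_, ?_⟩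
    · have h4 : w ^ 4 = (u ^ 4 + 8 * v ^ 4) ^ 2 := by rw [h]; ring
      rw [mul_pow _ w, h4]
      ring
    · have e1 : IsCoprime (u ^ 4 - 8 * v ^ 4) u := by
        have : IsCoprime (-(2 ^ 3 * v ^ 4) + u * u ^ 3) u :=
          (IsCoprime.mul_left h2u.pow_left hc.symm.pow_left).neg_left.add_mul_left_left _
        convert this using 1
        ring
      have e2 : IsCoprime (u ^ 4 - 8 * v ^ 4) v := by
        have : IsCoprime (u ^ 4 + v * (- 8 * v ^ 3)) v := hc.pow_left.add_mul_left_left _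
        convert this using 1
        ring
      have e3 : IsCoprime (u ^ 4 - 8 * v ^ 4) w := by
        have h1 : IsCoprime (u ^ 4 - 8 * v ^ 4) (u ^ 4 + 8 * v ^ 4) := by
          have h2 : IsCoprime (u ^ 4 - 8 * v ^ 4) (2 * u ^ 4) :=
            (Int.isCoprime_two_right.2 hu').mul_right e1.pow_right
          have : IsCoprime (u ^ 4 - 8 * v ^ 4) (2 * u ^ 4 + (u ^ 4 - 8 * v ^ 4) * (-1)) :=
            h2.add_mul_left_right _
          convert this using 1
          ring
        rw [h] at h1
        exact (IsCoprime.pow_right_iff two_pos).1 h1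
      exact (((Int.isCoprime_two_right.2 hu').mul_right e1).mul_right e2).mul_right e3
    · have hu0 : u ≠ 0 := by rintro rfl; exact absurd hu (by decide)
      have hw0 : w ≠ 0 := by rintro rfl; exact absurd hw (by decide)
      exact mul_ne_zero (mul_ne_zero (mul_ne_zero two_ne_zero hu0) hv) hw0
    · obtain ⟨c, rfl⟩ := hn
      exact ⟨u * c * w, by ring⟩

/-- Near-solutions of a quadruple square condition. -/
theorem exists_four_squares (b c : ℤ) (n : ℕ) : ∃ x y β γ : ℤ, IsCoprime x y ∧ Odd x ∧ y ≠ 0 ∧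
    2 ^ (n + 1) ∣ y ∧ x ^ 2 - b * (2 * (1 - 2 * b) * (1 - 2 * c) * y ^ 2) = β ^ 2 ∧
      x ^ 2 - c * (2 * (1 - 2 * b) * (1 - 2 * c) * y ^ 2) = γ ^ 2 := by
  induction n with
  | zero =>
    -- The factor `d = 2 * (1 - 2 * b) * (1 - 2 * c)` gives the twist `d s ^ 2 = t (t - b) (t - c)`
    -- the rational point `t = 1 / 2`, `s = 1 / 4`. Doubling it yields `t = x ^ 2 / (d y ^ 2)` with
    -- `x = 1 - 4 * b * c` and `y = 2`.
    have hx : Odd (1 - 4 * b * c) := ⟨- 2 * b * c, by ring⟩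
    exact ⟨1 - 4 * b * c, 2, 1 - 4 * b + 4 * b * c, 1 - 4 * c + 4 * b * c,
      Int.isCoprime_two_right.2 hx, hx, two_ne_zero, dvd_rfl, by ring, by ring⟩
  | succ n ih =>
    obtain ⟨x, y, β, γ, hc, hx, hy, hn, hβ, hγ⟩ := ih
    set d := 2 * (1 - 2 * b) * (1 - 2 * c) with hd
    have hd2 : Even d := ⟨(1 - 2 * b) * (1 - 2 * c), by rw [hd]; ring⟩
    have hodd : ∀ q r : ℤ, x ^ 2 - q * (d * y ^ 2) = r ^ 2 → Odd r := fun q r hr => by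
      have : Odd (r ^ 2) := hr ▸ hx.pow.sub_even ((hd2.mul_right _).mul_left _)
      exact (Int.odd_pow.1 this).resolve_right (by decide)
    have hne : ∀ r : ℤ, Odd r → r ≠ 0 := by
      rintro _ hr rfl
      exact absurd hr (by decide)
    -- Duplication on the same curve: the double of the point with `t = x ^ 2 / (d y ^ 2)` has
    -- `t`-coordinate `X ^ 2 / (d Y ^ 2)`.
    set X := x ^ 4 - b * c * (d * y ^ 2) ^ 2 with hX
    set Y := 2 * x * y * β * γ with hY
    have hXo : Odd X := hx.pow.sub_even (((hd2.mul_right _).pow_of_ne_zero two_ne_zero).mul_left _)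
    have hY0 : Y ≠ 0 := mul_ne_zero (mul_ne_zero (mul_ne_zero (mul_ne_zero two_ne_zero (hne _ hx)) hy)
      (hne _ (hodd _ _ hβ))) (hne _ (hodd _ _ hγ))
    have hYn : 2 ^ (n + 1 + 1) ∣ Y := by
      obtain ⟨k, hk⟩ := hn
      exact ⟨x * k * β * γ, by rw [hY, hk]; ring⟩
    have hB : X ^ 2 - b * (d * Y ^ 2) = (x ^ 4 - 2 * b * x ^ 2 * (d * y ^ 2) + b * c * (d * y ^ 2) ^ 2) ^ 2 := by
      have : Y ^ 2 = 4 * x ^ 2 * y ^ 2 * (x ^ 2 - b * (d * y ^ 2)) * (x ^ 2 - c * (d * y ^ 2)) := by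
        rw [hβ, hγ, hY]; ring
      rw [this, hX]
      ring
    have hC : X ^ 2 - c * (d * Y ^ 2) = (x ^ 4 - 2 * c * x ^ 2 * (d * y ^ 2) + b * c * (d * y ^ 2) ^ 2) ^ 2 := by
      have : Y ^ 2 = 4 * x ^ 2 * y ^ 2 * (x ^ 2 - b * (d * y ^ 2)) * (x ^ 2 - c * (d * y ^ 2)) := by
        rw [hβ, hγ, hY]; ring
      rw [this, hX]
      ring
    -- The greatest common divisor is odd because `X` is, so dividing by it keeps the power of `2`
    -- in `Y`.
    obtain ⟨g, X', Y', hg, hXY, hX', hY'⟩ : ∃ g X' Y' : ℤ, g ≠ 0 ∧ IsCoprime X' Y' ∧ X = g * X' ∧ Y = g * Y' := by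
      have hg0 : 0 < Int.gcd X Y := Int.gcd_pos_of_ne_zero_right _ hY0
      obtain ⟨X', Y', h1, h2, h3⟩ := Int.exists_gcd_one hg0
      refine ⟨Int.gcd X Y, X', Y', by exact_mod_cast hg0.ne', Int.isCoprime_iff_gcd_eq_one.2 h1, ?_, ?_⟩
      · rw [mul_comm]; exact h2
      · rw [mul_comm]; exact h3
    have hgo : Odd g := by
      rw [hX'] at hXo
      exact (Int.odd_mul.1 hXo).1
    have hdiv : ∀ q r : ℤ, X ^ 2 - q * (d * Y ^ 2) = r ^ 2 → ∃ s, X' ^ 2 - q * (d * Y' ^ 2) = s ^ 2 := by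
      intro q r hr
      have h1 : g ^ 2 * (X' ^ 2 - q * (d * Y' ^ 2)) = r ^ 2 := by
        rw [← hr, hX', hY']
        ring
      obtain ⟨s, hs⟩ := (Int.pow_dvd_pow_iff two_ne_zero).1 (Dvd.intro _ h1)
      refine ⟨s, mul_left_cancel₀ (pow_ne_zero 2 hg) ?_⟩
      rw [h1, hs]
      ring
    obtain ⟨β', hβ'⟩ := hdiv _ _ hB
    obtain ⟨γ', hγ'⟩ := hdiv _ _ hC
    refine ⟨X', Y', β', γ', hXY, ?_, ?_, ?_, hβ', hγ'⟩
    · rw [hX'] at hXo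
      exact (Int.odd_mul.1 hXo).2
    · rintro rfl
      rw [mul_zero] at hY'
      exact hY0 hY'
    · rw [hY'] at hYn
      exact (IsCoprime.pow_left (Int.isCoprime_two_left.2 hgo)).dvd_of_dvd_mul_left hYn

end
end StackyCurve

/-! ### From solutions to points with nearly perfect powers -/

namespace StackyCurve
noncomputable section

/-- A common divisor of the coordinates of `v` divides `c i₀ * c j₀ * g`, and the cofactor `c j ^ (M
j - 1)` completes the constant `c j` to an `M j`-th power. -/
theorem exists_infinite_phi_le {k : ℕ} (b : Fin k → P1Q) (M : Fin k → ℕ) (hM : ∀ j, 1 ≤ M j)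
    (c : Fin k → ℤ) (hc : ∀ j, c j ≠ 0) {g : ℤ} (hg : g ≠ 0) (i₀ j₀ : Fin k) (E : ℕ)
    (h : ∀ N : ℕ, ∃ (v : Fin 2 → ℤ) (A : Fin k → ℤ), (∀ j, pairing (coords (b j)) v = c j * A j) ∧
      (∃ x y, x * A i₀ + y * A j₀ = g) ∧ (∃ j, N ≤ (A j).natAbs) ∧
      ∀ j, ∃ e s : ℤ, e ≠ 0 ∧ e.natAbs ≤ E ∧ A j * e = s ^ M j) :
    ∃ E', {P : P1Q | ∀ j, phi (M j) (pairing (coords (b j)) (coords P)).natAbs ≤ E'}.Infinite := by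
  refine ⟨_, infinite_setOf_phi_le b M (G := (c i₀ * c j₀ * g).natAbs)
    (E := ∑ j, (c j).natAbs ^ (M j - 1) * E) fun N => ?_⟩
  obtain ⟨v, A, hv, ⟨x, y, hxy⟩, ⟨j, hj⟩, hA⟩ := h N
  refine ⟨v, fun d h0 h1 => ?_, ⟨j, ?_⟩, fun j => ?_⟩
  · have hd : ∀ j, d ∣ c j * A j := fun j => by
      rw [← hv]
      exact dvd_sub (h1.mul_left _) (h0.mul_left _)
    refine Nat.le_of_dvd (Int.natAbs_pos.2 (mul_ne_zero (mul_ne_zero (hc _) (hc _)) hg))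
      (Int.natAbs_dvd_natAbs.2 ?_)
    have : c i₀ * c j₀ * g = c j₀ * x * (c i₀ * A i₀) + c i₀ * y * (c j₀ * A j₀) := by
      rw [← hxy]
      ring
    rw [this]
    exact dvd_add ((hd _).mul_left _) ((hd _).mul_left _)
  · rw [hv, Int.natAbs_mul]
    exact hj.trans (Nat.le_mul_of_pos_left _ (Int.natAbs_pos.2 (hc j)))
  · obtain ⟨e, s, he, heE, hes⟩ := hA j
    refine ⟨c j ^ (M j - 1) * e, c j * s, mul_ne_zero (pow_ne_zero _ (hc j)) he, ?_, ?_⟩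
    · rw [Int.natAbs_mul, Int.natAbs_pow]
      exact (Nat.mul_le_mul_left _ heE).trans (Finset.single_le_sum
        (f := fun j => (c j).natAbs ^ (M j - 1) * E) (fun _ _ => Nat.zero_le _) (Finset.mem_univ j))
    · rw [hv, mul_pow, ← hes]
      conv_rhs => rw [← Nat.sub_add_cancel (hM j), pow_succ]
      ring

/-- Three vectors in the plane are linearly dependent, so the pairings with them satisfy one
relation; scaled by suitable products of mutual pairings it becomes `A 0 + A 1 + A 2 = 0`. -/
theorem exists_infinite_phi_le_of_three (b : Fin 3 → P1Q) (hb : Function.Injective b) (M : Fin 3 → ℕ)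
    (hM : ∀ j, 1 ≤ M j) {g : ℤ} (hg : g ≠ 0) (E : ℕ)
    (h : ∀ N : ℕ, ∃ A : Fin 3 → ℤ, A 0 + A 1 + A 2 = 0 ∧ (∃ x y, x * A 0 + y * A 1 = g) ∧
      (∃ j, N ≤ (A j).natAbs) ∧ ∀ j, ∃ e s : ℤ, e ≠ 0 ∧ e.natAbs ≤ E ∧ A j * e = s ^ M j) :
    ∃ E', {P : P1Q | ∀ j, phi (M j) (pairing (coords (b j)) (coords P)).natAbs ≤ E'}.Infinite := by
  have hne : ∀ i j, i ≠ j → pairing (coords (b i)) (coords (b j)) ≠ 0 := fun i j hij =>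
    pairing_coords_ne_zero (hb.ne hij)
  set a := fun j => coords (b j) with ha
  refine exists_infinite_phi_le b M hM
    ![pairing (a 2) (a 0) * pairing (a 0) (a 1), pairing (a 1) (a 2) * pairing (a 0) (a 1),
      pairing (a 1) (a 2) * pairing (a 2) (a 0)] ?_ hg 0 1 E fun N => ?_
  · intro j
    fin_cases j <;> exact mul_ne_zero (hne _ _ (by decide)) (hne _ _ (by decide))
  · obtain ⟨A, hA0, hxy, hN, hA⟩ := h N
    refine ⟨fun i => - A 1 * pairing (a 1) (a 2) * a 0 i + A 0 * pairing (a 2) (a 0) * a 1 i, A,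
      fun j => ?_, hxy, hN, hA⟩
    have h2 : A 2 = - A 0 - A 1 := by linear_combination hA0
    fin_cases j
    · simp only [pairing, Fin.zero_eta, Matrix.cons_val_zero]
      change a 0 0 * _ - a 0 1 * _ = _
      ring
    · simp only [pairing, Fin.mk_one, Matrix.cons_val_one, Matrix.cons_val_zero]
      change a 1 0 * _ - a 1 1 * _ = _
      ring
    · simp only [pairing, Fin.reduceFinMk, Matrix.cons_val]
      change a 2 0 * _ - a 2 1 * _ = _
      rw [h2]
      ring

theorem le_natAbs_of_two_pow_dvd {N : ℕ} {y : ℤ} (hy : y ≠ 0) (h : 2 ^ N ∣ y) : N ≤ y.natAbs := by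
  have h1 := Nat.le_of_dvd (Int.natAbs_pos.2 hy) (Int.natAbs_dvd_natAbs.2 h)
  rw [Int.natAbs_pow] at h1
  exact Nat.lt_two_pow_self.le.trans h1

theorem natAbs_le_natAbs_mul_pow {y c : ℤ} (hc : c ≠ 0) {k : ℕ} (hk : k ≠ 0) :
    y.natAbs ≤ (c * y ^ k).natAbs := by
  rw [Int.natAbs_mul, Int.natAbs_pow]
  exact (Nat.le_self_pow hk _).trans (Nat.le_mul_of_pos_left _ (Int.natAbs_pos.2 hc))

/-- A combination of `a 3` and `a 0` with coefficients `x ^ 2` and a multiple of `d * y ^ 2` pairs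
with `a 0` and `a 3` to constants times `x ^ 2` and `d * y ^ 2`. For the chosen `p` and `q`, the
other two pairings are constants times the squares in `exists_four_squares`. -/
theorem exists_infinite_phi_le_of_four (b : Fin 4 → P1Q) (hb : Function.Injective b) :
    ∃ E', {P : P1Q | ∀ j, phi 2 (pairing (coords (b j)) (coords P)).natAbs ≤ E'}.Infinite := by
  have hne : ∀ i j, i ≠ j → pairing (coords (b i)) (coords (b j)) ≠ 0 := fun i j hij =>
    pairing_coords_ne_zero (hb.ne hij)
  set a := fun j => coords (b j) with ha
  set p := - (pairing (a 0) (a 1) * pairing (a 2) (a 3)) with hp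
  set q := - (pairing (a 0) (a 2) * pairing (a 1) (a 3)) with hq
  set d := 2 * (1 - 2 * p) * (1 - 2 * q) with hd
  have hd0 : d ≠ 0 := mul_ne_zero (mul_ne_zero two_ne_zero (by omega)) (by omega)
  refine exists_infinite_phi_le b (fun _ => 2) (fun _ => one_le_two)
    ![pairing (a 0) (a 3), pairing (a 1) (a 3), pairing (a 2) (a 3),
      pairing (a 1) (a 3) * pairing (a 2) (a 3) * pairing (a 0) (a 3)] ?_ hd0 0 3 (1 + d.natAbs)
      fun N => ?_
  · intro j
    fin_cases j
    · exact hne _ _ (by decide)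
    · exact hne _ _ (by decide)
    · exact hne _ _ (by decide)
    · exact mul_ne_zero (mul_ne_zero (hne _ _ (by decide)) (hne _ _ (by decide)))
        (hne _ _ (by decide))
  · obtain ⟨x, y, β, γ, hxy, -, hy, hN, hβ, hγ⟩ := exists_four_squares p q N
    rw [← hd] at hβ hγ
    refine ⟨fun i => x ^ 2 * a 3 i - pairing (a 1) (a 3) * pairing (a 2) (a 3) * (d * y ^ 2) * a 0 i,
      ![x ^ 2, β ^ 2, γ ^ 2, d * y ^ 2], fun j => ?_, ?_, ⟨3, ?_⟩, fun j => ?_⟩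
    · fin_cases j
      · simp only [pairing, Fin.zero_eta, Matrix.cons_val_zero]
        change a 0 0 * _ - a 0 1 * _ = _
        ring
      · simp only [Fin.mk_one, Matrix.cons_val_one, Matrix.cons_val_zero]
        rw [← hβ, hp]
        simp only [pairing]
        change a 1 0 * _ - a 1 1 * _ = _
        ring
      · simp only [Fin.reduceFinMk, Matrix.cons_val]
        rw [← hγ, hq]
        simp only [pairing]
        change a 2 0 * _ - a 2 1 * _ = _
        ring
      · simp only [pairing, Fin.reduceFinMk, Matrix.cons_val]
        change a 3 0 * _ - a 3 1 * _ = _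
        ring
    · obtain ⟨r, s, hrs⟩ : IsCoprime (x ^ 2) (y ^ 2) := hxy.pow
      exact ⟨d * r, s, by
        change d * r * x ^ 2 + s * (d * y ^ 2) = d
        linear_combination d * hrs⟩
    · exact (le_natAbs_of_two_pow_dvd hy ((pow_dvd_pow 2 (Nat.le_succ N)).trans hN)).trans
        (natAbs_le_natAbs_mul_pow hd0 two_ne_zero)
    · fin_cases j
      · exact ⟨1, x, one_ne_zero, by simp, mul_one _⟩
      · exact ⟨1, β, one_ne_zero, by simp, mul_one _⟩
      · exact ⟨1, γ, one_ne_zero, by simp, mul_one _⟩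
      · refine ⟨d, d * y, hd0, by omega, ?_⟩
        change d * y ^ 2 * d = (d * y) ^ 2
        ring

/-- The bound `361 = 19 ^ 2` is the cofactor that completes `19 * w ^ 3` to a cube. -/
theorem exists_infinite_phi_le_333 (b : Fin 3 → P1Q) (hb : Function.Injective b) :
    ∃ E', {P : P1Q | ∀ j, phi (![3, 3, 3] j) (pairing (coords (b j)) (coords P)).natAbs ≤
      E'}.Infinite := by
  refine exists_infinite_phi_le_of_three b hb _ (by decide) one_ne_zero 361 fun N => ?_
  obtain ⟨u, v, w, h, hc, -, -, -, hw, hN⟩ := exists_cubes N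
  obtain ⟨r, s, hrs⟩ : IsCoprime (u ^ 3) (v ^ 3) := hc.pow
  refine ⟨![u ^ 3, v ^ 3, -19 * w ^ 3], ?_, ⟨r, s, hrs⟩, ⟨2, ?_⟩, fun j => ?_⟩
  · change u ^ 3 + v ^ 3 + -19 * w ^ 3 = 0
    linear_combination h
  · exact (le_natAbs_of_two_pow_dvd hw hN).trans (natAbs_le_natAbs_mul_pow (by decide) (by decide))
  · fin_cases j
    · exact ⟨1, u, one_ne_zero, by decide, mul_one _⟩
    · exact ⟨1, v, one_ne_zero, by decide, mul_one _⟩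
    · refine ⟨361, -19 * w, by decide, by decide, ?_⟩
      change -19 * w ^ 3 * 361 = (-19 * w) ^ 3
      ring

theorem exists_infinite_phi_le_244 (b : Fin 3 → P1Q) (hb : Function.Injective b) :
    ∃ E', {P : P1Q | ∀ j, phi (![2, 4, 4] j) (pairing (coords (b j)) (coords P)).natAbs ≤
      E'}.Infinite := by
  refine exists_infinite_phi_le_of_three b hb _ (by decide) (g := 1) one_ne_zero 2 fun N => ?_
  obtain ⟨u, v, w, h, hc, hu, hv, hN⟩ := exists_fourth_powers N
  have h2u := Int.isCoprime_two_left.2 hu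
  obtain ⟨r, s, hrs⟩ : IsCoprime (u ^ 4) (2 ^ 3 * v ^ 4) :=
    (IsCoprime.mul_left h2u.pow_left hc.symm.pow_left).symm.pow_left
  refine ⟨![-w ^ 2, u ^ 4, 8 * v ^ 4], ?_, ⟨-s, r - s, ?_⟩, ⟨2, ?_⟩, fun j => ?_⟩
  · change -w ^ 2 + u ^ 4 + 8 * v ^ 4 = 0
    linear_combination h
  · change -s * -w ^ 2 + (r - s) * u ^ 4 = 1
    linear_combination hrs - s * h
  · exact (le_natAbs_of_two_pow_dvd hv hN).trans (natAbs_le_natAbs_mul_pow (by decide) (by decide))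
  · fin_cases j
    · exact ⟨-1, w, by decide, by decide, by change -w ^ 2 * -1 = w ^ 2; ring⟩
    · exact ⟨1, u, one_ne_zero, by decide, mul_one _⟩
    · exact ⟨2, 2 * v, by decide, by decide, by change 8 * v ^ 4 * 2 = (2 * v) ^ 4; ring⟩

/-- Squaring `u ^ 3 + v ^ 3 = 19 * w ^ 3` gives `(u ^ 3 - v ^ 3) ^ 2 + 4 * (u * v) ^ 3 = 19 ^ 2 * w
^ 6`, a relation between a square, a cube and a sixth power up to constants. -/
theorem exists_infinite_phi_le_236 (b : Fin 3 → P1Q) (hb : Function.Injective b) :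
    ∃ E', {P : P1Q | ∀ j, phi (![2, 3, 6] j) (pairing (coords (b j)) (coords P)).natAbs ≤
      E'}.Infinite := by
  refine exists_infinite_phi_le_of_three b hb _ (by decide) (g := 4) four_ne_zero (19 ^ 4) fun N => ?_
  obtain ⟨u, v, w, h, hc, -, -, -, hw, hN⟩ := exists_cubes N
  have hcw : IsCoprime (19 * w ^ 3) (u ^ 3 * v ^ 3) := by
    have h1 : IsCoprime (u ^ 3) (v ^ 3) := hc.pow
    rw [← h]
    refine IsCoprime.mul_right ?_ ?_
    · have := h1.symm.add_mul_left_left 1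
      rwa [mul_one, add_comm] at this
    · have := h1.add_mul_left_left 1
      rwa [mul_one] at this
  obtain ⟨r, s, hrs⟩ : IsCoprime ((19 * w ^ 3) ^ 2) (u ^ 3 * v ^ 3) := hcw.pow_left
  have h2 : (19 * w ^ 3) ^ 2 = (u ^ 3 - v ^ 3) ^ 2 + 4 * (u ^ 3 * v ^ 3) := by
    rw [← h]
    ring
  refine ⟨![-(u ^ 3 - v ^ 3) ^ 2, -4 * (u * v) ^ 3, 19 ^ 2 * w ^ 6], ?_, ⟨-4 * r, -(4 * r + s), ?_⟩,
    ⟨2, ?_⟩, fun j => ?_⟩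
  · change -(u ^ 3 - v ^ 3) ^ 2 + -4 * (u * v) ^ 3 + 19 ^ 2 * w ^ 6 = 0
    linear_combination h2
  · change -4 * r * -(u ^ 3 - v ^ 3) ^ 2 + -(4 * r + s) * (-4 * (u * v) ^ 3) = 4
    linear_combination 4 * hrs - 4 * r * h2
  · exact (le_natAbs_of_two_pow_dvd hw hN).trans (natAbs_le_natAbs_mul_pow (by decide) (by decide))
  · fin_cases j
    · exact ⟨-1, u ^ 3 - v ^ 3, by decide, by decide, by
        change -(u ^ 3 - v ^ 3) ^ 2 * -1 = (u ^ 3 - v ^ 3) ^ 2; ring⟩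
    · exact ⟨2, -2 * (u * v), by decide, by decide, by
        change -4 * (u * v) ^ 3 * 2 = (-2 * (u * v)) ^ 3; ring⟩
    · exact ⟨19 ^ 4, 19 * w, by decide, by decide, by
        change 19 ^ 2 * w ^ 6 * 19 ^ 4 = (19 * w) ^ 6; ring⟩

/-- Bounded anti-canonical height from a subset of the stacky points. -/
theorem infinite_setOf_antiCanHeight_le {n k : ℕ} (a : Fin n → P1Q) {m : Fin n → ℕ}
    (hm : ∀ i, 1 ≤ m i) {e : Fin k → Fin n} (he : Function.Injective e) {M : Fin k → ℕ}
    (hM : ∀ j, 1 ≤ M j) (hMm : ∀ j, M j ≤ m (e j)) (h0 : eulerChar M = 0)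
    (h : ∃ E, {P : P1Q | ∀ j, phi (M j) (pairing (coords (a (e j))) (coords P)).natAbs ≤ E}.Infinite) :
    ∃ T : ℝ, {P | antiCanHeight a m P ≤ T}.Infinite := by
  obtain ⟨E, hE⟩ := h
  -- Multiplicity `1` at the remaining points makes the local factor trivial and leaves the Euler
  -- characteristic unchanged.
  set m' : Fin n → ℕ := Function.extend e M fun _ => 1 with hm'
  have h1 : ∀ j, m' (e j) = M j := fun j => he.extend_apply _ _ _
  have h2 : ∀ i, (¬ ∃ j, e j = i) → m' i = 1 := fun i hi => Function.extend_apply' _ _ _ hi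
  have h3 : eulerChar m' = 0 := by
    rw [← h0, eulerChar, eulerChar]
    congr 1
    refine (Finset.sum_of_injOn e he.injOn (fun _ _ => Finset.mem_univ _) (fun i _ hi => ?_)
      fun j _ => by rw [h1]).symm
    rw [h2 i (by simpa using hi)]
    norm_num
  have h4 : ∀ i, 1 ≤ m' i ∧ m' i ≤ m i := fun i => by
    by_cases hi : ∃ j, e j = i
    · obtain ⟨j, rfl⟩ := hi
      rw [h1]
      exact ⟨hM j, hMm j⟩
    · rw [h2 i hi]
      exact ⟨le_rfl, hm i⟩
  obtain ⟨T, hT⟩ := exists_antiCanHeight_le a (fun i => (h4 i).1) (fun i => (h4 i).2) h3 (max 1 E)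
  refine ⟨T, hE.mono fun P hP => hT P fun i => ?_⟩
  by_cases hi : ∃ j, e j = i
  · obtain ⟨j, rfl⟩ := hi
    rw [h1]
    exact (hP j).trans (le_max_right _ _)
  · rw [h2 i hi, phi_one]
    exact le_max_left _ _

/-- Three multiplicities of nonpositive Euler characteristic dominate a Euclidean triple. -/
theorem exists_euclidean_triple {x y z : ℕ} (hx : 2 ≤ x) (hxy : x ≤ y) (hyz : y ≤ z)
    (h : (1 : ℝ) / x + 1 / y + 1 / z ≤ 1) :
    (3 ≤ x ∧ 3 ≤ y ∧ 3 ≤ z) ∨ (2 ≤ x ∧ 4 ≤ y ∧ 4 ≤ z) ∨ (2 ≤ x ∧ 3 ≤ y ∧ 6 ≤ z) := by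
  have hz0 : (0 : ℝ) < 1 / z := by
    have : (0 : ℝ) < z := by exact_mod_cast (by omega : 0 < z)
    positivity
  rcases lt_or_ge 2 x with h2 | h2
  · left; omega
  obtain rfl : x = 2 := le_antisymm h2 hx
  rcases lt_or_ge 3 y with h3 | h3
  · right; left; omega
  right; right
  have hy : y = 2 ∨ y = 3 := by omega
  rcases hy with rfl | rfl
  · norm_num at h
    linarith
  · refine ⟨le_rfl, le_rfl, ?_⟩
    by_contra h6
    have hz : z = 3 ∨ z = 4 ∨ z = 5 := by omega
    rcases hz with rfl | rfl | rfl <;> norm_num at h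

/-- Each stacky point lowers the Euler characteristic by less than `1`, so there are at least three.
Three sorted multiplicities dominate `(3, 3, 3)`, `(2, 4, 4)` or `(2, 3, 6)`; among more points,
four are taken with multiplicity `2`. -/
theorem exists_infinite_antiCanHeight_le {n : ℕ} (a : Fin n → P1Q) (ha : Function.Injective a)
    {m : Fin n → ℕ} (hm : ∀ i, 2 ≤ m i) (h : eulerChar m ≤ 0) :
    ∃ T : ℝ, {P | antiCanHeight a m P ≤ T}.Infinite := by
  have hm1 : ∀ i, 1 ≤ m i := fun i => one_le_two.trans (hm i)
  have hlt : (2 : ℝ) < n := by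
    have h1 : (2 : ℝ) ≤ ∑ i, (1 - 1 / (m i : ℝ)) := by
      unfold eulerChar at h
      linarith
    have hpos : ∀ i, (0 : ℝ) < 1 / (m i : ℝ) := fun i => by
      have : (0 : ℝ) < m i := by exact_mod_cast hm1 i
      positivity
    rcases Nat.eq_zero_or_pos n with rfl | hn
    · norm_num at h1
    · have h2 : ∑ i, (1 - 1 / (m i : ℝ)) < ∑ _i : Fin n, (1 : ℝ) :=
        Finset.sum_lt_sum_of_nonempty ⟨⟨0, hn⟩, Finset.mem_univ _⟩ fun i _ => by
          linarith [hpos i]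
      rw [Finset.sum_const, Finset.card_univ, Fintype.card_fin, nsmul_one] at h2
      linarith
  have hn : 3 ≤ n := by exact_mod_cast hlt
  rcases hn.eq_or_lt with rfl | h4
  · set σ := Tuple.sort m with hσ
    have hmono : Monotone (m ∘ σ) := Tuple.monotone_sort m
    have hsum : (1 : ℝ) / m (σ 0) + 1 / m (σ 1) + 1 / m (σ 2) ≤ 1 := by
      have h1 := Equiv.sum_comp σ fun i => (1 - 1 / (m i : ℝ))
      unfold eulerChar at h
      rw [← h1, Fin.sum_univ_three] at h
      linarith
    have hinj : Function.Injective fun j => a (σ j) := ha.comp σ.injective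
    rcases exists_euclidean_triple (hm _) (hmono (by decide : (0 : Fin 3) ≤ 1))
      (hmono (by decide : (1 : Fin 3) ≤ 2)) hsum with ⟨h0, h1, h2⟩ | ⟨h0, h1, h2⟩ | ⟨h0, h1, h2⟩
    · refine infinite_setOf_antiCanHeight_le a hm1 σ.injective (M := ![3, 3, 3]) (by decide) ?_ ?_
        (exists_infinite_phi_le_333 _ hinj)
      · intro j
        fin_cases j
        exacts [h0, h1, h2]
      · rw [eulerChar, Fin.sum_univ_three]
        change 2 - ((1 - 1 / ((3 : ℕ) : ℝ)) + (1 - 1 / ((3 : ℕ) : ℝ)) + (1 - 1 / ((3 : ℕ) : ℝ))) = 0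
        norm_num
    · refine infinite_setOf_antiCanHeight_le a hm1 σ.injective (M := ![2, 4, 4]) (by decide) ?_ ?_
        (exists_infinite_phi_le_244 _ hinj)
      · intro j
        fin_cases j
        exacts [h0, h1, h2]
      · rw [eulerChar, Fin.sum_univ_three]
        change 2 - ((1 - 1 / ((2 : ℕ) : ℝ)) + (1 - 1 / ((4 : ℕ) : ℝ)) + (1 - 1 / ((4 : ℕ) : ℝ))) = 0
        norm_num
    · refine infinite_setOf_antiCanHeight_le a hm1 σ.injective (M := ![2, 3, 6]) (by decide) ?_ ?_
        (exists_infinite_phi_le_236 _ hinj)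
      · intro j
        fin_cases j
        exacts [h0, h1, h2]
      · rw [eulerChar, Fin.sum_univ_three]
        change 2 - ((1 - 1 / ((2 : ℕ) : ℝ)) + (1 - 1 / ((3 : ℕ) : ℝ)) + (1 - 1 / ((6 : ℕ) : ℝ))) = 0
        norm_num
  · exact infinite_setOf_antiCanHeight_le a hm1 (Fin.castLE_injective h4) (M := fun _ => 2)
      (fun _ => one_le_two) (fun j => hm _) (by norm_num [eulerChar])
      (exists_infinite_phi_le_of_four _ (ha.comp (Fin.castLE_injective h4)))

theorem not_northcott_antiCanHeight {n : ℕ} (a : Fin n → P1Q) (ha : Function.Injective a)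
    {m : Fin n → ℕ} (hm : ∀ i, 2 ≤ m i) (h : eulerChar m ≤ 0) : ¬ Northcott (antiCanHeight a m) := by
  obtain ⟨T, hT⟩ := exists_infinite_antiCanHeight_le a ha hm h
  exact fun hN => hT (hN.finite_le T)

end
end StackyCurve

/-! ### Algebraic points of the projective line -/

namespace StackyCurve
noncomputable section
open NumberField Height

section
variable {K : Type*} [Field K] [NumberField K]

theorem absNorm_span_intCast (z : ℤ) :
    Ideal.absNorm (Ideal.span {(z : 𝓞 K)}) = z.natAbs ^ Module.finrank ℚ K := by
  rw [Ideal.absNorm_span_singleton, ← eq_intCast (algebraMap ℤ (𝓞 K)), Algebra.norm_algebraMap,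
    Int.natAbs_pow, RingOfIntegers.rank]

/-- The coordinates generate the principal ideal of `t`, whose norm cancels in the quotient. -/
theorem absNorm_div_absNorm {v : Fin 2 → 𝓞 K} {w : Fin 2 → ℤ} (hw : IsCoprime (w 0) (w 1)) {t : 𝓞 K}
    (ht : t ≠ 0) (hv : ∀ i, v i = t * w i) (a : Fin 2 → ℤ) :
    Ideal.absNorm (Ideal.span {(a 0 : 𝓞 K) * v 1 - a 1 * v 0}) / Ideal.absNorm (Ideal.span {v 0, v 1}) =
      (pairing a w).natAbs ^ Module.finrank ℚ K := by
  have h1 : Ideal.span {v 0, v 1} = Ideal.span {t} := by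
    apply le_antisymm
    · rw [Ideal.span_le]
      rintro _ (rfl | rfl)
      · exact Ideal.mem_span_singleton.2 (Dvd.intro _ (hv 0).symm)
      · exact Ideal.mem_span_singleton.2 (Dvd.intro _ (hv 1).symm)
    · rw [Ideal.span_singleton_le_iff_mem, Ideal.mem_span_pair]
      obtain ⟨x, y, hxy⟩ := hw
      refine ⟨x, y, ?_⟩
      rw [hv, hv]
      have : ((x * w 0 + y * w 1 : ℤ) : 𝓞 K) = 1 := by rw [hxy, Int.cast_one]
      push_cast at this
      linear_combination t * this
  have h2 : (a 0 : 𝓞 K) * v 1 - a 1 * v 0 = t * (pairing a w : ℤ) := by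
    rw [hv, hv, pairing]
    push_cast
    ring
  have h3 : Ideal.absNorm (Ideal.span {t}) ≠ 0 := by
    rw [Ne, Ideal.absNorm_eq_zero_iff, Ideal.span_singleton_eq_bot]
    exact ht
  rw [h1, h2, ← Ideal.span_singleton_mul_span_singleton, map_mul, absNorm_span_intCast,
    Nat.mul_div_cancel_left _ (Nat.pos_of_ne_zero h3)]

theorem mulHeight_eq_max_pow {v : Fin 2 → 𝓞 K} {w : Fin 2 → ℤ} (hw : IsCoprime (w 0) (w 1)) {t : 𝓞 K}
    (ht : t ≠ 0) (hv : ∀ i, v i = t * w i) :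
    mulHeight (fun i => (v i : K)) = (max |(w 0 : ℝ)| |(w 1 : ℝ)|) ^ Module.finrank ℚ K := by
  have h1 : (fun i => (v i : K)) = (t : K) • fun i => algebraMap ℚ K ((((↑) : ℤ → ℚ) ∘ w) i) := by
    funext i
    rw [hv, Pi.smul_apply, smul_eq_mul]
    simp
  have hg : Finset.univ.gcd w = 1 := by
    have h : ∀ i, Finset.univ.gcd w ∣ w i := fun i => Finset.gcd_dvd (Finset.mem_univ i)
    exact (Finset.normalize_gcd (s := Finset.univ) (f := w)).symm.trans
      (normalize_eq_one.2 (hw.isUnit_of_dvd' (h 0) (h 1)))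
  have h3 : ⨆ i, |w i| = max |w 0| |w 1| := by
    refine le_antisymm (ciSup_le fun i => ?_) (max_le ?_ ?_)
    · fin_cases i
      · exact le_max_left _ _
      · exact le_max_right _ _
    · exact Finite.le_ciSup (fun i => |w i|) 0
    · exact Finite.le_ciSup (fun i => |w i|) 1
  rw [h1, mulHeight_smul_eq_mulHeight _ (by simpa using ht), mulHeight_algebraMap,
    Rat.mulHeight_eq_max_abs_of_gcd_eq_one hg, h3]
  push_cast
  rfl

end

theorem exists_rep_eq_integralCoords (P : P1Qbar) : ∃ c : Qbar, c ≠ 0 ∧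
    ∀ i, P.rep i = c * ((integralCoords P i : fieldOfDef P) : Qbar) :=
  (exists_integral_coords P).choose_spec

theorem intCast_comp_ne_zero {w : Fin 2 → ℤ} (hw : IsCoprime (w 0) (w 1)) :
    (fun i => (w i : Qbar)) ≠ 0 := fun h => by
  have h1 : ∀ i, w i = 0 := fun i => by simpa using congrFun h i
  rw [h1, h1] at hw
  exact not_isCoprime_zero_zero hw

/-- A rational point of the projective line as an algebraic point. -/
def toBar (P : P1Q) : P1Qbar :=
  Projectivization.mk Qbar _ (intCast_comp_ne_zero (coords_isCoprime P))

theorem toBar_injective : Function.Injective toBar := by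
  intro P Q h
  obtain ⟨c, hc⟩ := (Projectivization.mk_eq_mk_iff' _ _ _ _ _).1 h
  by_contra hne
  apply pairing_coords_ne_zero hne
  have h0 : c * (coords Q 0 : Qbar) = coords P 0 := congrFun hc 0
  have h1 : c * (coords Q 1 : Qbar) = coords P 1 := congrFun hc 1
  have : ((pairing (coords P) (coords Q) : ℤ) : Qbar) = 0 := by
    rw [pairing]
    push_cast
    rw [← h0, ← h1]
    ring
  exact_mod_cast this

theorem exists_rep_toBar_eq (P : P1Q) :
    ∃ u : Qbar, u ≠ 0 ∧ ∀ i, (toBar P).rep i = u * (coords P i : Qbar) := by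
  obtain ⟨u, hu⟩ := Projectivization.exists_smul_eq_mk_rep Qbar _
    (intCast_comp_ne_zero (coords_isCoprime P))
  exact ⟨u, u.ne_zero, fun i => (congrFun hu i).symm⟩

theorem degP1_toBar (P : P1Q) : degP1 (toBar P) = 1 := by
  obtain ⟨u, hu, hP⟩ := exists_rep_toBar_eq P
  have h : fieldOfDef (toBar P) = ⊥ := by
    rw [fieldOfDef, IntermediateField.adjoin_eq_bot_iff]
    rintro _ ⟨⟨i, j⟩, rfl⟩
    change (toBar P).rep i / (toBar P).rep j ∈ _
    rw [hP, hP, mul_div_mul_left _ _ hu]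
    exact div_mem (intCast_mem _ _) (intCast_mem _ _)
  rw [degP1, h, IntermediateField.finrank_bot]

/-- The field of definition has degree one, and the chosen integral coordinates are an integral
multiple of the coprime ones; the multiple cancels in all factors. -/
theorem antiCanHeightBar_toBar {n : ℕ} (a : Fin n → P1Q) (m : Fin n → ℕ) (P : P1Q) :
    antiCanHeightBar a m (toBar P) = antiCanHeight a m P := by
  obtain ⟨u, hu, hP⟩ := exists_rep_toBar_eq P
  obtain ⟨c, hc, hQ⟩ := exists_rep_eq_integralCoords (toBar P)
  set v := integralCoords (toBar P) with hv
  have hcop := coords_isCoprime P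
  obtain ⟨x, y, hxy⟩ := hcop
  have h1 : ∀ i, ((v i : fieldOfDef (toBar P)) : Qbar) = u / c * coords P i := fun i => by
    have h := hP i
    rw [hQ i] at h
    field_simp
    linear_combination h
  set t : 𝓞 (fieldOfDef (toBar P)) := x * v 0 + y * v 1 with ht
  have h2 : ((t : fieldOfDef (toBar P)) : Qbar) = u / c := by
    have h3 : ((t : fieldOfDef (toBar P)) : Qbar) =
        x * ((v 0 : fieldOfDef (toBar P)) : Qbar) + y * ((v 1 : fieldOfDef (toBar P)) : Qbar) := by
      simp [ht]
    have h4 : ((x * coords P 0 + y * coords P 1 : ℤ) : Qbar) = 1 := by rw [hxy, Int.cast_one]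
    push_cast at h4
    rw [h3, h1, h1]
    linear_combination (u / c) * h4
  have ht0 : t ≠ 0 := by
    intro h
    rw [h] at h2
    exact div_ne_zero hu hc (by rw [← h2]; simp)
  have hvt : ∀ i, v i = t * coords P i := fun i => by
    apply RingOfIntegers.ext
    apply Subtype.ext
    rw [h1, ← h2]
    simp
  have hd : Module.finrank ℚ (fieldOfDef (toBar P)) = 1 := degP1_toBar P
  rw [antiCanHeightBar, antiCanHeight, ← hv, mulHeight_eq_max_pow (coords_isCoprime P) ht0 hvt, hd,
    pow_one]
  congr 1
  refine Finset.prod_congr rfl fun i _ => ?_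
  rw [intersectionNorm, ← hv, absNorm_div_absNorm (coords_isCoprime P) ht0 hvt, hd, pow_one]
  rfl

theorem not_strongNorthcott_antiCanHeightBar {n : ℕ} (a : Fin n → P1Q) (ha : Function.Injective a)
    {m : Fin n → ℕ} (hm : ∀ i, 2 ≤ m i) (h : eulerChar m ≤ 0) :
    ¬ StrongNorthcott degP1 (antiCanHeightBar a m) := by
  obtain ⟨T, hT⟩ := exists_infinite_antiCanHeight_le a ha hm h
  intro hN
  refine hT (Set.Finite.subset ((hN (max T 1) 1 (by positivity) one_pos).preimage
    toBar_injective.injOn) fun P hP => ?_)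
  refine ⟨?_, (degP1_toBar P).le⟩
  rw [antiCanHeightBar_toBar]
  exact le_trans hP (le_max_left _ _)

theorem ht_rep_le (P : P1Qbar) :
    ht P.rep ≤ mulHeight (fun i => (integralCoords P i : fieldOfDef P)) := by
  obtain ⟨c, hc, hQ⟩ := exists_rep_eq_integralCoords P
  have h1 := ht_pow_finrank (fieldOfDef P).val.toRingHom
    (fun i => (integralCoords P i : fieldOfDef P))
  rw [← h1]
  have h2 : P.rep = fun i => c * (fieldOfDef P).val.toRingHom (integralCoords P i : fieldOfDef P) :=
    funext hQ
  rw [h2, ht_smul _ hc]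
  exact le_self_pow₀ (one_le_ht _) Module.finrank_pos.ne'

theorem strongNorthcott_antiCanHeightBar {n : ℕ} (a : Fin n → P1Q) {m : Fin n → ℕ}
    (hm : ∀ i, 2 ≤ m i) (h : 0 < eulerChar m) : StrongNorthcott degP1 (antiCanHeightBar a m) := by
  intro T D hT _
  -- The local factors are at least `1`, and the Weil height relative to the field of definition
  -- dominates the absolute one.
  have key : ∀ P : P1Qbar, antiCanHeightBar a m P ≤ T → ht P.rep ≤ T ^ (eulerChar m)⁻¹ := by
    intro P hP
    refine (ht_rep_le P).trans ?_
    have h0 := (mulHeight_pos fun i => (integralCoords P i : fieldOfDef P)).le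
    rw [← Real.rpow_le_rpow_iff h0 (by positivity) h, ← Real.rpow_mul hT.le,
      inv_mul_cancel₀ h.ne', Real.rpow_one]
    exact (le_mul_of_one_le_right (Real.rpow_nonneg h0 _) (one_le_prod_phi hm _)).trans hP
  have h1 : ({P : P1Qbar | antiCanHeightBar a m P ≤ T ∧ degP1 P ≤ D} ∩ {P | P.rep 0 ≠ 0}).Finite := by
    refine Set.Finite.of_finite_image (f := fun P => P.rep 1 / P.rep 0)
      ((finite_setOf_ht_le (T ^ (eulerChar m)⁻¹) D).subset ?_) ?_
    · rintro _ ⟨P, ⟨⟨hP, hd⟩, h0⟩, rfl⟩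
      refine ⟨?_, ?_⟩
      · refine le_trans (le_of_eq ?_) (key P hP)
        rw [← ht_smul P.rep (inv_ne_zero h0)]
        congr 1
        funext i
        fin_cases i
        · exact (inv_mul_cancel₀ h0).symm
        · exact div_eq_inv_mul _ _
      · refine le_trans ?_ hd
        have hx : P.rep 1 / P.rep 0 ∈ fieldOfDef P :=
          IntermediateField.subset_adjoin ℚ _ ⟨(1, 0), rfl⟩
        have := minpoly.natDegree_le (A := ℚ) (⟨_, hx⟩ : fieldOfDef P)
        rwa [← minpoly.algebraMap_eq (algebraMap (fieldOfDef P) Qbar).injective] at this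
    · rintro P ⟨-, h0⟩ Q ⟨-, h0'⟩ hPQ
      rw [← P.mk_rep, ← Q.mk_rep, Projectivization.mk_eq_mk_iff']
      refine ⟨P.rep 0 / Q.rep 0, funext fun i => ?_⟩
      have hPQ' : P.rep 1 / P.rep 0 = Q.rep 1 / Q.rep 0 := hPQ
      fin_cases i
      · exact div_mul_cancel₀ _ h0'
      · change P.rep 0 / Q.rep 0 * Q.rep 1 = P.rep 1
        rw [div_mul_eq_mul_div, mul_div_assoc, ← hPQ', mul_div_cancel₀ _ h0]
  -- The ratio of coordinates misses only the single point with first coordinate zero.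
  have h2 : {P : P1Qbar | P.rep 0 = 0}.Subsingleton := by
    intro P hP Q hQ
    have hne : ∀ R : P1Qbar, R.rep 0 = 0 → R.rep 1 ≠ 0 := fun R hR h3 => R.rep_nonzero (by
      funext i
      fin_cases i
      exacts [hR, h3])
    rw [← P.mk_rep, ← Q.mk_rep, Projectivization.mk_eq_mk_iff']
    refine ⟨P.rep 1 / Q.rep 1, funext fun i => ?_⟩
    fin_cases i
    · change P.rep 1 / Q.rep 1 * Q.rep 0 = P.rep 0
      rw [hQ, hP, mul_zero]
    · exact div_mul_cancel₀ _ (hne Q hQ)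
  refine (h1.union h2.finite).subset fun P hP => ?_
  by_cases h0 : P.rep 0 = 0
  · exact Or.inr h0
  · exact Or.inl ⟨hP, h0⟩

end
end StackyCurve

/-! ### The theorem -/

theorem mainTheorem2 :
    (∀ (n : ℕ) (a : Fin n → StackyCurve.P1Q) (m : Fin n → ℕ),
      Function.Injective a → (∀ i, 2 ≤ m i) →
        (StackyCurve.eulerChar m ≤ 0 → ¬ Northcott (StackyCurve.antiCanHeight a m)) ∧
        (Northcott (StackyCurve.antiCanHeight a m) ↔ 0 < StackyCurve.eulerChar m) ∧
        (StackyCurve.StrongNorthcott StackyCurve.degP1 (StackyCurve.antiCanHeightBar a m) ↔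
          0 < StackyCurve.eulerChar m)) ∧
    (∀ (C : StackyCurve.Curve) (K : C.X →₀ ℤ) (H : C.GeomPoint → ℝ),
      C.IsCanonical K → StackyCurve.Curve.IsWeilHeight (-K) H →
        (StackyCurve.StrongNorthcott StackyCurve.Curve.GeomPoint.deg H ↔
          0 < C.degDiv (-K))) := by
  refine ⟨fun n a m ha hm => ?_, fun C K H _ hH => hH.strongNorthcott_iff⟩
  have h1 : StackyCurve.eulerChar m ≤ 0 → ¬ Northcott (StackyCurve.antiCanHeight a m) :=
    StackyCurve.not_northcott_antiCanHeight a ha hm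
  refine ⟨h1, ⟨fun h => ?_, StackyCurve.northcott_antiCanHeight a hm⟩,
    ⟨fun h => ?_, StackyCurve.strongNorthcott_antiCanHeightBar a hm⟩⟩
  · exact not_le.1 fun h0 => h1 h0 h
  · exact not_le.1 fun h0 => StackyCurve.not_strongNorthcott_antiCanHeightBar a ha hm h0 h
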